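/- Let $(M,g)$ be an oriented smooth space-time of dimension 4 and signature $(-,+,+,+)$ with metric volume element $\eta$, and let $U$ be the canonical 2-form of a 2+2 almost-product structure: a smooth 2-form that at each point is the volume element of a time-like plane $V$. The projectors on $V$ and on $H=V^\perp$ are $v=U\cdot U$ and $h=g-v$, where $(A\cdot B)_{\alpha\beta}=A_\alpha{}^{\mu}B_{\mu\beta}$. Suppose the structure is umbilical: for both planes the symmetric part of the second fundamental form, $Q_v(x,y)=h(\nabla_{v(x)}v(y))$ for $V$ and $Q_h(x,y)=v(\nabla_{h(x)}h(y))$ for $H$, is pure trace, i.e. equal to $\frac12 v\otimes \mathrm{tr}\,Q_v$ and $\frac12 h\otimes\mathrm{tr}\,Q_h$ respectively. Notation. $\mathcal U=\frac1{\sqrt2}(U-\mathrm i*U)$ is the canonical self-dual bivector, $\xi=\delta\,\mathcal U$ (that is, $\xi_\beta=-\nabla^\alpha\mathcal U_{\alpha\beta}$), $\chi=i_\xi\mathcal U$ (that is, $\chi_\beta=\xi^\alpha\mathcal U_{\alpha\beta}$), $T_{\alpha\beta}=\nabla_\alpha\xi_\beta-\chi_\alpha\xi_\beta$, and $A=\frac12(T-T^t)$,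 $S=\frac12(T+T^t)$. For 2-forms, $(F,K)=\frac12F_{\alpha\beta}K^{\alpha\beta}$; for double 2-forms, $P(F)_{\alpha\beta}=\frac12P_{\alpha\beta}{}^{\mu\nu}F_{\mu\nu}$ and $(P\circ Q)_{\alpha\beta\rho\sigma}=\frac12P_{\alpha\beta}{}^{\mu\nu}Q_{\mu\nu\rho\sigma}$; for 2-tensors, $[B,C]=B\cdot C-C\cdot B$ and $(B\wedge C)_{\alpha\beta\mu\nu}=B_{\alpha\mu}C_{\beta\nu}+B_{\beta\nu}C_{\alpha\mu}-B_{\alpha\nu}C_{\beta\mu}-B_{\beta\mu}C_{\alpha\nu}$. Put $G=\frac12g\wedge g$, $\mathcal G=\frac12(G-\mathrm i\,\eta)$, $\mathcal G_\perp=\mathcal U\otimes\mathcal U+\mathcal G$, $F_\perp=\mathcal G_\perp(F)$ and $P_\perp=\mathcal G_\perp\circ P\circ\mathcal G_\perp$. For a tensor $Rm_{\alpha\beta\mu\nu}$ with the algebraic symmetries of a Riemann tensor (antisymmetry in each pair of indices and the first Bianchi identity), let $Ric_{\beta\nu}=g^{\alpha\mu}Rm_{\alpha\beta\mu\nu}$,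 let $R$ be the trace of $Ric$, $W=Rm-\frac12(Ric-\frac R6g)\wedge g$ and $\mathcal W=\mathcal G\circ W\circ\mathcal G$. Theorem. At every point of $M$, and for every (real or complex) tensor $Rm$ with the algebraic symmetries of a Riemann tensor at that point, the Ricci identities $$\nabla_\alpha\nabla_\beta\,\mathcal U_{\mu\nu}-\nabla_\beta\nabla_\alpha\,\mathcal U_{\mu\nu}=\mathcal U_\mu{}^{\lambda}Rm_{\lambda\nu\beta\alpha}-\mathcal U_\nu{}^{\lambda}Rm_{\lambda\mu\beta\alpha}$$ hold if and only if the following three equations hold: $$\mathcal W_\perp=\Omega\,\mathcal G_\perp\quad\text{with}\quad\Omega=-\Big[\frac R{12}+(A,\mathcal U)\Big],\qquad \mathcal W(\mathcal U)_\perp=-A_\perp,\qquad [\mathcal U,Ric]=2\,\mathcal U\cdot S\cdot\mathcal U-S .$$ In particular, the Riemann tensor of $g$ has the algebraic symmetries and satisfies the Ricci identities, and so the three equations hold when $\mathcal W$, $Ric$ and $R$ are the self-dual Weyl tensor, the Ricci tensor and the scalar curvature of $(M,g)$. -/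

import Mathlib

open scoped Manifold ContDiff

noncomputable section

namespace TwoPlusTwo

/-- The model space of a four-dimensional manifold. -/
abbrev E4 := EuclideanSpace ℝ (Fin 4)

/-! ## Components of tensors

All components are taken to be complex numbers; a real tensor is a tensor whose components happen
to be real. Unless stated otherwise the indices of a tensor are lowered. -/

/-- Components of a covector. -/
abbrev Tensor1 := Fin 4 → ℂ
/-- Components of a covariant 2-tensor. -/
abbrev Tensor2 := Fin 4 → Fin 4 → ℂ
/-- Components of a covariant 3-tensor. -/
abbrev Tensor3 := Fin 4 → Fin 4 → Fin 4 → ℂ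
/-- Components of a covariant 4-tensor. -/
abbrev Tensor4 := Fin 4 → Fin 4 → Fin 4 → Fin 4 → ℂ

/-! ### Algebra at a point; `g` denotes the components of the metric -/

/-- The components `g^{ab}` of the inverse metric. -/
def inv (g : Tensor2) : Tensor2 := fun a b => (Matrix.of g)⁻¹ a b

/-- `(A · B)_{ab} = A_a^m B_{mb}`. -/
def dot (g A B : Tensor2) : Tensor2 := fun a b => ∑ m, ∑ n, A a m * inv g m n * B n b

/-- The commutator `[A, B] = A · B - B · A`. -/
def comm (g A B : Tensor2) : Tensor2 := fun a b => dot g A B a b - dot g B A a b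

/-- The trace `g^{ab} A_{ab}`. -/
def tr (g A : Tensor2) : ℂ := ∑ a, ∑ b, inv g a b * A a b

/-- The antisymmetric part `(T - Tᵗ) / 2`. -/
def antisymPart (T : Tensor2) : Tensor2 := fun a b => (T a b - T b a) / 2

/-- The symmetric part `(T + Tᵗ) / 2`. -/
def symPart (T : Tensor2) : Tensor2 := fun a b => (T a b + T b a) / 2

/-- `(A ∧ B)_{abmn} = A_{am} B_{bn} + A_{bn} B_{am} - A_{an} B_{bm} - A_{bm} B_{an}`. -/
def wedge (A B : Tensor2) : Tensor4 := fun a b m n =>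
  A a m * B b n + A b n * B a m - A a n * B b m - A b m * B a n

/-- The metric `G = (1/2) g ∧ g` on 2-forms. -/
def formMetric (g : Tensor2) : Tensor4 := fun a b m n => wedge g g a b m n / 2

/-- The product `(F, H) = (1/2) F_{ab} H^{ab}` of 2-forms. -/
def formInner (g F H : Tensor2) : ℂ :=
  (∑ a, ∑ b, ∑ m, ∑ n, F a b * inv g a m * inv g b n * H m n) / 2

/-- `P(F)_{ab} = (1/2) P_{ab}^{mn} F_{mn}` for a double 2-form `P` and a 2-form `F`. -/
def dapply (g : Tensor2) (P : Tensor4) (F : Tensor2) : Tensor2 := fun a b =>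
  (∑ m, ∑ n, ∑ p, ∑ q, P a b p q * inv g p m * inv g q n * F m n) / 2

/-- `(P ∘ Q)_{abrs} = (1/2) P_{ab}^{mn} Q_{mnrs}` for double 2-forms `P`, `Q`. -/
def dcomp (g : Tensor2) (P Q : Tensor4) : Tensor4 := fun a b r s =>
  (∑ m, ∑ n, ∑ p, ∑ q, P a b p q * inv g p m * inv g q n * Q m n r s) / 2

/-- The Hodge dual `(*F)_{ab} = (1/2) η_{abmn} F^{mn}` of a 2-form, `η` being the volume element. -/
def hodge (g : Tensor2) (η : Tensor4) (F : Tensor2) : Tensor2 := dapply g η F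

/-- The self-dual bivector `(F - i *F) / √2` of a 2-form `F`. -/
def sdBivector (g : Tensor2) (η : Tensor4) (F : Tensor2) : Tensor2 := fun a b =>
  (F a b - Complex.I * hodge g η F a b) / (Real.sqrt 2 : ℂ)

/-- The metric `𝒢 = (1/2) (G - i η)` on the space of self-dual bivectors. -/
def sdMetric (g : Tensor2) (η : Tensor4) : Tensor4 := fun a b m n =>
  (formMetric g a b m n - Complex.I * η a b m n) / 2

/-- `𝒢_⊥ = 𝒰 ⊗ 𝒰 + 𝒢`. -/
def sdMetricPerp (g : Tensor2) (η : Tensor4) (SU : Tensor2) : Tensor4 := fun a b m n =>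
  SU a b * SU m n + sdMetric g η a b m n

/-- `F_⊥ = 𝒢_⊥(F)` for a 2-form `F`. -/
def formPerp (g : Tensor2) (η : Tensor4) (SU F : Tensor2) : Tensor2 :=
  dapply g (sdMetricPerp g η SU) F

/-- `P_⊥ = 𝒢_⊥ ∘ P ∘ 𝒢_⊥` for a double 2-form `P`. -/
def doublePerp (g : Tensor2) (η : Tensor4) (SU : Tensor2) (P : Tensor4) : Tensor4 :=
  dcomp g (dcomp g (sdMetricPerp g η SU) P) (sdMetricPerp g η SU)

/-- Tensors with the algebraic symmetries of a Riemann tensor. -/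
structure IsCurvatureLike (Rm : Tensor4) : Prop where
  antisymm_left : ∀ a b c d, Rm a b c d = -Rm b a c d
  antisymm_right : ∀ a b c d, Rm a b c d = -Rm a b d c
  bianchi : ∀ a b c d, Rm a b c d + Rm a c d b + Rm a d b c = 0

/-- The Ricci tensor `Ric_{sb} = g^{ra} Rm_{rsab}`. -/
def ricci (g : Tensor2) (Rm : Tensor4) : Tensor2 := fun s b =>
  ∑ r, ∑ a, inv g r a * Rm r s a b

/-- The scalar curvature. -/
def scalar (g : Tensor2) (Rm : Tensor4) : ℂ := tr g (ricci g Rm)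

/-- The Weyl tensor `W`, defined by `Rm = W + (1/2) (Ric - (R/6) g) ∧ g` (in dimension four). -/
def weyl (g : Tensor2) (Rm : Tensor4) : Tensor4 := fun a b m n =>
  Rm a b m n -
    wedge (fun c d => (ricci g Rm c d - scalar g Rm / 6 * g c d) / 2) g a b m n

/-- The self-dual Weyl tensor `𝒲 = 𝒢 ∘ W ∘ 𝒢`. -/
def sdWeyl (g : Tensor2) (η : Tensor4) (Rm : Tensor4) : Tensor4 :=
  dcomp g (dcomp g (sdMetric g η) (weyl g Rm)) (sdMetric g η)

/-! ### Calculus in a chart; `g` denotes the components of the metric as functions on `E4` -/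

/-- The partial derivative `∂_a f`. -/
def pd (f : E4 → ℂ) (a : Fin 4) (y : E4) : ℂ := fderiv ℝ f y (EuclideanSpace.single a 1)

/-- The Christoffel symbols `Γ^c_{ab}` of the Levi-Civita connection. -/
def christoffel (g : E4 → Tensor2) (y : E4) (c a b : Fin 4) : ℂ :=
  (∑ d, inv (g y) c d *
    (pd (fun z => g z b d) a y + pd (fun z => g z a d) b y - pd (fun z => g z a b) d y)) / 2

/-- `∇_a w_b`. -/
def nabla1 (g : E4 → Tensor2) (w : E4 → Tensor1) (y : E4) : Tensor2 := fun a b =>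
  pd (fun z => w z b) a y - ∑ c, christoffel g y c a b * w y c

/-- `∇_a F_{mn}`. -/
def nabla2 (g : E4 → Tensor2) (F : E4 → Tensor2) (y : E4) : Tensor3 := fun a m n =>
  pd (fun z => F z m n) a y - ∑ c, christoffel g y c a m * F y c n
    - ∑ c, christoffel g y c a n * F y m c

/-- `∇_a H_{bmn}`. -/
def nabla3 (g : E4 → Tensor2) (H : E4 → Tensor3) (y : E4) : Tensor4 := fun a b m n =>
  pd (fun z => H z b m n) a y - ∑ c, christoffel g y c a b * H y c m n
    - ∑ c, christoffel g y c a m * H y b c n - ∑ c, christoffel g y c a n * H y b m c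

/-- The Riemann tensor `R_{rsab}`, with the convention
`R^k_{sab} = ∂_a Γ^k_{bs} - ∂_b Γ^k_{as} + Γ^k_{al} Γ^l_{bs} - Γ^k_{bl} Γ^l_{as}`. -/
def riemann (g : E4 → Tensor2) (y : E4) : Tensor4 := fun r s a b =>
  ∑ k, g y r k *
    (pd (fun z => christoffel g z k b s) a y - pd (fun z => christoffel g z k a s) b y
      + ∑ l, christoffel g y k a l * christoffel g y l b s
      - ∑ l, christoffel g y k b l * christoffel g y l a s)

/-- The codifferential `(δF)_b = -∇^a F_{ab}` of a 2-form; in Lorentzian signature and dimension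
four this is `*d*`. -/
def codiff (g : E4 → Tensor2) (F : E4 → Tensor2) (y : E4) : Tensor1 := fun b =>
  -∑ a, ∑ c, inv (g y) a c * nabla2 g F y c a b

/-- `(i_ξ F)_b = ξ^a F_{ab}` for the covector `ξ`. -/
def interior (g : Tensor2) (ξ : Tensor1) (F : Tensor2) : Tensor1 := fun b =>
  ∑ a, ∑ c, ξ c * inv g c a * F a b

/-- `T = ∇ξ - χ ⊗ ξ`, where `ξ = δ𝒰` and `χ = i_ξ 𝒰`. -/
def tensorT (g SU : E4 → Tensor2) (y : E4) : Tensor2 := fun a b =>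
  nabla1 g (codiff g SU) y a b - interior (g y) (codiff g SU y) (SU y) a * codiff g SU y b

/-- The Ricci identities for `𝒰` at `y`, with `Rm` in the place of the curvature tensor:
`∇_a ∇_b 𝒰_{mn} - ∇_b ∇_a 𝒰_{mn} = 𝒰_m^l Rm_{lnba} - 𝒰_n^l Rm_{lmba}`. -/
def RicciIdentities (g SU : E4 → Tensor2) (y : E4) (Rm : Tensor4) : Prop :=
  ∀ a b m n : Fin 4,
    nabla3 g (nabla2 g SU) y a b m n - nabla3 g (nabla2 g SU) y b a m n =
      (∑ k, ∑ l, SU y m k * inv (g y) k l * Rm l n b a)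
        - ∑ k, ∑ l, SU y n k * inv (g y) k l * Rm l m b a

/-- `Ω = -[R/12 + (A, 𝒰)]`, `A` being the antisymmetric part of `T`. -/
def omega (g SU : E4 → Tensor2) (y : E4) (Rm : Tensor4) : ℂ :=
  -(scalar (g y) Rm / 12 + formInner (g y) (antisymPart (tensorT g SU y)) (SU y))

/-- The three equations at `y` for the self-dual Weyl tensor, the Ricci tensor and the scalar
curvature of `Rm`:
`𝒲_⊥ = Ω 𝒢_⊥`, `𝒲(𝒰)_⊥ = -A_⊥` and `[𝒰, Ric] = 2 𝒰 · S · 𝒰 - S`,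
where `A` and `S` are the antisymmetric and symmetric parts of `T`. -/
structure IntegrabilityEquations (g : E4 → Tensor2) (η : E4 → Tensor4) (SU : E4 → Tensor2)
    (y : E4) (Rm : Tensor4) : Prop where
  weyl_perp : ∀ a b m n,
    doublePerp (g y) (η y) (SU y) (sdWeyl (g y) (η y) Rm) a b m n =
      omega g SU y Rm * sdMetricPerp (g y) (η y) (SU y) a b m n
  weyl_mixed : ∀ a b,
    formPerp (g y) (η y) (SU y) (dapply (g y) (sdWeyl (g y) (η y) Rm) (SU y)) a b =
      -formPerp (g y) (η y) (SU y) (antisymPart (tensorT g SU y)) a b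
  ricci_comm : ∀ a b,
    comm (g y) (SU y) (ricci (g y) Rm) a b =
      2 * dot (g y) (dot (g y) (SU y) (symPart (tensorT g SU y))) (SU y) a b
        - symPart (tensorT g SU y) a b

/-- The generalized second fundamental form of the 2-plane with projector `v` (lowered indices):
the `e`-th contravariant component of `h(∇_{v(∂_a)} v(∂_b))`, where `h = g - v`. -/
def secondForm (g v : E4 → Tensor2) (y : E4) (a b e : Fin 4) : ℂ :=
  ∑ d, (∑ k, inv (g y) e k * (g y k d - v y k d)) *
    ∑ c, (∑ k, inv (g y) c k * v y k a) *
      (pd (fun z => ∑ k, inv (g z) d k * v z k b) c y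
        + ∑ l, christoffel g y d c l * ∑ k, inv (g y) l k * v y k b)

/-- The 2-plane with projector `v` is umbilical at `y`: the symmetric part `S_v` of its second
fundamental form is `(1/2) v ⊗ tr S_v`. -/
def UmbilicalPlane (g v : E4 → Tensor2) (y : E4) : Prop :=
  ∀ a b e : Fin 4,
    (secondForm g v y a b e + secondForm g v y b a e) / 2 =
      v y a b * (∑ c, ∑ d, inv (g y) c d * secondForm g v y c d e) / 2

/-! ## Space-times and 2+2 structures -/

section Manifold

variable {M : Type*} [TopologicalSpace M] [ChartedSpace E4 M]

/-- The `i`-th coordinate vector of the chart `e` at the point with coordinates `y`. -/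
def coordVec (e : OpenPartialHomeomorph M E4) (y : E4) (i : Fin 4) :
    TangentSpace (𝓡 4) (e.symm y) :=
  mfderiv (𝓡 4) (𝓡 4) e.symm y (EuclideanSpace.single i (1 : ℝ) : E4)

/-- The components of a field of bilinear forms in the chart `e`. -/
def comp2 (B : ∀ x : M, LinearMap.BilinForm ℝ (TangentSpace (𝓡 4) x))
    (e : OpenPartialHomeomorph M E4) (y : E4) : Tensor2 := fun i j =>
  (B (e.symm y) (coordVec e y i) (coordVec e y j) : ℝ)

/-- The components of a field of alternating 4-forms in the chart `e`. -/
def comp4 (θ : ∀ x : M, (TangentSpace (𝓡 4) x) [⋀^Fin 4]→ₗ[ℝ] ℝ)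
    (e : OpenPartialHomeomorph M E4) (y : E4) : Tensor4 := fun i j k l =>
  (θ (e.symm y) ![coordVec e y i, coordVec e y j, coordVec e y k, coordVec e y l] : ℝ)

/-- The basis `b` is orthonormal for `B`, of signature `(-,+,+,+)`. -/
def IsLorentzFrame {V : Type*} [AddCommGroup V] [Module ℝ V] (B : LinearMap.BilinForm ℝ V)
    (b : Module.Basis (Fin 4) ℝ V) : Prop :=
  ∀ i j, B (b i) (b j) = if i = j then (if i = 0 then -1 else 1) else 0

variable (M) in
/-- An oriented space-time of signature `(-,+,+,+)`: a smooth Lorentz metric together with a smooth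
metric volume element (which amounts to the orientation). -/
structure SpaceTime where
  metric : ∀ x : M, LinearMap.BilinForm ℝ (TangentSpace (𝓡 4) x)
  lorentz : ∀ x, ∃ b : Module.Basis (Fin 4) ℝ (TangentSpace (𝓡 4) x), IsLorentzFrame (metric x) b
  metric_smooth : ∀ e ∈ atlas E4 M, ∀ i j,
    ContDiffOn ℝ ∞ (fun y => comp2 metric e y i j) e.target
  vol : ∀ x : M, (TangentSpace (𝓡 4) x) [⋀^Fin 4]→ₗ[ℝ] ℝ
  vol_unit : ∀ x (b : Module.Basis (Fin 4) ℝ (TangentSpace (𝓡 4) x)),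
    IsLorentzFrame (metric x) b → vol x b = 1 ∨ vol x b = -1
  vol_smooth : ∀ e ∈ atlas E4 M, ∀ i j k l,
    ContDiffOn ℝ ∞ (fun y => comp4 vol e y i j k l) e.target

/-- A 2+2 almost-product structure, given by its canonical 2-form `U`: a smooth 2-form which at each
point is the volume element of a time-like plane, that is, `U = e⁰ ∧ e¹` for the dual basis `eⁱ` of
some orthonormal frame (the plane is spanned by the first two vectors of the frame). -/
structure Structure22 (S : SpaceTime M) where
  form : ∀ x : M, LinearMap.BilinForm ℝ (TangentSpace (𝓡 4) x)
  unitary : ∀ x, ∃ b : Module.Basis (Fin 4) ℝ (TangentSpace (𝓡 4) x),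
    IsLorentzFrame (S.metric x) b ∧
      ∀ u w, form x u w = b.coord 0 u * b.coord 1 w - b.coord 1 u * b.coord 0 w
  form_smooth : ∀ e ∈ atlas E4 M, ∀ i j,
    ContDiffOn ℝ ∞ (fun y => comp2 form e y i j) e.target

/-- Components in a chart of the metric. -/
def SpaceTime.g (S : SpaceTime M) (e : OpenPartialHomeomorph M E4) : E4 → Tensor2 :=
  comp2 S.metric e

/-- Components in a chart of the volume element. -/
def SpaceTime.η (S : SpaceTime M) (e : OpenPartialHomeomorph M E4) : E4 → Tensor4 :=
  comp4 S.vol e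

variable {S : SpaceTime M}

/-- Components in a chart of the projector `v = U · U` on the time-like plane. -/
def Structure22.v (U : Structure22 S) (e : OpenPartialHomeomorph M E4) : E4 → Tensor2 := fun y =>
  dot (S.g e y) (comp2 U.form e y) (comp2 U.form e y)

/-- Components in a chart of the projector `h = g - v` on the space-like plane. -/
def Structure22.h (U : Structure22 S) (e : OpenPartialHomeomorph M E4) : E4 → Tensor2 := fun y =>
  fun a b => S.g e y a b - U.v e y a b

/-- Components in a chart of the canonical self-dual bivector `𝒰 = (U - i *U) / √2`. -/
def Structure22.sd (U : Structure22 S) (e : OpenPartialHomeomorph M E4) : E4 → Tensor2 := fun y =>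
  sdBivector (S.g e y) (S.η e y) (comp2 U.form e y)

/-- The structure is umbilical: both planes are umbilical at every point. -/
def Structure22.IsUmbilical (U : Structure22 S) : Prop :=
  ∀ e ∈ atlas E4 M, ∀ y ∈ e.target,
    UmbilicalPlane (S.g e) (U.v e) y ∧ UmbilicalPlane (S.g e) (U.h e) y

end Manifold

end TwoPlusTwo

end

namespace TwoPlusTwo

open Matrix
open scoped Kronecker

/-! ## Change of frame

`p i a` are the components of a coframe; `act1`, `act2`, `act4` send the frame components of a
tensor to its components. -/

/-! Everything is pointwise algebra in a complex null coframe adapted to the two planes, once the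
first derivative of `𝒰` is known on a whole chart. In such a coframe the metric pairs the indices 0
with 1 and 2 with 3, and `𝒰` is diagonal as an endomorphism, with eigenvalues `σ_a/√2` for the signs
`σ = (1,-1,1,-1)`. Contraction with `𝒰` therefore only multiplies components by signs, and `𝒢_⊥`
keeps the components of a 2-form whose two indices have equal sign, namely 02 and 13.

First derivative. Since `𝒰·𝒰 = g/2`, each `∇_a 𝒰` anticommutes with `𝒰`, so only the eight numbers
`∇_a 𝒰_{02}` and `∇_a 𝒰_{13}` can be nonzero. Umbilicity, tested on null vectors of either plane
(where the trace term vanishes), kills four of them; the other four are, up to sign, the components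
of `ξ = δ𝒰`. Hence `∇𝒰` is an explicit expression in `g`, `𝒰` and `ξ` (`nabla2_eq_umbilicForm`). The
link between umbilicity, which concerns the projector `v`, and `∇𝒰` is the identity `v = g/2 +
𝒰·𝒰'`, with `𝒰'` the conjugate bivector.

Second derivative. Differentiating that expression and antisymmetrizing gives the commutator of the
covariant derivatives as a linear expression in `T` (`nabla3_commutator`); the remaining terms
quadratic in `ξ` cancel by the algebraic identity `crossForm_quadratic`. The Ricci identities become
the equation `commutatorForm = curvatureForm`, which involves only `g`, `𝒰`, `T` and `Rm` at the
point.

Algebra. In null components this equation amounts to twelve scalar equations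
(`curvature_eqs_iff_null`) and the three integrability equations to eleven
(`pointEquations_iff_null`). The twelve are equivalent to the eleven together with `tr T = 0`,
because the component `Rm_{0213} = Rm_{1302}` is prescribed twice. The trace condition does not
involve `Rm`, and it holds because the genuine Riemann tensor satisfies the Ricci identities
(`MetricOn.ricciIdentities_riemann`, `tr_eq_zero_of_commutatorForm_eq`). So the equivalence holds
for every curvature-like `Rm` (`commutatorForm_eq_iff`).

Naturality of all operations under a change of frame carries the null-frame computations to
coordinate components. -/

abbrev Mat4 := Matrix (Fin 4) (Fin 4) ℂ

def act1 (p : Mat4) (w : Tensor1) : Tensor1 := fun a => ∑ i, p i a * w i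

def act2 (p : Mat4) (A : Tensor2) : Tensor2 := fun a b => ∑ i, ∑ j, p i a * p j b * A i j

/-- Nesting two copies of `act2` lets linearity and index swaps for 2-tensors be reused on each pair
of indices. -/
def act4 (p : Mat4) (P : Tensor4) : Tensor4 := fun a b c d =>
  act2 p (fun i j => act2 p (P i j) c d) a b

def doubleMat (P : Tensor4) : Matrix (Fin 4 × Fin 4) (Fin 4 × Fin 4) ℂ :=
  Matrix.of fun x y => P x.1 x.2 y.1 y.2

def formVec (F : Tensor2) : Fin 4 × Fin 4 → ℂ := fun x => F x.1 x.2

theorem of_act2 (p : Mat4) (A : Tensor2) : Matrix.of (act2 p A) = pᵀ * Matrix.of A * p := by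
  ext a b
  simp only [act2, Matrix.of_apply, Matrix.mul_apply, Matrix.transpose_apply, Finset.sum_mul]
  rw [Finset.sum_comm]
  exact Finset.sum_congr rfl fun _ _ => Finset.sum_congr rfl fun _ _ => by ring

theorem act1_eq_vecMul (p : Mat4) (w : Tensor1) : act1 p w = w ᵥ* p := by
  ext a
  simp [act1, Matrix.vecMul, dotProduct, mul_comm]

theorem of_inj {A B : Tensor2} (h : Matrix.of A = Matrix.of B) : A = B := h

theorem act2_act2 (p q : Mat4) (A : Tensor2) : act2 p (act2 q A) = act2 (q * p) A := by
  apply of_inj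
  simp only [of_act2, Matrix.transpose_mul, Matrix.mul_assoc]

theorem act2_one (A : Tensor2) : act2 1 A = A := by
  apply of_inj
  simp [of_act2]

theorem act1_act1 (p q : Mat4) (w : Tensor1) : act1 p (act1 q w) = act1 (q * p) w := by
  simp [act1_eq_vecMul, Matrix.vecMul_vecMul]

theorem act1_one (w : Tensor1) : act1 1 w = w := by
  simp [act1_eq_vecMul]

theorem act2_injective {p q : Mat4} (hpq : p * q = 1) : Function.Injective (act2 p) := by
  intro A B h
  have := congrArg (act2 q) h
  rwa [act2_act2, act2_act2, hpq, act2_one, act2_one] at this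

/-! ### Linearity, index permutations and tensor products under a change of frame -/

theorem act2_add (p : Mat4) (A B : Tensor2) (a b : Fin 4) :
    act2 p (fun i j => A i j + B i j) a b = act2 p A a b + act2 p B a b := by
  simp only [act2, mul_add, Finset.sum_add_distrib]

theorem act2_sub (p : Mat4) (A B : Tensor2) (a b : Fin 4) :
    act2 p (fun i j => A i j - B i j) a b = act2 p A a b - act2 p B a b := by
  simp only [act2, mul_sub, Finset.sum_sub_distrib]

theorem act2_neg (p : Mat4) (A : Tensor2) (a b : Fin 4) :
    act2 p (fun i j => -A i j) a b = -act2 p A a b := by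
  simp only [act2, mul_neg, Finset.sum_neg_distrib]

theorem act2_const_mul (p : Mat4) (c : ℂ) (A : Tensor2) (a b : Fin 4) :
    act2 p (fun i j => c * A i j) a b = c * act2 p A a b := by
  simp only [act2, Finset.mul_sum]
  exact Finset.sum_congr rfl fun _ _ => Finset.sum_congr rfl fun _ _ => by ring

theorem act2_mul_const (p : Mat4) (c : ℂ) (A : Tensor2) (a b : Fin 4) :
    act2 p (fun i j => A i j * c) a b = act2 p A a b * c := by
  simp only [mul_comm _ c, act2_const_mul]

theorem act2_div_const (p : Mat4) (c : ℂ) (A : Tensor2) (a b : Fin 4) :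
    act2 p (fun i j => A i j / c) a b = act2 p A a b / c := by
  simp only [div_eq_mul_inv, act2_mul_const]

theorem act2_swap (p : Mat4) (A : Tensor2) (a b : Fin 4) :
    act2 p (fun i j => A j i) a b = act2 p A b a := by
  simp only [act2]
  rw [Finset.sum_comm]
  exact Finset.sum_congr rfl fun _ _ => Finset.sum_congr rfl fun _ _ => by ring

theorem act2_tmul (p : Mat4) (u w : Tensor1) (a b : Fin 4) :
    act2 p (fun i j => u i * w j) a b = act1 p u a * act1 p w b := by
  simp only [act2, act1, Finset.sum_mul_sum]
  exact Finset.sum_congr rfl fun _ _ => Finset.sum_congr rfl fun _ _ => by ring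

theorem act4_add (p : Mat4) (P Q : Tensor4) (a b c d : Fin 4) :
    act4 p (fun i j k l => P i j k l + Q i j k l) a b c d = act4 p P a b c d + act4 p Q a b c d := by
  simp only [act4, act2_add]

theorem act4_sub (p : Mat4) (P Q : Tensor4) (a b c d : Fin 4) :
    act4 p (fun i j k l => P i j k l - Q i j k l) a b c d = act4 p P a b c d - act4 p Q a b c d := by
  simp only [act4, act2_sub]

theorem act4_neg (p : Mat4) (P : Tensor4) (a b c d : Fin 4) :
    act4 p (fun i j k l => -P i j k l) a b c d = -act4 p P a b c d := by
  simp only [act4, act2_neg]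

theorem act4_const_mul (p : Mat4) (c : ℂ) (P : Tensor4) (a b m n : Fin 4) :
    act4 p (fun i j k l => c * P i j k l) a b m n = c * act4 p P a b m n := by
  simp only [act4, act2_const_mul]

theorem act4_div_const (p : Mat4) (c : ℂ) (P : Tensor4) (a b m n : Fin 4) :
    act4 p (fun i j k l => P i j k l / c) a b m n = act4 p P a b m n / c := by
  simp only [act4, act2_div_const]

theorem act4_expand (p : Mat4) (P : Tensor4) (a b c d : Fin 4) :
    act4 p P a b c d =
      ∑ i, ∑ j, ∑ k, ∑ l, p i a * p j b * (p k c * p l d * P i j k l) := by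
  simp only [act4, act2, Finset.mul_sum]

theorem act4_swap_left (p : Mat4) (P : Tensor4) (a b m n : Fin 4) :
    act4 p (fun i j k l => P j i k l) a b m n = act4 p P b a m n :=
  act2_swap p (fun i j => act2 p (P i j) m n) a b

theorem act4_swap_right (p : Mat4) (P : Tensor4) (a b m n : Fin 4) :
    act4 p (fun i j k l => P i j l k) a b m n = act4 p P a b n m := by
  simp only [act4]
  congr 1
  funext i j
  exact act2_swap p (P i j) m n

theorem act4_swap_middle (p : Mat4) (P : Tensor4) (a b m n : Fin 4) :
    act4 p (fun i j k l => P i k j l) a b m n = act4 p P a m b n := by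
  simp only [act4_expand]
  refine Finset.sum_congr rfl fun _ _ => ?_
  rw [Finset.sum_comm]
  exact Finset.sum_congr rfl fun _ _ => Finset.sum_congr rfl fun _ _ =>
    Finset.sum_congr rfl fun _ _ => by ring

theorem act4_tmul (p : Mat4) (A B : Tensor2) (a b m n : Fin 4) :
    act4 p (fun i j k l => A i j * B k l) a b m n = act2 p A a b * act2 p B m n := by
  simp only [act4, act2_const_mul, act2_mul_const]

theorem act4_tmul_middle (p : Mat4) (A B : Tensor2) (a b m n : Fin 4) :
    act4 p (fun i j k l => A i k * B j l) a b m n = act2 p A a m * act2 p B b n := by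
  rw [act4_swap_middle p (fun i k j l => A i k * B j l), act4_tmul]

theorem act4_tmul_outer (p : Mat4) (A B : Tensor2) (a b m n : Fin 4) :
    act4 p (fun i j k l => A i l * B j k) a b m n = act2 p A a n * act2 p B b m := by
  rw [act4_swap_right p (fun i j k l => A i k * B j l), act4_tmul_middle]

/-! ### 2-forms as vectors and double 2-forms as matrices on pairs of indices -/

theorem doubleMat_injective : Function.Injective doubleMat := by
  intro P Q h
  funext a b c d
  exact congrFun (congrFun h (a, b)) (c, d)

theorem formVec_injective : Function.Injective formVec := by
  intro P Q h
  funext a b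
  exact congrFun h (a, b)

theorem doubleMat_act4 (p : Mat4) (P : Tensor4) :
    doubleMat (act4 p P) = (p ⊗ₖ p)ᵀ * doubleMat P * (p ⊗ₖ p) := by
  ext x y
  simp only [doubleMat, act4_expand, Matrix.of_apply, Matrix.mul_apply, Matrix.transpose_apply,
    Matrix.kroneckerMap_apply, Fintype.sum_prod_type, Finset.sum_mul]
  -- The matrix product sums over the right pair of indices outside the left pair; the two pairs of
  -- sums are exchanged.
  rw [show ∀ f : Fin 4 → Fin 4 → Fin 4 → Fin 4 → ℂ, (∑ i, ∑ j, ∑ k, ∑ l, f i j k l)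
      = ∑ k, ∑ l, ∑ i, ∑ j, f i j k l from fun f => by
    simp only [← Fintype.sum_prod_type' (f := fun i j => ∑ k, ∑ l, f i j k l)]
    rw [Finset.sum_comm]
    refine Finset.sum_congr rfl fun _ _ => ?_
    rw [Finset.sum_comm]
    refine Finset.sum_congr rfl fun _ _ => ?_
    rw [Fintype.sum_prod_type]]
  exact Finset.sum_congr rfl fun _ _ => Finset.sum_congr rfl fun _ _ =>
    Finset.sum_congr rfl fun _ _ => Finset.sum_congr rfl fun _ _ => by ring

theorem formVec_act2 (p : Mat4) (F : Tensor2) :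
    formVec (act2 p F) = (p ⊗ₖ p)ᵀ *ᵥ formVec F := by
  ext x
  simp [formVec, act2, Matrix.mulVec, dotProduct, Matrix.kroneckerMap_apply,
    Fintype.sum_prod_type]

theorem act4_act4 (p q : Mat4) (P : Tensor4) : act4 p (act4 q P) = act4 (q * p) P := by
  apply doubleMat_injective
  simp only [doubleMat_act4, Matrix.mul_kronecker_mul, Matrix.transpose_mul, Matrix.mul_assoc]

theorem act4_one (P : Tensor4) : act4 1 P = P := by
  apply doubleMat_injective
  simp [doubleMat_act4]

theorem act4_injective {p q : Mat4} (hpq : p * q = 1) : Function.Injective (act4 p) := by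
  intro A B h
  have := congrArg (act4 q) h
  rwa [act4_act4, act4_act4, hpq, act4_one, act4_one] at this

/-! ### Naturality of the tensor operations -/

noncomputable def invMat (g : Tensor2) : Mat4 := Matrix.of (inv g)

theorem invMat_eq (g : Tensor2) : invMat g = (Matrix.of g)⁻¹ := rfl

/-- The single fact behind all the naturality statements: every contraction puts an inverse metric
between two factors that each bring a copy of `p`, and `p` and its transpose are absorbed by the
transformed inverse metric. -/
theorem mul_invMat_act2_mul {p : Mat4} (hp : IsUnit p.det) (g : Tensor2) :
    p * invMat (act2 p g) * pᵀ = invMat g := by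
  have hp' : IsUnit pᵀ.det := by rwa [Matrix.det_transpose]
  simp only [invMat_eq, of_act2, Matrix.mul_inv_rev]
  rw [Matrix.mul_nonsing_inv_cancel_left _ _ hp, Matrix.nonsing_inv_mul_cancel_right _ _ hp']

theorem kronecker_mul_invMat_act2_mul {p : Mat4} (hp : IsUnit p.det) (g : Tensor2) :
    (p ⊗ₖ p) * (invMat (act2 p g) ⊗ₖ invMat (act2 p g)) * (p ⊗ₖ p)ᵀ = invMat g ⊗ₖ invMat g := by
  rw [← Matrix.kroneckerMap_transpose, ← Matrix.mul_kronecker_mul, ← Matrix.mul_kronecker_mul,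
    mul_invMat_act2_mul hp]

theorem of_dot (g A B : Tensor2) : Matrix.of (dot g A B) = Matrix.of A * invMat g * Matrix.of B := by
  ext a b
  simp only [dot, invMat, Matrix.of_apply, Matrix.mul_apply, Finset.sum_mul]
  rw [Finset.sum_comm]

theorem dot_act2 {p : Mat4} (hp : IsUnit p.det) (g A B : Tensor2) :
    dot (act2 p g) (act2 p A) (act2 p B) = act2 p (dot g A B) := by
  apply of_inj
  simp only [of_dot, of_act2, ← mul_invMat_act2_mul hp g, Matrix.mul_assoc]

theorem tr_eq_trace (g A : Tensor2) : tr g A = (invMat g * (Matrix.of A)ᵀ).trace := by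
  simp [tr, invMat, Matrix.trace, Matrix.mul_apply]

theorem tr_act2 {p : Mat4} (hp : IsUnit p.det) (g A : Tensor2) :
    tr (act2 p g) (act2 p A) = tr g A := by
  simp only [tr_eq_trace, of_act2, ← mul_invMat_act2_mul hp g, Matrix.transpose_mul,
    Matrix.transpose_transpose]
  rw [← Matrix.mul_assoc, ← Matrix.mul_assoc, Matrix.trace_mul_comm]
  simp only [Matrix.mul_assoc]

theorem interior_eq (g : Tensor2) (ξ : Tensor1) (F : Tensor2) :
    interior g ξ F = ξ ᵥ* (invMat g * Matrix.of F) := by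
  ext b
  simp only [interior, invMat, Matrix.vecMul, dotProduct, Matrix.mul_apply, Finset.mul_sum,
    Matrix.of_apply]
  rw [Finset.sum_comm]
  exact Finset.sum_congr rfl fun _ _ => Finset.sum_congr rfl fun _ _ => by ring

theorem interior_act {p : Mat4} (hp : IsUnit p.det) (g : Tensor2) (ξ : Tensor1) (F : Tensor2) :
    interior (act2 p g) (act1 p ξ) (act2 p F) = act1 p (interior g ξ F) := by
  simp only [interior_eq, of_act2, act1_eq_vecMul, Matrix.vecMul_vecMul,
    ← mul_invMat_act2_mul hp g, Matrix.mul_assoc]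

theorem formInner_eq (g F H : Tensor2) :
    formInner g F H = (formVec F ⬝ᵥ ((invMat g ⊗ₖ invMat g) *ᵥ formVec H)) / 2 := by
  simp only [formInner, formVec, dotProduct, Matrix.mulVec, Matrix.kroneckerMap_apply, invMat,
    Matrix.of_apply, Fintype.sum_prod_type, Finset.mul_sum, mul_assoc]

theorem formInner_act {p : Mat4} (hp : IsUnit p.det) (g F H : Tensor2) :
    formInner (act2 p g) (act2 p F) (act2 p H) = formInner g F H := by
  simp only [formInner_eq, formVec_act2, ← kronecker_mul_invMat_act2_mul hp g,
    ← Matrix.mulVec_mulVec, Matrix.dotProduct_mulVec, Matrix.vecMul_transpose]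
  simp only [Matrix.mulVec_transpose, Matrix.vecMul_vecMul]

theorem formVec_dapply (g : Tensor2) (P : Tensor4) (F : Tensor2) :
    formVec (dapply g P F) =
      (1 / 2 : ℂ) • ((doubleMat P * (invMat g ⊗ₖ invMat g)) *ᵥ formVec F) := by
  ext x
  simp only [dapply, formVec, dotProduct, Matrix.mulVec, Matrix.kroneckerMap_apply, invMat,
    Matrix.mul_apply, doubleMat, Matrix.of_apply, Fintype.sum_prod_type, Finset.sum_mul,
    Pi.smul_apply, smul_eq_mul, mul_assoc]
  ring

theorem dapply_act {p : Mat4} (hp : IsUnit p.det) (g : Tensor2) (P : Tensor4) (F : Tensor2) :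
    dapply (act2 p g) (act4 p P) (act2 p F) = act2 p (dapply g P F) := by
  apply formVec_injective
  simp only [formVec_dapply, formVec_act2, doubleMat_act4, ← kronecker_mul_invMat_act2_mul hp g,
    Matrix.mulVec_mulVec, Matrix.mul_assoc, Matrix.mulVec_smul]

theorem doubleMat_dcomp (g : Tensor2) (P Q : Tensor4) :
    doubleMat (dcomp g P Q) =
      (1 / 2 : ℂ) • (doubleMat P * (invMat g ⊗ₖ invMat g) * doubleMat Q) := by
  ext x y
  simp only [dcomp, Matrix.kroneckerMap_apply, invMat,
    Matrix.mul_apply, doubleMat, Matrix.of_apply, Fintype.sum_prod_type, Finset.sum_mul,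
    Matrix.smul_apply, smul_eq_mul]
  ring_nf

theorem dcomp_act {p : Mat4} (hp : IsUnit p.det) (g : Tensor2) (P Q : Tensor4) :
    dcomp (act2 p g) (act4 p P) (act4 p Q) = act4 p (dcomp g P Q) := by
  apply doubleMat_injective
  simp only [doubleMat_dcomp, doubleMat_act4, ← kronecker_mul_invMat_act2_mul hp g,
    Matrix.mul_assoc, Matrix.mul_smul, Matrix.smul_mul]

theorem comm_act2 {p : Mat4} (hp : IsUnit p.det) (g A B : Tensor2) :
    comm (act2 p g) (act2 p A) (act2 p B) = act2 p (comm g A B) := by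
  funext a b
  simp only [comm, dot_act2 hp]
  rw [← act2_sub]
  rfl

theorem antisymPart_act2 (p : Mat4) (T : Tensor2) :
    antisymPart (act2 p T) = act2 p (antisymPart T) := by
  funext a b
  change _ = act2 p (fun i j => (T i j - T j i) / 2) a b
  rw [act2_div_const, act2_sub, act2_swap p T]
  rfl

theorem symPart_act2 (p : Mat4) (T : Tensor2) :
    symPart (act2 p T) = act2 p (symPart T) := by
  funext a b
  change _ = act2 p (fun i j => (T i j + T j i) / 2) a b
  rw [act2_div_const, act2_add, act2_swap p T]
  rfl

theorem wedge_act2 (p : Mat4) (A B : Tensor2) :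
    wedge (act2 p A) (act2 p B) = act4 p (wedge A B) := by
  funext a b m n
  have h : wedge A B = fun i j k l =>
      A i k * B j l + B i k * A j l - A i l * B j k - B i l * A j k := by
    funext i j k l
    simp only [wedge]
    ring
  rw [h, act4_sub, act4_sub, act4_add, act4_tmul_middle, act4_tmul_middle, act4_tmul_outer,
    act4_tmul_outer]
  simp only [wedge]
  ring

theorem formMetric_act2 (p : Mat4) (g : Tensor2) :
    formMetric (act2 p g) = act4 p (formMetric g) := by
  funext a b m n
  change _ = act4 p (fun a b m n => wedge g g a b m n / 2) a b m n
  rw [act4_div_const, ← wedge_act2]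
  rfl

theorem sdMetric_act (p : Mat4) (g : Tensor2) (η : Tensor4) :
    sdMetric (act2 p g) (act4 p η) = act4 p (sdMetric g η) := by
  funext a b m n
  change _ = act4 p (fun a b m n => (formMetric g a b m n - Complex.I * η a b m n) / 2) a b m n
  rw [act4_div_const, act4_sub, act4_const_mul]
  rw [← formMetric_act2]
  rfl

theorem sdMetricPerp_act (p : Mat4) (g : Tensor2) (η : Tensor4) (F : Tensor2) :
    sdMetricPerp (act2 p g) (act4 p η) (act2 p F) = act4 p (sdMetricPerp g η F) := by
  funext a b m n
  change _ = act4 p (fun a b m n => F a b * F m n + sdMetric g η a b m n) a b m n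
  rw [act4_add, act4_tmul]
  rw [← sdMetric_act]
  rfl

theorem formPerp_act {p : Mat4} (hp : IsUnit p.det) (g : Tensor2) (η : Tensor4) (F H : Tensor2) :
    formPerp (act2 p g) (act4 p η) (act2 p F) (act2 p H) = act2 p (formPerp g η F H) := by
  simp only [formPerp, sdMetricPerp_act, dapply_act hp]

theorem doublePerp_act {p : Mat4} (hp : IsUnit p.det) (g : Tensor2) (η : Tensor4) (F : Tensor2)
    (P : Tensor4) :
    doublePerp (act2 p g) (act4 p η) (act2 p F) (act4 p P) = act4 p (doublePerp g η F P) := by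
  simp only [doublePerp, sdMetricPerp_act, dcomp_act hp]

theorem ricci_act {p : Mat4} (hp : IsUnit p.det) (g : Tensor2) (Rm : Tensor4) :
    ricci (act2 p g) (act4 p Rm) = act2 p (ricci g Rm) := by
  funext s b
  -- With the two free indices frozen, the Ricci contraction is the trace of a 2-tensor, whose
  -- invariance is known.
  have h1 : ∀ (h : Tensor2) (P : Tensor4), ricci h P s b = tr h (fun r a => P r s a b) :=
    fun _ _ => rfl
  have h2 : (fun r a => act4 p Rm r s a b) =
      act2 p (fun i k => ∑ j, ∑ l, p j s * p l b * Rm i j k l) := by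
    funext r a
    simp only [act4_expand, act2, Finset.mul_sum]
    refine Finset.sum_congr rfl fun _ _ => ?_
    rw [Finset.sum_comm]
    exact Finset.sum_congr rfl fun _ _ => Finset.sum_congr rfl fun _ _ =>
      Finset.sum_congr rfl fun _ _ => by ring
  rw [h1, h2, tr_act2 hp]
  simp only [tr, act2, ricci, Finset.mul_sum]
  rw [show ∀ f : Fin 4 → Fin 4 → Fin 4 → Fin 4 → ℂ, (∑ i, ∑ j, ∑ k, ∑ l, f i j k l)
      = ∑ k, ∑ l, ∑ i, ∑ j, f i j k l from fun f => by
    simp only [← Fintype.sum_prod_type' (f := fun i j => ∑ k, ∑ l, f i j k l)]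
    rw [Finset.sum_comm]
    refine Finset.sum_congr rfl fun _ _ => ?_
    rw [Finset.sum_comm]
    refine Finset.sum_congr rfl fun _ _ => ?_
    rw [Fintype.sum_prod_type]]
  exact Finset.sum_congr rfl fun _ _ => Finset.sum_congr rfl fun _ _ =>
    Finset.sum_congr rfl fun _ _ => Finset.sum_congr rfl fun _ _ => by ring

theorem scalar_act {p : Mat4} (hp : IsUnit p.det) (g : Tensor2) (Rm : Tensor4) :
    scalar (act2 p g) (act4 p Rm) = scalar g Rm := by
  simp only [scalar, ricci_act hp, tr_act2 hp]

theorem weyl_act {p : Mat4} (hp : IsUnit p.det) (g : Tensor2) (Rm : Tensor4) :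
    weyl (act2 p g) (act4 p Rm) = act4 p (weyl g Rm) := by
  funext a b m n
  have h : (fun c d => (act2 p (ricci g Rm) c d - scalar g Rm / 6 * act2 p g c d) / 2) =
      act2 p (fun c d => (ricci g Rm c d - scalar g Rm / 6 * g c d) / 2) := by
    funext c d
    rw [act2_div_const, act2_sub, act2_const_mul]
  simp only [weyl, ricci_act hp, scalar_act hp, h, wedge_act2]
  rw [← act4_sub]
  rfl

theorem sdWeyl_act {p : Mat4} (hp : IsUnit p.det) (g : Tensor2) (η Rm : Tensor4) :
    sdWeyl (act2 p g) (act4 p η) (act4 p Rm) = act4 p (sdWeyl g η Rm) := by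
  simp only [sdWeyl, sdMetric_act, weyl_act hp, dcomp_act hp]

end TwoPlusTwo

namespace TwoPlusTwo

/-! ## Null frames -/

/-- The index of the vector of a null frame dual to the `i`-th one. -/
def dualIdx : Fin 4 → Fin 4 := ![1, 0, 3, 2]

/-- The signs of the eigenvalues of the canonical self-dual bivector in a null frame. -/
def nullSign : Fin 4 → ℂ := ![1, -1, 1, -1]

/-- The metric in a null frame. -/
def nullMetric : Tensor2 := fun a b => if b = dualIdx a then 1 else 0

/-- The canonical self-dual bivector in an adapted null frame. -/
noncomputable def nullBivector : Tensor2 := fun a b =>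
  nullSign a / (Real.sqrt 2 : ℂ) * nullMetric a b

/-- The volume element determined by a self-dual bivector of square `-1`. -/
noncomputable def volOfBivector (F : Tensor2) : Tensor4 := fun a b m n =>
  -2 * Complex.I * (F a b * F m n - F a m * F b n + F a n * F b m)

theorem dualIdx_dualIdx (a : Fin 4) : dualIdx (dualIdx a) = a := by
  fin_cases a <;> rfl

theorem dualIdx_involutive : Function.Involutive dualIdx := dualIdx_dualIdx

theorem nullSign_dualIdx (a : Fin 4) : nullSign (dualIdx a) = -nullSign a := by
  fin_cases a <;> simp [nullSign, dualIdx]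

theorem nullSign_mul_self (a : Fin 4) : nullSign a * nullSign a = 1 := by
  fin_cases a <;> simp [nullSign]

theorem eq_dualIdx_iff {a b : Fin 4} : b = dualIdx a ↔ a = dualIdx b :=
  ⟨fun h => by rw [h, dualIdx_dualIdx], fun h => by rw [h, dualIdx_dualIdx]⟩

theorem nullMetric_symm (a b : Fin 4) : nullMetric a b = nullMetric b a := by
  simp only [nullMetric, eq_dualIdx_iff (a := a)]

theorem nullMetric_mul_nullSign (a b : Fin 4) :
    nullMetric a b * nullSign b = -(nullMetric a b * nullSign a) := by
  unfold nullMetric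
  split_ifs with h
  · rw [h, nullSign_dualIdx]; ring
  · ring

theorem sqrt_two_sq : (Real.sqrt 2 : ℂ) ^ 2 = 2 := by
  rw [← Complex.ofReal_pow, Real.sq_sqrt (by norm_num)]
  norm_num

theorem sqrt_two_ne_zero : (Real.sqrt 2 : ℂ) ≠ 0 := fun h => by
  have := sqrt_two_sq
  rw [h] at this
  norm_num at this

/-! ### Contractions in a null frame -/

theorem sum_mul_nullMetric (f : Fin 4 → ℂ) (a : Fin 4) :
    ∑ m, f m * nullMetric m a = f (dualIdx a) := by
  simp only [nullMetric_symm _ a]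
  simp [nullMetric]

theorem sum_nullMetric_mul (f : Fin 4 → ℂ) (a : Fin 4) :
    ∑ m, nullMetric a m * f m = f (dualIdx a) := by
  simp [nullMetric]

theorem inv_nullMetric : inv nullMetric = nullMetric := by
  have h : (Matrix.of nullMetric)⁻¹ = Matrix.of nullMetric := by
    refine Matrix.inv_eq_left_inv ?_
    ext i j
    simp only [Matrix.mul_apply, Matrix.of_apply, sum_nullMetric_mul]
    simp [nullMetric, dualIdx_dualIdx, Matrix.one_apply, eq_comm]
  exact h

theorem dot_null (A B : Tensor2) (a b : Fin 4) :
    dot nullMetric A B a b = ∑ m, A a m * B (dualIdx m) b := by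
  simp only [dot, inv_nullMetric, mul_assoc, ← Finset.mul_sum, sum_nullMetric_mul]

/-- Multiplication by `𝒰` on the right rescales columns, and `nullBivector_dot` rescales rows. The
signs are opposite because a contraction passes to the dual index, which reverses `nullSign`. -/
theorem dot_nullBivector (A : Tensor2) (a b : Fin 4) :
    dot nullMetric A nullBivector a b = -(nullSign b / (Real.sqrt 2 : ℂ) * A a b) := by
  simp [dot_null, nullBivector, nullMetric, dualIdx_dualIdx, nullSign_dualIdx]
  ring

theorem nullBivector_dot (A : Tensor2) (a b : Fin 4) :
    dot nullMetric nullBivector A a b = nullSign a / (Real.sqrt 2 : ℂ) * A a b := by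
  simp [dot_null, nullBivector, nullMetric, dualIdx_dualIdx]

theorem tr_null (A : Tensor2) : tr nullMetric A = ∑ a, A a (dualIdx a) := by
  simp only [tr, inv_nullMetric, sum_nullMetric_mul]

theorem ricci_null (Rm : Tensor4) (s b : Fin 4) :
    ricci nullMetric Rm s b = ∑ r, Rm r s (dualIdx r) b := by
  simp only [ricci, inv_nullMetric, sum_nullMetric_mul _ _]

theorem dapply_null (P : Tensor4) (F : Tensor2) (a b : Fin 4) :
    dapply nullMetric P F a b = (∑ p, ∑ q, P a b p q * F (dualIdx p) (dualIdx q)) / 2 := by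
  have h : ∀ m n : Fin 4, ∑ p, ∑ q, P a b p q * nullMetric p m * nullMetric q n * F m n =
      P a b (dualIdx m) (dualIdx n) * F m n := fun m n => by
    simp only [← Finset.sum_mul, mul_right_comm _ (nullMetric _ m), sum_mul_nullMetric]
  simp only [dapply, inv_nullMetric, h]
  congr 1
  rw [← Equiv.sum_comp dualIdx_involutive.toPerm]
  refine Finset.sum_congr rfl fun m _ => ?_
  rw [← Equiv.sum_comp dualIdx_involutive.toPerm]
  simp [Function.Involutive.coe_toPerm, dualIdx_dualIdx]

theorem dcomp_eq_dapply (g : Tensor2) (P Q : Tensor4) (a b r s : Fin 4) :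
    dcomp g P Q a b r s = dapply g P (fun m n => Q m n r s) a b := rfl

theorem formInner_null (F H : Tensor2) :
    formInner nullMetric F H = (∑ a, ∑ b, F a b * H (dualIdx a) (dualIdx b)) / 2 := by
  simp only [formInner, inv_nullMetric, mul_assoc, ← Finset.mul_sum, sum_nullMetric_mul]

theorem nullBivector_antisymm (a b : Fin 4) : nullBivector a b = -nullBivector b a := by
  unfold nullBivector
  have := nullMetric_mul_nullSign a b
  rw [nullMetric_symm b a]
  linear_combination (1 / (Real.sqrt 2 : ℂ)) * this

/-! ### The double 2-forms `𝒢` and `𝒢_⊥` as projections in a null frame -/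

/-- The projection onto the components of a 2-form along `𝒰^⊥`. -/
noncomputable def perpCoeff (a b : Fin 4) : ℂ := (1 + nullSign a * nullSign b) / 2

/-- The volume element is itself quadratic in `𝒰`: its term `𝒰 ⊗ 𝒰` cancels the one in `𝒢_⊥`, and
the two crossed terms are those of `G` multiplied by `nullSign a * nullSign b / 2`. This produces
the factor `perpCoeff`, which is 1 for indices of equal sign and 0 otherwise. -/
theorem sdMetricPerp_null (a b m n : Fin 4) :
    sdMetricPerp nullMetric (volOfBivector nullBivector) nullBivector a b m n =
      perpCoeff a b * (nullMetric a m * nullMetric b n - nullMetric a n * nullMetric b m) := by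
  simp only [sdMetricPerp, sdMetric, formMetric, wedge, volOfBivector, nullBivector, perpCoeff]
  have h := sqrt_two_ne_zero
  have h2 := sqrt_two_sq
  field_simp
  rw [h2]
  linear_combination 4 * nullSign a * (nullMetric a n * nullMetric b m * nullSign b -
    nullMetric a m * nullMetric b n * nullSign b + nullMetric a b * nullMetric m n * nullSign m) *
    Complex.I_sq

theorem sdMetric_null (a b m n : Fin 4) :
    sdMetric nullMetric (volOfBivector nullBivector) a b m n =
      perpCoeff a b * (nullMetric a m * nullMetric b n - nullMetric a n * nullMetric b m)
        - nullBivector a b * nullBivector m n := by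
  rw [← sdMetricPerp_null, sdMetricPerp]
  ring

theorem dapply_perpCoeff {F : Tensor2} (hF : ∀ a b, F a b = -F b a) (a b : Fin 4) :
    dapply nullMetric (fun a b m n => perpCoeff a b *
      (nullMetric a m * nullMetric b n - nullMetric a n * nullMetric b m)) F a b =
      perpCoeff a b * F a b := by
  have e : ∀ p q, (nullMetric a p * nullMetric b q - nullMetric a q * nullMetric b p) *
      F (dualIdx p) (dualIdx q) = nullMetric a p * (nullMetric b q * F (dualIdx p) (dualIdx q)) -
        nullMetric b p * (nullMetric a q * F (dualIdx p) (dualIdx q)) := fun p q => by ring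
  rw [dapply_null]
  simp only [mul_assoc, ← Finset.mul_sum, e, Finset.sum_sub_distrib, sum_nullMetric_mul,
    dualIdx_dualIdx]
  rw [hF b a]
  ring

theorem sdMetricPerp_null_eq :
    sdMetricPerp nullMetric (volOfBivector nullBivector) nullBivector = fun a b m n =>
      perpCoeff a b * (nullMetric a m * nullMetric b n - nullMetric a n * nullMetric b m) := by
  funext a b m n
  exact sdMetricPerp_null a b m n

theorem formPerp_null {F : Tensor2} (hF : ∀ a b, F a b = -F b a) (a b : Fin 4) :
    formPerp nullMetric (volOfBivector nullBivector) nullBivector F a b = perpCoeff a b * F a b := by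
  rw [formPerp, sdMetricPerp_null_eq, dapply_perpCoeff hF]

/-- `𝒢_⊥` is symmetric as a double 2-form: a nonzero product of metric components forces both signs
to flip between the pairs, which leaves their product unchanged. -/
theorem perpCoeff_mul_null (a b m n : Fin 4) :
    perpCoeff a b * (nullMetric a m * nullMetric b n - nullMetric a n * nullMetric b m) =
      perpCoeff m n * (nullMetric m a * nullMetric n b - nullMetric m b * nullMetric n a) := by
  have h1 := nullMetric_mul_nullSign a m
  have h2 := nullMetric_mul_nullSign b n
  have h3 := nullMetric_mul_nullSign a n
  have h4 := nullMetric_mul_nullSign b m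
  rw [nullMetric_symm m a, nullMetric_symm n b, nullMetric_symm m b, nullMetric_symm n a]
  simp only [perpCoeff]
  linear_combination (-1 / 2 : ℂ) * nullMetric b n * nullSign n * h1
    + (1 / 2 : ℂ) * nullMetric a m * nullSign a * h2 + (1 / 2 : ℂ) * nullMetric b m * nullSign m * h3
    - (1 / 2 : ℂ) * nullMetric a n * nullSign a * h4

theorem perpCoeff_mul_self (a b : Fin 4) : perpCoeff a b * perpCoeff a b = perpCoeff a b := by
  have h1 := nullSign_mul_self a
  have h2 := nullSign_mul_self b
  simp only [perpCoeff]
  linear_combination (1 / 4 : ℂ) * nullSign b * nullSign b * h1 + (1 / 4 : ℂ) * h2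

/-- `𝒰` lives on pairs of dual indices, which have opposite signs. -/
theorem perpCoeff_mul_nullBivector (a b : Fin 4) : perpCoeff a b * nullBivector a b = 0 := by
  have h1 := nullSign_mul_self a
  have h2 := nullMetric_mul_nullSign a b
  simp only [perpCoeff, nullBivector]
  linear_combination (1 / 2 / (Real.sqrt 2 : ℂ)) * h2 +
    nullMetric a b * (nullSign b / 2 / (Real.sqrt 2 : ℂ)) * h1

theorem dcomp_perp_left {P : Tensor4} (hP : ∀ a b m n, P a b m n = -P b a m n) (a b m n : Fin 4) :
    dcomp nullMetric (sdMetricPerp nullMetric (volOfBivector nullBivector) nullBivector) P a b m n =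
      perpCoeff a b * P a b m n := by
  rw [dcomp_eq_dapply, sdMetricPerp_null_eq, dapply_perpCoeff fun a b => hP a b m n]

theorem dcomp_perp_right {P : Tensor4} (hP : ∀ a b m n, P a b m n = -P a b n m) (a b m n : Fin 4) :
    dcomp nullMetric P (sdMetricPerp nullMetric (volOfBivector nullBivector) nullBivector) a b m n =
      perpCoeff m n * P a b m n := by
  -- By the symmetry of `𝒢_⊥`, composing on the right is applying it to the 2-form in the last two
  -- slots, after renaming the summation indices by `dualIdx`.
  rw [dcomp_eq_dapply, sdMetricPerp_null_eq, ← dapply_perpCoeff (hP a b)]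
  simp only [perpCoeff_mul_null _ _ m n, dapply_null]
  congr 1
  rw [← Equiv.sum_comp dualIdx_involutive.toPerm]
  refine Finset.sum_congr rfl fun m _ => ?_
  rw [← Equiv.sum_comp dualIdx_involutive.toPerm]
  simp only [Function.Involutive.coe_toPerm, dualIdx_dualIdx]
  exact Finset.sum_congr rfl fun m _ => mul_comm _ _

theorem dapply_sub_left (g : Tensor2) (P Q : Tensor4) (F : Tensor2) (a b : Fin 4) :
    dapply g (fun a b m n => P a b m n - Q a b m n) F a b = dapply g P F a b - dapply g Q F a b := by
  simp only [dapply, sub_mul, Finset.sum_sub_distrib, sub_div]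

theorem dapply_sub_right (g : Tensor2) (P : Tensor4) (F H : Tensor2) (a b : Fin 4) :
    dapply g P (fun m n => F m n - H m n) a b = dapply g P F a b - dapply g P H a b := by
  simp only [dapply, mul_sub, Finset.sum_sub_distrib, sub_div]

theorem dapply_mul_const (g : Tensor2) (P : Tensor4) (F : Tensor2) (c : ℂ) (a b : Fin 4) :
    dapply g P (fun m n => F m n * c) a b = dapply g P F a b * c := by
  simp only [dapply, ← mul_assoc, ← Finset.sum_mul]
  ring

theorem sdMetric_null_eq :
    sdMetric nullMetric (volOfBivector nullBivector) = fun a b m n =>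
      sdMetricPerp nullMetric (volOfBivector nullBivector) nullBivector a b m n
        - nullBivector a b * nullBivector m n := by
  funext a b m n
  rw [sdMetricPerp]
  ring

theorem dapply_null_tmul (A B F : Tensor2) (a b : Fin 4) :
    dapply nullMetric (fun a b m n => A a b * B m n) F a b = A a b * formInner nullMetric B F := by
  simp only [dapply_null, formInner_null, mul_assoc, ← Finset.mul_sum]
  ring

theorem dcomp_sdMetric_left {P : Tensor4} (hP : ∀ a b m n, P a b m n = -P b a m n)
    (a b m n : Fin 4) :
    dcomp nullMetric (sdMetric nullMetric (volOfBivector nullBivector)) P a b m n =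
      perpCoeff a b * P a b m n -
        nullBivector a b * formInner nullMetric nullBivector (fun p q => P p q m n) := by
  rw [dcomp_eq_dapply, sdMetric_null_eq, dapply_sub_left, dapply_null_tmul,
    ← dcomp_eq_dapply, dcomp_perp_left hP]

theorem dcomp_sdMetric_right {P : Tensor4} (hP : ∀ a b m n, P a b m n = -P a b n m)
    (a b m n : Fin 4) :
    dcomp nullMetric P (sdMetric nullMetric (volOfBivector nullBivector)) a b m n =
      perpCoeff m n * P a b m n - dapply nullMetric P nullBivector a b * nullBivector m n := by
  rw [dcomp_eq_dapply, sdMetric_null_eq, dapply_sub_right, dapply_mul_const, ← dcomp_eq_dapply,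
    dcomp_perp_right hP]

theorem perpCoeff_symm (a b : Fin 4) : perpCoeff a b = perpCoeff b a := by
  simp only [perpCoeff, mul_comm]

theorem formInner_nullBivector_self : formInner nullMetric nullBivector nullBivector = -1 := by
  have h := sqrt_two_ne_zero
  have h2 := sqrt_two_sq
  rw [formInner_null]
  simp [nullBivector, nullMetric, dualIdx, nullSign, Fin.sum_univ_four]
  field_simp
  rw [h2]
  norm_num

/-- `𝒢 ∘ W ∘ 𝒢` in an adapted null frame. -/
theorem sdProj_null {W : Tensor4} (hl : ∀ a b m n, W a b m n = -W b a m n)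
    (hr : ∀ a b m n, W a b m n = -W a b n m) :
    ∃ B C : Tensor2,
      (∀ a b, perpCoeff a b * B a b = perpCoeff a b * dapply nullMetric W nullBivector a b) ∧
      ∀ a b m n,
      dcomp nullMetric (dcomp nullMetric (sdMetric nullMetric (volOfBivector nullBivector)) W)
        (sdMetric nullMetric (volOfBivector nullBivector)) a b m n =
        perpCoeff a b * perpCoeff m n * W a b m n - nullBivector a b * (perpCoeff m n * C m n)
          - B a b * nullBivector m n := by
  set X := dcomp nullMetric (sdMetric nullMetric (volOfBivector nullBivector)) W with hX
  have hXW : ∀ a b m n, X a b m n = perpCoeff a b * W a b m n -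
      nullBivector a b * formInner nullMetric nullBivector (fun p q => W p q m n) :=
    dcomp_sdMetric_left hl
  have hXr : ∀ a b m n, X a b m n = -X a b n m := fun a b m n => by
    simp only [hXW, hr _ _ m n, formInner, mul_neg, Finset.sum_neg_distrib]
    ring
  -- With `𝒢 = 𝒢_⊥ - 𝒰 ⊗ 𝒰` on both sides, the part of the product that is not perpendicular in both
  -- slots has a factor `𝒰`. `B` is the half-projected tensor applied to `𝒰`; it differs from `W(𝒰)`
  -- only along `𝒰` after projection.
  refine ⟨dapply nullMetric X nullBivector,
    fun m n => formInner nullMetric nullBivector (fun p q => W p q m n), fun a b => ?_,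
    fun a b m n => ?_⟩
  · have : dapply nullMetric X nullBivector a b =
        perpCoeff a b * dapply nullMetric W nullBivector a b - nullBivector a b *
          formInner nullMetric
            (fun m n => formInner nullMetric nullBivector (fun p q => W p q m n)) nullBivector := by
      rw [← dapply_null_tmul, show X = fun a b m n => perpCoeff a b * W a b m n -
        nullBivector a b * formInner nullMetric nullBivector (fun p q => W p q m n) from
        funext fun a => funext fun b => funext fun m => funext fun n => hXW a b m n,
        dapply_sub_left]
      simp only [dapply, mul_assoc, Finset.mul_sum, ← mul_div_assoc]
    rw [this]
    linear_combination dapply nullMetric W nullBivector a b * perpCoeff_mul_self a b -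
      formInner nullMetric
        (fun m n => formInner nullMetric nullBivector (fun p q => W p q m n)) nullBivector *
      perpCoeff_mul_nullBivector a b
  · rw [dcomp_sdMetric_right hXr, hXW]
    ring

theorem sdProj_antisymm (W : Tensor4) :
    let K := dcomp nullMetric
      (dcomp nullMetric (sdMetric nullMetric (volOfBivector nullBivector)) W)
      (sdMetric nullMetric (volOfBivector nullBivector))
    (∀ a b m n, K a b m n = -K b a m n) ∧ ∀ a b m n, K a b m n = -K a b n m := by
  intro K
  have h : ∀ a b m n, sdMetric nullMetric (volOfBivector nullBivector) a b m n =
      -sdMetric nullMetric (volOfBivector nullBivector) b a m n := fun a b m n => by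
    rw [sdMetric_null, sdMetric_null, perpCoeff_symm b a, nullBivector_antisymm b a]
    ring
  have h' : ∀ a b m n, sdMetric nullMetric (volOfBivector nullBivector) a b m n =
      -sdMetric nullMetric (volOfBivector nullBivector) a b n m := fun a b m n => by
    rw [sdMetric_null, sdMetric_null, nullBivector_antisymm n m]
    ring
  constructor
  · intro a b m n
    simp only [K, dcomp, h a b, neg_mul, Finset.sum_neg_distrib, neg_div]
  · intro a b m n
    simp only [K, dcomp, h' _ _ m n, mul_neg, Finset.sum_neg_distrib, neg_div]

/-- The terms of `𝒢 ∘ W ∘ 𝒢` with a factor `𝒰` are annihilated by the outer projections, and these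
are idempotent on the rest. -/
theorem doublePerp_sdProj_null {W : Tensor4} (hl : ∀ a b m n, W a b m n = -W b a m n)
    (hr : ∀ a b m n, W a b m n = -W a b n m) (a b m n : Fin 4) :
    doublePerp nullMetric (volOfBivector nullBivector) nullBivector
      (dcomp nullMetric (dcomp nullMetric (sdMetric nullMetric (volOfBivector nullBivector)) W)
        (sdMetric nullMetric (volOfBivector nullBivector))) a b m n =
      perpCoeff a b * perpCoeff m n * W a b m n := by
  obtain ⟨B, C, -, hK⟩ := sdProj_null hl hr
  obtain ⟨hKl, hKr⟩ := sdProj_antisymm W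
  rw [doublePerp, dcomp_perp_right, dcomp_perp_left hKl, hK]
  · linear_combination perpCoeff m n * W a b m n * perpCoeff m n * perpCoeff_mul_self a b +
      perpCoeff a b * W a b m n * perpCoeff_mul_self m n -
      perpCoeff m n * (perpCoeff m n * C m n) * perpCoeff_mul_nullBivector a b -
      perpCoeff a b * B a b * perpCoeff_mul_nullBivector m n
  · intro a b m n
    rw [dcomp_perp_left hKl, dcomp_perp_left hKl, hKr]
    ring

theorem formInner_perpCoeff_nullBivector (F : Tensor2) :
    formInner nullMetric (fun m n => perpCoeff m n * F m n) nullBivector = 0 := by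
  have h : ∀ a b, perpCoeff a b * nullBivector (dualIdx a) (dualIdx b) = 0 := fun a b => by
    rw [← perpCoeff_mul_nullBivector (dualIdx a) (dualIdx b)]
    simp only [perpCoeff, nullSign_dualIdx]
    ring
  have h' : ∀ a b, perpCoeff a b * F a b * nullBivector (dualIdx a) (dualIdx b) = 0 :=
    fun a b => by rw [mul_right_comm, h, zero_mul]
  simp only [formInner_null, h', Finset.sum_const_zero, zero_div]

theorem formInner_sub_mul (g F H K : Tensor2) (c : ℂ) :
    formInner g (fun m n => F m n - c * H m n) K = formInner g F K - c * formInner g H K := by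
  simp only [formInner, sub_mul, Finset.sum_sub_distrib, sub_div, mul_assoc, ← Finset.mul_sum]
  ring

theorem dapply_eq_formInner (P : Tensor4) (F : Tensor2) (a b : Fin 4) :
    dapply nullMetric P F a b = formInner nullMetric (P a b) F := by
  rw [dapply_null, formInner_null]

/-- Contracting the second slot with `𝒰` kills everything perpendicular there and keeps the
coefficient `B` of `𝒰`, with the sign given by `(𝒰, 𝒰) = -1`. -/
theorem formPerp_sdProj_null {W : Tensor4} (hl : ∀ a b m n, W a b m n = -W b a m n)
    (hr : ∀ a b m n, W a b m n = -W a b n m) (a b : Fin 4) :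
    formPerp nullMetric (volOfBivector nullBivector) nullBivector
      (dapply nullMetric
        (dcomp nullMetric (dcomp nullMetric (sdMetric nullMetric (volOfBivector nullBivector)) W)
          (sdMetric nullMetric (volOfBivector nullBivector))) nullBivector) a b =
      perpCoeff a b * dapply nullMetric W nullBivector a b := by
  obtain ⟨B, C, hB, hK⟩ := sdProj_null hl hr
  obtain ⟨hKl, hKr⟩ := sdProj_antisymm W
  rw [formPerp_null, ← hB]
  · congr 1
    rw [dapply_eq_formInner]
    have h : dcomp nullMetric
        (dcomp nullMetric (sdMetric nullMetric (volOfBivector nullBivector)) W)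
        (sdMetric nullMetric (volOfBivector nullBivector)) a b = fun m n =>
        perpCoeff m n * (perpCoeff a b * W a b m n - nullBivector a b * C m n) -
          B a b * nullBivector m n := by
      funext m n
      rw [hK]
      ring
    rw [h, formInner_sub_mul, formInner_perpCoeff_nullBivector, formInner_nullBivector_self]
    ring
  · intro a b
    simp only [dapply, hKl a b, neg_mul, Finset.sum_neg_distrib, neg_div]

/-! ## The algebraic equivalence -/

/-- The commutator `∇_a ∇_b 𝒰_{mn} - ∇_b ∇_a 𝒰_{mn}` of an umbilical structure, in terms of the
tensor `T`. -/
noncomputable def commutatorForm (g F T : Tensor2) : Tensor4 := fun a b m n =>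
  -(g b m * T a n - g b n * T a m - g a m * T b n + g a n * T b m) / 2
    - (F b m * dot g T F a n - F b n * dot g T F a m - F a m * dot g T F b n
      + F a n * dot g T F b m)

/-- The curvature side of the Ricci identities for `F`. -/
noncomputable def curvatureForm (g F : Tensor2) (Rm : Tensor4) : Tensor4 := fun a b m n =>
  (∑ k, ∑ l, F m k * inv g k l * Rm l n b a) - ∑ k, ∑ l, F n k * inv g k l * Rm l m b a

/-- The three integrability equations at a point. -/
def PointEquations (g : Tensor2) (η : Tensor4) (F T : Tensor2) (Rm : Tensor4) : Prop :=
  (doublePerp g η F (sdWeyl g η Rm) = fun a b m n =>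
    -(scalar g Rm / 12 + formInner g (antisymPart T) F) * sdMetricPerp g η F a b m n) ∧
  (formPerp g η F (dapply g (sdWeyl g η Rm) F) = fun a b =>
    -formPerp g η F (antisymPart T) a b) ∧
  comm g F (ricci g Rm) = fun a b => 2 * dot g (dot g F (symPart T)) F a b - symPart T a b

/-- The classical consequence of the symmetries: a signed sum of four Bianchi identities, in which
the antisymmetries cancel all but the two wanted terms. -/
theorem IsCurvatureLike.pair_symm {Rm : Tensor4} (h : IsCurvatureLike Rm) (a b c d : Fin 4) :
    Rm a b c d = Rm c d a b := by
  have h1 := h.antisymm_left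
  have h2 := h.antisymm_right
  have h3 := h.bianchi
  linear_combination (1 / 2 : ℂ) * (h3 a b c d - h3 b c d a - h3 c d a b + h3 d a b c
    - h2 a c d b + h1 b a c d + h1 c a b d + h1 c b d a - h1 d a b c - h1 d b c a + h2 b d c a
    - h1 d c a b)

theorem curvatureForm_null (Rm : Tensor4) (hl : ∀ a b m n, Rm a b m n = -Rm b a m n)
    (a b m n : Fin 4) :
    curvatureForm nullMetric nullBivector Rm a b m n =
      (nullSign m + nullSign n) / (Real.sqrt 2 : ℂ) * Rm m n b a := by
  have h : ∀ m n, (∑ k, ∑ l, nullBivector m k * inv nullMetric k l * Rm l n b a) =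
      nullSign m / (Real.sqrt 2 : ℂ) * Rm m n b a := fun m n => by
    rw [← nullBivector_dot (fun l n => Rm l n b a)]
    rfl
  simp only [curvatureForm, h]
  rw [hl n m]
  ring

/-- In null components the terms with two factors `𝒰` repeat those with `g`, multiplied by `nullSign
m * nullSign n`; the two groups add up to a projection in the slots `m n`. -/
theorem commutatorForm_null (T : Tensor2) (a b m n : Fin 4) :
    commutatorForm nullMetric nullBivector T a b m n =
      -perpCoeff m n * (nullMetric b m * T a n - nullMetric b n * T a m - nullMetric a m * T b n
        + nullMetric a n * T b m) := by
  have e : ∀ a b, nullBivector a b = -(nullSign b / (Real.sqrt 2 : ℂ) * nullMetric a b) :=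
    fun a b => by
      unfold nullBivector
      linear_combination (1 / (Real.sqrt 2 : ℂ)) * nullMetric_mul_nullSign a b
  simp only [commutatorForm, dot_nullBivector, perpCoeff, e]
  have h := sqrt_two_ne_zero
  have h2 := sqrt_two_sq
  field_simp
  rw [h2]
  ring

theorem weyl_antisymm_left {g : Tensor2} {Rm : Tensor4} (hl : ∀ a b m n, Rm a b m n = -Rm b a m n)
    (a b m n : Fin 4) : weyl g Rm a b m n = -weyl g Rm b a m n := by
  simp only [weyl, wedge, hl b a]
  ring

theorem weyl_antisymm_right {g : Tensor2} {Rm : Tensor4} (hr : ∀ a b m n, Rm a b m n = -Rm a b n m)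
    (a b m n : Fin 4) : weyl g Rm a b m n = -weyl g Rm a b n m := by
  simp only [weyl, wedge, hr a b n m]
  ring

/-- Every operator in the three equations is diagonal on null components. In particular `[𝒰, ·]`
multiplies by `(σ_a + σ_b)/√2`, and `2 𝒰·S·𝒰 - S` by `-(1 + σ_a σ_b)`, so the last equation too only
sees indices of equal sign. -/
theorem pointEquations_null (T : Tensor2) {Rm : Tensor4} (hl : ∀ a b m n, Rm a b m n = -Rm b a m n)
    (hr : ∀ a b m n, Rm a b m n = -Rm a b n m) :
    PointEquations nullMetric (volOfBivector nullBivector) nullBivector T Rm ↔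
      (∀ a b m n, perpCoeff a b * perpCoeff m n * weyl nullMetric Rm a b m n =
        -(scalar nullMetric Rm / 12 + formInner nullMetric (antisymPart T) nullBivector) *
        (perpCoeff a b *
          (nullMetric a m * nullMetric b n - nullMetric a n * nullMetric b m))) ∧
      (∀ a b, perpCoeff a b * dapply nullMetric (weyl nullMetric Rm) nullBivector a b =
        -(perpCoeff a b * antisymPart T a b)) ∧
      ∀ a b, (nullSign a + nullSign b) / (Real.sqrt 2 : ℂ) * ricci nullMetric Rm a b =
        -2 * perpCoeff a b * symPart T a b := by
  have hA : ∀ a b, antisymPart T a b = -antisymPart T b a := fun a b => by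
    simp only [antisymPart]; ring
  have h1 := doublePerp_sdProj_null (weyl_antisymm_left (g := nullMetric) hl)
    (weyl_antisymm_right hr)
  have h2 := formPerp_sdProj_null (weyl_antisymm_left (g := nullMetric) hl)
    (weyl_antisymm_right hr)
  have h3 : ∀ a b, comm nullMetric nullBivector (ricci nullMetric Rm) a b =
      (nullSign a + nullSign b) / (Real.sqrt 2 : ℂ) * ricci nullMetric Rm a b := fun a b => by
    rw [comm, nullBivector_dot, dot_nullBivector]
    ring
  have h4 : ∀ a b, 2 * dot nullMetric (dot nullMetric nullBivector (symPart T)) nullBivector a b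
      - symPart T a b = -2 * perpCoeff a b * symPart T a b := fun a b => by
    rw [dot_nullBivector, nullBivector_dot, perpCoeff]
    have h := sqrt_two_ne_zero
    have h2 := sqrt_two_sq
    field_simp
    rw [h2]
    ring
  simp only [PointEquations, funext_iff, sdWeyl, h1, h2, h3, h4, sdMetricPerp_null, formPerp_null hA]

/-! ### From tensor equations to scalar equations -/

theorem perpCoeff_cases (m n : Fin 4) :
    (perpCoeff m n = 0 ∧ nullSign m + nullSign n = 0) ∨ m = n ∨ (m = 0 ∧ n = 2) ∨
      (m = 2 ∧ n = 0) ∨ (m = 1 ∧ n = 3) ∨ (m = 3 ∧ n = 1) := by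
  fin_cases m <;> fin_cases n <;> simp [perpCoeff, nullSign]

theorem perpCoeff_zero_two : perpCoeff 0 2 = 1 := by
  simp [perpCoeff, nullSign]

theorem perpCoeff_one_three : perpCoeff 1 3 = 1 := by
  simp [perpCoeff, nullSign]

/-- The image of `𝒢_⊥` is two-dimensional, with coordinates 02 and 13. -/
theorem perpCoeff_mul_eq_zero_iff {F : Tensor2} (hF : ∀ a b, F a b = -F b a) :
    (∀ a b, perpCoeff a b * F a b = 0) ↔ F 0 2 = 0 ∧ F 1 3 = 0 := by
  constructor
  · intro H
    have h1 := H 0 2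
    have h2 := H 1 3
    rw [perpCoeff_zero_two, one_mul] at h1
    rw [perpCoeff_one_three, one_mul] at h2
    exact ⟨h1, h2⟩
  · rintro ⟨h1, h2⟩ a b
    rcases perpCoeff_cases a b with ⟨p, -⟩ | rfl | ⟨rfl, rfl⟩ | ⟨rfl, rfl⟩ | ⟨rfl, rfl⟩ | ⟨rfl, rfl⟩
    · rw [p, zero_mul]
    · linear_combination (1 / 2 : ℂ) * perpCoeff a a * hF a a
    · rw [h1, mul_zero]
    · rw [hF, h1, neg_zero, mul_zero]
    · rw [h2, mul_zero]
    · rw [hF, h2, neg_zero, mul_zero]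

theorem perpCoeff_mul_double_eq_zero_iff {P : Tensor4} (hl : ∀ a b m n, P a b m n = -P b a m n)
    (hr : ∀ a b m n, P a b m n = -P a b n m) :
    (∀ a b m n, perpCoeff a b * (perpCoeff m n * P a b m n) = 0) ↔
      (P 0 2 0 2 = 0 ∧ P 0 2 1 3 = 0) ∧ P 1 3 0 2 = 0 ∧ P 1 3 1 3 = 0 := by
  rw [← perpCoeff_mul_eq_zero_iff (hr 0 2), ← perpCoeff_mul_eq_zero_iff (hr 1 3)]
  simp only [← forall_and]
  constructor
  · intro H m n
    exact (perpCoeff_mul_eq_zero_iff (F := fun a b => perpCoeff m n * P a b m n) fun a b => by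
      rw [hl]; ring).1 fun a b => H a b m n
  · intro H a b m n
    exact (perpCoeff_mul_eq_zero_iff (F := fun a b => perpCoeff m n * P a b m n) fun a b => by
      rw [hl]; ring).2 (H m n) a b

/-- Both sides are 2-forms in `a b` and, in `m n`, live on the pairs 02 and 13: this gives two
equations between 2-forms, hence twelve components. Pair symmetry identifies `Rm 1 3 0 2` with `Rm 0
2 1 3`, so this component receives two values in terms of `T`. -/
theorem curvature_eqs_iff_null {T : Tensor2} {Rm : Tensor4}
    (hR : IsCurvatureLike Rm) :
    (∀ a b m n, -perpCoeff m n * (nullMetric b m * T a n - nullMetric b n * T a m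
      - nullMetric a m * T b n + nullMetric a n * T b m) =
      (nullSign m + nullSign n) / (Real.sqrt 2 : ℂ) * Rm m n b a) ↔
    Rm 0 2 0 2 = 0 ∧ Rm 1 3 1 3 = 0 ∧
      (Real.sqrt 2 : ℂ) * Rm 0 2 1 3 = -(T 3 2 + T 1 0) ∧
      (Real.sqrt 2 : ℂ) * Rm 0 2 1 3 = T 2 3 + T 0 1 ∧
      (Real.sqrt 2 : ℂ) * Rm 0 2 0 3 = -T 0 0 ∧ (Real.sqrt 2 : ℂ) * Rm 0 2 1 2 = -T 2 2 ∧
      (Real.sqrt 2 : ℂ) * Rm 1 3 0 3 = T 3 3 ∧ (Real.sqrt 2 : ℂ) * Rm 1 3 1 2 = T 1 1 ∧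
      (Real.sqrt 2 : ℂ) * Rm 0 2 0 1 = T 0 2 ∧ (Real.sqrt 2 : ℂ) * Rm 0 2 2 3 = -T 2 0 ∧
      (Real.sqrt 2 : ℂ) * Rm 1 3 0 1 = T 1 3 ∧ (Real.sqrt 2 : ℂ) * Rm 1 3 2 3 = -T 3 1 := by
  have hl := hR.antisymm_left
  have hr := hR.antisymm_right
  have hz : ∀ a b c, Rm a b c c = 0 := fun a b c => by linear_combination (1 / 2 : ℂ) * hr a b c c
  have hz' : ∀ a b c, Rm c c a b = 0 := fun a b c => by linear_combination (1 / 2 : ℂ) * hl c c a b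
  have hp := hR.pair_symm 1 3 0 2
  have h := sqrt_two_ne_zero
  have h2 := sqrt_two_sq
  -- On the pair 02 the two eigenvalue signs add up to 2, on 13 to -2, so the curvature enters with
  -- the factor `√2` or `-√2`.
  have k : (2 : ℂ) / (Real.sqrt 2 : ℂ) = (Real.sqrt 2 : ℂ) := by rw [div_eq_iff h, ← sq, h2]
  have split : (∀ a b m n, -perpCoeff m n * (nullMetric b m * T a n - nullMetric b n * T a m
      - nullMetric a m * T b n + nullMetric a n * T b m) =
      (nullSign m + nullSign n) / (Real.sqrt 2 : ℂ) * Rm m n b a) ↔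
      (∀ a b, -(nullMetric b 0 * T a 2 - nullMetric b 2 * T a 0
        - nullMetric a 0 * T b 2 + nullMetric a 2 * T b 0) = (Real.sqrt 2 : ℂ) * Rm 0 2 b a) ∧
      ∀ a b, (nullMetric b 1 * T a 3 - nullMetric b 3 * T a 1
        - nullMetric a 1 * T b 3 + nullMetric a 3 * T b 1) = (Real.sqrt 2 : ℂ) * Rm 1 3 b a := by
    have e1 := perpCoeff_zero_two
    have e2 := perpCoeff_one_three
    have s1 : nullSign 0 + nullSign 2 = 2 := by simp [nullSign]; norm_num
    have s2 : nullSign 1 + nullSign 3 = -2 := by simp [nullSign]; norm_num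
    constructor
    · intro H
      refine ⟨fun a b => ?_, fun a b => ?_⟩
      · have := H a b 0 2
        rw [e1, s1, k] at this
        linear_combination this
      · have := H a b 1 3
        rw [e2, s2, neg_div, k] at this
        linear_combination -this
    · rintro ⟨A, B⟩ a b m n
      rcases perpCoeff_cases m n with ⟨p, q⟩ | rfl | ⟨rfl, rfl⟩ | ⟨rfl, rfl⟩ | ⟨rfl, rfl⟩ |
        ⟨rfl, rfl⟩
      · rw [p, q]
        ring
      · rw [hz']
        ring
      · rw [e1, s1, k]
        linear_combination A a b
      · rw [perpCoeff_symm, e1, add_comm (nullSign 2), s1, k, hl]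
        linear_combination -A a b
      · rw [e2, s2, neg_div, k]
        linear_combination -B a b
      · rw [perpCoeff_symm, e2, add_comm (nullSign 3), s2, neg_div, k, hl]
        linear_combination B a b
  rw [split]
  constructor
  · rintro ⟨A, B⟩
    have hw : ∀ x, (Real.sqrt 2 : ℂ) * x = 0 → x = 0 := fun x hx =>
      (mul_eq_zero.1 hx).resolve_left h
    have a1 := A 2 0
    have a2 := A 3 1
    have a3 := A 3 0
    have a4 := A 2 1
    have a5 := A 1 0
    have a6 := A 3 2
    have b1 := B 3 1
    have b2 := B 2 0
    have b3 := B 3 0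
    have b4 := B 2 1
    have b5 := B 1 0
    have b6 := B 3 2
    simp [nullMetric, dualIdx] at a1 a2 a3 a4 a5 a6 b1 b2 b3 b4 b5 b6
    rw [hp] at b2
    refine ⟨?_, ?_, ?_, ?_, ?_, ?_, ?_, ?_, ?_, ?_, ?_, ?_⟩ <;> grind
  · rintro ⟨h1, h2, h3, h4, h5, h6, h7, h8, h9, h10, h11, h12⟩
    constructor
    · intro a b
      fin_cases a <;> fin_cases b <;> simp [nullMetric, dualIdx, hz] <;> grind
    · intro a b
      fin_cases a <;> fin_cases b <;> simp [nullMetric, dualIdx, hz] <;> grind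

/-- The equation for `𝒲_⊥` has three independent components by pair symmetry, that for `𝒲(𝒰)_⊥` has
two, and the symmetric Ricci equation has six (00, 11, 22, 33, 02, 13). No Ricci term is left in the
first five: the scalar part of `W_{0213}` cancels the term `R/12` of `Ω`, and the Ricci parts drop
out of the other components. -/
theorem pointEquations_iff_null {T : Tensor2} {Rm : Tensor4} (hR : IsCurvatureLike Rm) :
    PointEquations nullMetric (volOfBivector nullBivector) nullBivector T Rm ↔
    Rm 0 2 0 2 = 0 ∧ Rm 1 3 1 3 = 0 ∧
      2 * (Real.sqrt 2 : ℂ) * Rm 0 2 1 3 = T 0 1 - T 1 0 + T 2 3 - T 3 2 ∧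
      (Real.sqrt 2 : ℂ) * (Rm 0 2 0 1 + Rm 0 2 2 3) = T 0 2 - T 2 0 ∧
      (Real.sqrt 2 : ℂ) * (Rm 1 3 0 1 + Rm 1 3 2 3) = T 1 3 - T 3 1 ∧
      (Real.sqrt 2 : ℂ) * Rm 0 2 0 3 = -T 0 0 ∧ (Real.sqrt 2 : ℂ) * Rm 0 2 1 2 = -T 2 2 ∧
      (Real.sqrt 2 : ℂ) * Rm 1 3 0 3 = T 3 3 ∧ (Real.sqrt 2 : ℂ) * Rm 1 3 1 2 = T 1 1 ∧
      (Real.sqrt 2 : ℂ) * (Rm 0 2 0 1 - Rm 0 2 2 3) = T 0 2 + T 2 0 ∧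
      (Real.sqrt 2 : ℂ) * (Rm 1 3 0 1 - Rm 1 3 2 3) = T 1 3 + T 3 1 := by
  rw [pointEquations_null T hR.antisymm_left hR.antisymm_right]
  have hl := hR.antisymm_left
  have hr := hR.antisymm_right
  have hp := hR.pair_symm
  have hz : ∀ a b c, Rm a b c c = 0 := fun a b c => by linear_combination (1 / 2 : ℂ) * hr a b c c
  have hz' : ∀ a b c, Rm c c a b = 0 := fun a b c => by linear_combination (1 / 2 : ℂ) * hl c c a b
  have h := sqrt_two_ne_zero
  have h2 := sqrt_two_sq
  have hs : ∀ a b, ricci nullMetric Rm a b = ricci nullMetric Rm b a := fun a b => by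
    simp only [ricci_null, Fin.sum_univ_four, dualIdx]
    simp
    grind
  have r00 : ricci nullMetric Rm 0 0 = 2 * Rm 0 2 0 3 := by
    simp [ricci_null, Fin.sum_univ_four, dualIdx, hz, hz']
    grind
  have r22 : ricci nullMetric Rm 2 2 = 2 * Rm 0 2 1 2 := by
    simp [ricci_null, Fin.sum_univ_four, dualIdx, hz, hz']
    grind
  have r11 : ricci nullMetric Rm 1 1 = 2 * Rm 1 3 1 2 := by
    simp [ricci_null, Fin.sum_univ_four, dualIdx, hz, hz']
    grind
  have r33 : ricci nullMetric Rm 3 3 = 2 * Rm 1 3 0 3 := by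
    simp [ricci_null, Fin.sum_univ_four, dualIdx, hz, hz']
    grind
  have r02 : ricci nullMetric Rm 0 2 = -Rm 0 2 0 1 + Rm 0 2 2 3 := by
    simp [ricci_null, Fin.sum_univ_four, dualIdx, hz, hz']
    grind
  have r13 : ricci nullMetric Rm 1 3 = Rm 1 3 0 1 - Rm 1 3 2 3 := by
    simp [ricci_null, Fin.sum_univ_four, dualIdx, hz, hz']
    grind
  have hsc : scalar nullMetric Rm = 2 * (ricci nullMetric Rm 0 1 + ricci nullMetric Rm 2 3) := by
    rw [scalar, tr_null]
    simp [Fin.sum_univ_four, dualIdx, hs 1 0, hs 3 2]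
    ring
  have k : (2 : ℂ) / (Real.sqrt 2 : ℂ) = (Real.sqrt 2 : ℂ) := by rw [div_eq_iff h, ← sq, h2]
  have hA : ∀ a b, antisymPart T a b = -antisymPart T b a := fun a b => by
    simp only [antisymPart]; ring
  have hWl := weyl_antisymm_left (g := nullMetric) hl
  have hWr := weyl_antisymm_right (g := nullMetric) hr
  have w1 : weyl nullMetric Rm 0 2 0 2 = Rm 0 2 0 2 := by
    simp [weyl, wedge, nullMetric, dualIdx]
  have w2 : weyl nullMetric Rm 1 3 1 3 = Rm 1 3 1 3 := by
    simp [weyl, wedge, nullMetric, dualIdx]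
  have w3 : weyl nullMetric Rm 0 2 1 3 = Rm 0 2 1 3 - scalar nullMetric Rm / 12 := by
    rw [hsc]
    simp [weyl, wedge, nullMetric, dualIdx, hsc]
    ring
  have w4 : weyl nullMetric Rm 1 3 0 2 = Rm 0 2 1 3 - scalar nullMetric Rm / 12 := by
    rw [hsc, hp 0 2 1 3]
    simp [weyl, wedge, nullMetric, dualIdx, hsc, hs 1 0, hs 3 2]
    ring
  -- This sum is, up to a factor, the 02 component of `W(𝒰)`; the two Ricci corrections cancel by
  -- symmetry of the Ricci tensor.
  have w5 : weyl nullMetric Rm 0 2 0 1 + weyl nullMetric Rm 0 2 2 3 =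
      Rm 0 2 0 1 + Rm 0 2 2 3 := by
    simp [weyl, wedge, nullMetric, dualIdx, hs 2 0]
  have w6 : weyl nullMetric Rm 1 3 0 1 + weyl nullMetric Rm 1 3 2 3 =
      Rm 1 3 0 1 + Rm 1 3 2 3 := by
    simp [weyl, wedge, nullMetric, dualIdx, hs 3 1]
  have hin : ∀ F : Tensor2, (∀ a b, F a b = -F b a) → formInner nullMetric F nullBivector =
      -(F 0 1 + F 2 3) / (Real.sqrt 2 : ℂ) := fun F hF => by
    rw [formInner_null]
    simp [Fin.sum_univ_four, nullBivector, nullMetric, dualIdx, nullSign, hF 1 0, hF 3 2]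
    ring
  have e1 : (∀ a b m n, perpCoeff a b * perpCoeff m n * weyl nullMetric Rm a b m n =
        -(scalar nullMetric Rm / 12 + formInner nullMetric (antisymPart T) nullBivector) *
        (perpCoeff a b *
          (nullMetric a m * nullMetric b n - nullMetric a n * nullMetric b m))) ↔
      Rm 0 2 0 2 = 0 ∧ Rm 1 3 1 3 = 0 ∧
      2 * (Real.sqrt 2 : ℂ) * Rm 0 2 1 3 = T 0 1 - T 1 0 + T 2 3 - T 3 2 := by
    set Ω := -(scalar nullMetric Rm / 12 + formInner nullMetric (antisymPart T) nullBivector)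
      with hΩ
    have hΩ' : Ω = -scalar nullMetric Rm / 12 +
        (T 0 1 - T 1 0 + T 2 3 - T 3 2) / (2 * (Real.sqrt 2 : ℂ)) := by
      rw [hΩ, hin _ hA]
      simp only [antisymPart]
      field_simp
      ring
    have e := perpCoeff_mul_double_eq_zero_iff (P := fun a b m n => weyl nullMetric Rm a b m n -
      Ω * (nullMetric a m * nullMetric b n - nullMetric a n * nullMetric b m))
      (fun a b m n => by rw [hWl]; ring) (fun a b m n => by rw [hWr]; ring)
    rw [show (∀ a b m n, perpCoeff a b * perpCoeff m n * weyl nullMetric Rm a b m n =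
        Ω * (perpCoeff a b *
          (nullMetric a m * nullMetric b n - nullMetric a n * nullMetric b m))) ↔ _ from
      (forall₄_congr fun a b m n => ?_).trans e]
    · have t1 : nullMetric 0 0 = 0 := by simp [nullMetric, dualIdx]
      have t2 : nullMetric 0 2 = 0 := by simp [nullMetric, dualIdx]
      have t3 : nullMetric 1 1 = 0 := by simp [nullMetric, dualIdx]
      have t4 : nullMetric 1 3 = 0 := by simp [nullMetric, dualIdx]
      have t5 : nullMetric 0 1 = 1 := by simp [nullMetric, dualIdx]
      have t6 : nullMetric 2 3 = 1 := by simp [nullMetric, dualIdx]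
      have t7 : nullMetric 0 3 = 0 := by simp [nullMetric, dualIdx]
      have t8 : nullMetric 1 2 = 0 := by simp [nullMetric, dualIdx]
      simp only [w1, w2, w3, w4, nullMetric_symm 1 0, nullMetric_symm 3 2, nullMetric_symm 2 1,
        nullMetric_symm 2 0, nullMetric_symm 3 0, nullMetric_symm 3 1, t1, t2, t3, t4, t5, t6, t7, t8, hΩ']
      have : Rm 0 2 1 3 - scalar nullMetric Rm / 12 - (-scalar nullMetric Rm / 12 +
        (T 0 1 - T 1 0 + T 2 3 - T 3 2) / (2 * (Real.sqrt 2 : ℂ))) * (1 * 1 - 0 * 0) = 0 ↔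
        2 * (Real.sqrt 2 : ℂ) * Rm 0 2 1 3 = T 0 1 - T 1 0 + T 2 3 - T 3 2 := by
        have hw : 2 * (Real.sqrt 2 : ℂ) ≠ 0 := mul_ne_zero two_ne_zero h
        have hD := mul_div_cancel₀ (T 0 1 - T 1 0 + T 2 3 - T 3 2) hw
        constructor
        · intro H
          rw [← hD]
          linear_combination 2 * (Real.sqrt 2 : ℂ) * H
        · intro H
          rw [← hD] at H
          linear_combination mul_left_cancel₀ hw H
      rw [this]
      simp
      tauto
    -- The right-hand side is already perpendicular in both slots, so it may be projected in `a b`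
    -- and in `m n` without change.
    · have q := perpCoeff_mul_null a b m n
      have q2 := perpCoeff_mul_self a b
      rw [nullMetric_symm m a, nullMetric_symm n b, nullMetric_symm m b, nullMetric_symm n a] at q
      constructor <;> intro H
      · linear_combination H - Ω * (nullMetric a m * nullMetric b n -
          nullMetric a n * nullMetric b m) * q2 + Ω * perpCoeff a b * q
      · linear_combination H + Ω * (nullMetric a m * nullMetric b n -
          nullMetric a n * nullMetric b m) * q2 - Ω * perpCoeff a b * q
  have e2 : (∀ a b, perpCoeff a b * dapply nullMetric (weyl nullMetric Rm) nullBivector a b =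
        -(perpCoeff a b * antisymPart T a b)) ↔
      (Real.sqrt 2 : ℂ) * (Rm 0 2 0 1 + Rm 0 2 2 3) = T 0 2 - T 2 0 ∧
      (Real.sqrt 2 : ℂ) * (Rm 1 3 0 1 + Rm 1 3 2 3) = T 1 3 - T 3 1 := by
    have e := perpCoeff_mul_eq_zero_iff (F := fun a b =>
      dapply nullMetric (weyl nullMetric Rm) nullBivector a b + antisymPart T a b) fun a b => by
        simp only [dapply, hWl a b, neg_mul, Finset.sum_neg_distrib, neg_div, hA a b]
        ring
    rw [show (∀ a b, perpCoeff a b * dapply nullMetric (weyl nullMetric Rm) nullBivector a b =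
        -(perpCoeff a b * antisymPart T a b)) ↔ _ from (forall₂_congr fun a b => by
          rw [mul_add, eq_neg_iff_add_eq_zero]).trans e]
    simp only [dapply_eq_formInner, hin _ (hWr _ _), w5, w6, antisymPart]
    have : ∀ x y : ℂ, -x / (Real.sqrt 2 : ℂ) + y / 2 = 0 ↔ (Real.sqrt 2 : ℂ) * x = y := fun x y => by
      have kx : x / (Real.sqrt 2 : ℂ) = 2 / (Real.sqrt 2 : ℂ) * x / 2 := by ring
      rw [k] at kx
      rw [neg_div, kx]
      constructor <;> intro H
      · linear_combination -2 * H
      · linear_combination -(1 / 2 : ℂ) * H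
    rw [this, this]
  have e3 : (∀ a b, (nullSign a + nullSign b) / (Real.sqrt 2 : ℂ) * ricci nullMetric Rm a b =
        -2 * perpCoeff a b * symPart T a b) ↔
      (Real.sqrt 2 : ℂ) * Rm 0 2 0 3 = -T 0 0 ∧ (Real.sqrt 2 : ℂ) * Rm 0 2 1 2 = -T 2 2 ∧
      (Real.sqrt 2 : ℂ) * Rm 1 3 0 3 = T 3 3 ∧ (Real.sqrt 2 : ℂ) * Rm 1 3 1 2 = T 1 1 ∧
      (Real.sqrt 2 : ℂ) * (Rm 0 2 0 1 - Rm 0 2 2 3) = T 0 2 + T 2 0 ∧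
      (Real.sqrt 2 : ℂ) * (Rm 1 3 0 1 - Rm 1 3 2 3) = T 1 3 + T 3 1 := by
    have c1 := perpCoeff_zero_two
    have c2 := perpCoeff_one_three
    have s1 : nullSign 0 + nullSign 2 = 2 := by simp [nullSign]; norm_num
    have s2 : nullSign 1 + nullSign 3 = -2 := by simp [nullSign]; norm_num
    have c3 : ∀ a, perpCoeff a a = 1 := fun a => by simp [perpCoeff, nullSign_mul_self]
    have s3 : nullSign 0 = 1 := rfl
    have s4 : nullSign 1 = -1 := rfl
    have s5 : nullSign 2 = 1 := rfl
    have s6 : nullSign 3 = -1 := rfl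
    have k2 : (1 + 1 : ℂ) / (Real.sqrt 2 : ℂ) = (Real.sqrt 2 : ℂ) := by
      rw [one_add_one_eq_two, k]
    have k3 : (-1 + -1 : ℂ) / (Real.sqrt 2 : ℂ) = -(Real.sqrt 2 : ℂ) := by
      rw [← neg_add, neg_div, k2]
    constructor
    · intro H
      have h1 := H 0 0
      have h2 := H 2 2
      have h3 := H 3 3
      have h4 := H 1 1
      have h5 := H 0 2
      have h6 := H 1 3
      rw [c3, s3, k2, r00, symPart] at h1
      rw [c3, s5, k2, r22, symPart] at h2
      rw [c3, s6, k3, r33, symPart] at h3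
      rw [c3, s4, k3, r11, symPart] at h4
      rw [c1, s3, s5, k2, r02, symPart] at h5
      rw [c2, s4, s6, k3, r13, symPart] at h6
      refine ⟨?_, ?_, ?_, ?_, ?_, ?_⟩
      · linear_combination h1 / 2
      · linear_combination h2 / 2
      · linear_combination -h3 / 2
      · linear_combination -h4 / 2
      · linear_combination -h5
      · linear_combination -h6
    · rintro ⟨h1, h2, h3, h4, h5, h6⟩ a b
      rcases perpCoeff_cases a b with ⟨p, q⟩ | rfl | ⟨rfl, rfl⟩ | ⟨rfl, rfl⟩ | ⟨rfl, rfl⟩ |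
        ⟨rfl, rfl⟩
      · rw [p, q]
        ring
      · rw [c3]
        fin_cases a
        · change (nullSign 0 + nullSign 0) / _ * ricci nullMetric Rm 0 0 = _ * symPart T 0 0
          rw [s3, k2, r00, symPart]
          linear_combination 2 * h1
        · change (nullSign 1 + nullSign 1) / _ * ricci nullMetric Rm 1 1 = _ * symPart T 1 1
          rw [s4, k3, r11, symPart]
          linear_combination -2 * h4
        · change (nullSign 2 + nullSign 2) / _ * ricci nullMetric Rm 2 2 = _ * symPart T 2 2
          rw [s5, k2, r22, symPart]
          linear_combination 2 * h2
        · change (nullSign 3 + nullSign 3) / _ * ricci nullMetric Rm 3 3 = _ * symPart T 3 3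
          rw [s6, k3, r33, symPart]
          linear_combination -2 * h3
      · rw [c1, s3, s5, k2, r02, symPart]
        linear_combination -h5
      · rw [perpCoeff_symm, hs, c1, s3, s5, k2, r02, symPart]
        linear_combination -h5
      · rw [c2, s4, s6, k3, r13, symPart]
        linear_combination -h6
      · rw [perpCoeff_symm, hs, c2, s4, s6, k3, r13, symPart]
        linear_combination -h6
  rw [e1, e2, e3]
  tauto

/-- The two values prescribed for `Rm_{0213}` by the Ricci identities differ by the trace of `T`,
and the integrability equations prescribe their mean. The mixed components match by taking sums and
differences: sums carry the antisymmetric part of `T`, differences the symmetric part. -/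
theorem commutatorForm_eq_iff_null {T : Tensor2} (hT : tr nullMetric T = 0) {Rm : Tensor4}
    (hR : IsCurvatureLike Rm) :
    commutatorForm nullMetric nullBivector T = curvatureForm nullMetric nullBivector Rm ↔
      PointEquations nullMetric (volOfBivector nullBivector) nullBivector T Rm := by
  rw [pointEquations_iff_null hR]
  simp only [funext_iff, commutatorForm_null, curvatureForm_null Rm hR.antisymm_left]
  rw [curvature_eqs_iff_null hR]
  have hT' : T 0 1 + T 1 0 + T 2 3 + T 3 2 = 0 := by
    rw [← hT, tr_null]
    simp [Fin.sum_univ_four, dualIdx]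
  constructor
  · rintro ⟨h1, h2, h3, h4, h5, h6, h7, h8, h9, h10, h11, h12⟩
    refine ⟨h1, h2, ?_, ?_, ?_, h5, h6, h7, h8, ?_, ?_⟩
    · linear_combination h3 + h4
    · linear_combination h9 + h10
    · linear_combination h11 + h12
    · linear_combination h9 - h10
    · linear_combination h11 - h12
  · rintro ⟨h1, h2, h3, h4, h5, h6, h7, h8, h9, h10, h11⟩
    refine ⟨h1, h2, ?_, ?_, h6, h7, h8, h9, ?_, ?_, ?_, ?_⟩
    · linear_combination h3 / 2 + hT' / 2
    · linear_combination h3 / 2 - hT' / 2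
    · linear_combination h4 / 2 + h10 / 2
    · linear_combination h4 / 2 - h10 / 2
    · linear_combination h5 / 2 + h11 / 2
    · linear_combination h5 / 2 - h11 / 2

/-- The trace of `T` vanishes as soon as some curvature-like tensor satisfies the identities. -/
theorem tr_eq_zero_of_commutatorForm_null {T : Tensor2} {Rm : Tensor4} (hR : IsCurvatureLike Rm)
    (h : commutatorForm nullMetric nullBivector T = curvatureForm nullMetric nullBivector Rm) :
    tr nullMetric T = 0 := by
  simp only [funext_iff, commutatorForm_null, curvatureForm_null Rm hR.antisymm_left] at h
  obtain ⟨-, -, h3, h4, -⟩ := (curvature_eqs_iff_null hR).1 h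
  rw [tr_null]
  simp [Fin.sum_univ_four, dualIdx]
  linear_combination h3 - h4

/-! ### Arbitrary coframes -/

theorem volOfBivector_act2 (p : Mat4) (F : Tensor2) :
    volOfBivector (act2 p F) = act4 p (volOfBivector F) := by
  funext a b m n
  change _ = act4 p (fun a b m n =>
    -2 * Complex.I * (F a b * F m n - F a m * F b n + F a n * F b m)) a b m n
  rw [act4_const_mul, act4_add, act4_sub, act4_tmul, act4_tmul_middle, act4_tmul_outer]
  rfl

/-- The antisymmetrized product of two 2-tensors. -/
def crossForm (A B : Tensor2) : Tensor4 := fun a b m n =>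
  A b m * B a n - A b n * B a m - A a m * B b n + A a n * B b m

theorem crossForm_act (p : Mat4) (A B : Tensor2) :
    crossForm (act2 p A) (act2 p B) = act4 p (crossForm A B) := by
  funext a b m n
  have : crossForm A B =
      fun a b m n => B a n * A b m - B a m * A b n - A a m * B b n + A a n * B b m := by
    funext a b m n
    simp only [crossForm]
    ring
  rw [this, act4_add, act4_sub, act4_sub]
  simp only [act4_tmul_middle, act4_tmul_outer, crossForm]
  ring

theorem commutatorForm_eq (g F T : Tensor2) (a b m n : Fin 4) :
    commutatorForm g F T a b m n =
      -crossForm g T a b m n / 2 - crossForm F (dot g T F) a b m n := rfl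

theorem commutatorForm_act {p : Mat4} (hp : IsUnit p.det) (g F T : Tensor2) :
    commutatorForm (act2 p g) (act2 p F) (act2 p T) = act4 p (commutatorForm g F T) := by
  funext a b m n
  change _ = act4 p (fun a b m n =>
    -crossForm g T a b m n / 2 - crossForm F (dot g T F) a b m n) a b m n
  rw [act4_sub, act4_div_const, act4_neg, commutatorForm_eq, dot_act2 hp, crossForm_act,
    crossForm_act]

theorem act2_sum (p : Mat4) (A : Fin 4 → Tensor2) (a b : Fin 4) :
    act2 p (fun i j => ∑ k, A k i j) a b = ∑ k, act2 p (A k) a b := by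
  simp only [Fin.sum_univ_four, act2_add]

theorem curvatureForm_act {p : Mat4} (hp : IsUnit p.det) (g F : Tensor2) (Rm : Tensor4) :
    curvatureForm (act2 p g) (act2 p F) (act4 p Rm) = act4 p (curvatureForm g F Rm) := by
  have hD : ∀ a b m n, (∑ k, ∑ l, act2 p F m k * inv (act2 p g) k l * act4 p Rm l n b a) =
      act4 p (fun i j k l => dot g F (fun x y => Rm x y k l) i j) m n b a := fun a b m n => by
    change dot (act2 p g) (act2 p F) (act2 p fun i j => act2 p (Rm i j) b a) m n = _
    rw [dot_act2 hp]
    have : dot g F (fun i j => act2 p (Rm i j) b a) =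
        fun i j => act2 p (fun k l => dot g F (fun x y => Rm x y k l) i j) b a := by
      funext i j
      simp only [dot, act2_sum, act2_const_mul]
    rw [this]
    rfl
  -- The exchange of the two pairs, with the former first pair reversed, is a product of adjacent
  -- transpositions.
  have hP : ∀ (P : Tensor4) (a b m n : Fin 4),
      act4 p (fun i j k l => P k l j i) a b m n = act4 p P m n b a := fun P a b m n => by
    rw [act4_swap_middle p fun i k j l => P k l j i, act4_swap_left p fun k i j l => P k l j i,
      act4_swap_right p fun k i l j => P k l j i, act4_swap_middle p fun k l i j => P k l j i,
      act4_swap_right]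
  funext a b m n
  change _ = act4 p (fun a b m n => dot g F (fun x y => Rm x y b a) m n -
    dot g F (fun x y => Rm x y b a) n m) a b m n
  rw [act4_sub, hP (fun i j k l => dot g F (fun x y => Rm x y k l) i j),
    act4_swap_right p fun i j l k => dot g F (fun x y => Rm x y j i) l k,
    hP (fun i j k l => dot g F (fun x y => Rm x y k l) i j), ← hD, ← hD]
  rfl

theorem pointEquations_act {p q : Mat4} (hpq : p * q = 1) (g F T : Tensor2) (η Rm : Tensor4) :
    PointEquations (act2 p g) (act4 p η) (act2 p F) (act2 p T) (act4 p Rm) ↔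
      PointEquations g η F T Rm := by
  have hp : IsUnit p.det := by
    rw [← Matrix.isUnit_iff_isUnit_det]
    exact IsUnit.of_mul_eq_one _ hpq
  have e1 : ∀ c : ℂ, (fun a b m n => c * act4 p (sdMetricPerp g η F) a b m n) =
      act4 p (fun a b m n => c * sdMetricPerp g η F a b m n) := fun c => by
    funext a b m n
    rw [act4_const_mul]
  have e2 : ∀ A : Tensor2, (fun a b => -act2 p A a b) = act2 p (fun a b => -A a b) := fun A => by
    funext a b
    rw [act2_neg]
  have e3 : ∀ A B : Tensor2, (fun a b => 2 * act2 p A a b - act2 p B a b) =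
      act2 p (fun a b => 2 * A a b - B a b) := fun A B => by
    funext a b
    rw [act2_sub, act2_const_mul]
  simp only [PointEquations, sdWeyl_act hp, doublePerp_act hp, scalar_act hp, antisymPart_act2,
    symPart_act2, formInner_act hp, sdMetricPerp_act, dapply_act hp, formPerp_act hp, ricci_act hp,
    comm_act2 hp, dot_act2 hp, e1, e2, e3, (act4_injective hpq).eq_iff, (act2_injective hpq).eq_iff]

theorem IsCurvatureLike.act {p : Mat4} {Rm : Tensor4} (h : IsCurvatureLike Rm) :
    IsCurvatureLike (act4 p Rm) where
  antisymm_left a b c d := by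
    rw [← act4_swap_left, ← act4_neg]
    congr 1
    funext i j k l
    exact h.antisymm_left j i k l
  antisymm_right a b c d := by
    rw [← act4_swap_right, ← act4_neg]
    congr 1
    funext i j k l
    exact h.antisymm_right i j l k
  bianchi a b c d := by
    have h1 : act4 p (fun i j k l => Rm i k l j) a b c d = act4 p Rm a c d b := by
      rw [act4_swap_middle p fun i k j l => Rm i k l j, act4_swap_right]
    have h2 : act4 p (fun i j k l => Rm i l j k) a b c d = act4 p Rm a d b c := by
      rw [act4_swap_right p fun i j l k => Rm i l j k, act4_swap_middle]
    rw [← h1, ← h2, ← act4_add, ← act4_add]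
    simp only [h.bianchi, act4_expand, mul_zero, Finset.sum_const_zero]

/-- Transport from the null frame: `T` and `Rm` are arbitrary, so each is written as the image under
`p` of its frame components. -/
theorem commutatorForm_eq_iff {p q : Mat4} (hpq : p * q = 1) {T : Tensor2}
    (hT : tr (act2 p nullMetric) T = 0) {Rm : Tensor4} (hR : IsCurvatureLike Rm) :
    commutatorForm (act2 p nullMetric) (act2 p nullBivector) T =
        curvatureForm (act2 p nullMetric) (act2 p nullBivector) Rm ↔
      PointEquations (act2 p nullMetric) (act4 p (volOfBivector nullBivector))
        (act2 p nullBivector) T Rm := by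
  have hp : IsUnit p.det := by
    rw [← Matrix.isUnit_iff_isUnit_det]
    exact IsUnit.of_mul_eq_one _ hpq
  have hqp : q * p = 1 := mul_eq_one_comm.1 hpq
  rw [← act2_one T, ← hqp, ← act2_act2, tr_act2 hp] at hT
  rw [← act2_one T, ← act4_one Rm, ← hqp, ← act2_act2, ← act4_act4, pointEquations_act hpq,
    commutatorForm_act hp, curvatureForm_act hp, (act4_injective hpq).eq_iff]
  exact commutatorForm_eq_iff_null hT hR.act

theorem tr_eq_zero_of_commutatorForm_eq {p q : Mat4} (hpq : p * q = 1) {T : Tensor2}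
    {Rm : Tensor4} (hR : IsCurvatureLike Rm)
    (h : commutatorForm (act2 p nullMetric) (act2 p nullBivector) T =
        curvatureForm (act2 p nullMetric) (act2 p nullBivector) Rm) :
    tr (act2 p nullMetric) T = 0 := by
  have hp : IsUnit p.det := by
    rw [← Matrix.isUnit_iff_isUnit_det]
    exact IsUnit.of_mul_eq_one _ hpq
  have hqp : q * p = 1 := mul_eq_one_comm.1 hpq
  rw [← act2_one T, ← act4_one Rm, ← hqp, ← act2_act2, ← act4_act4, 
    commutatorForm_act hp, curvatureForm_act hp, (act4_injective hpq).eq_iff] at h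
  rw [← act2_one T, ← hqp, ← act2_act2, tr_act2 hp]
  exact tr_eq_zero_of_commutatorForm_null hR.act h

end TwoPlusTwo

namespace TwoPlusTwo

/-! ## First derivatives of the self-dual bivector of an umbilical structure -/

/-- The first slot is the direction of differentiation; it is kept apart so that each `D i` is
handled as a 2-tensor. -/
def act3 (p : Mat4) (D : Tensor3) : Tensor3 := fun a b c => ∑ i, p i a * act2 p (D i) b c

theorem act3_act3 (p q : Mat4) (D : Tensor3) : act3 p (act3 q D) = act3 (q * p) D := by
  funext a b c
  have h : ∀ i, act2 p (act3 q D i) b c = ∑ j, q j i * act2 (q * p) (D j) b c := fun i => by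
    simp only [← act2_act2]
    change act2 p (fun b c => ∑ j, q j i * act2 q (D j) b c) b c = _
    simp only [act2_sum, act2_const_mul]
  simp only [act3, h, Matrix.mul_apply, Finset.mul_sum, Finset.sum_mul]
  rw [Finset.sum_comm]
  exact Finset.sum_congr rfl fun _ _ => Finset.sum_congr rfl fun _ _ => by ring

theorem act3_one (D : Tensor3) : act3 1 D = D := by
  funext a b c
  simp [act3, act2_one, Matrix.one_apply]

/-- The form of `∇𝒰` for an umbilical structure, in terms of the codifferential `ξ` of `𝒰`. -/
noncomputable def umbilicForm (g F : Tensor2) (ξ : Tensor1) : Tensor3 := fun a m n =>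
  -(g a m * ξ n - g a n * ξ m) / 2 - F a m * interior g ξ F n + F a n * interior g ξ F m

/-- The codifferential of a 2-form with covariant derivative `D`. -/
noncomputable def codiffOf (g : Tensor2) (D : Tensor3) : Tensor1 := fun b =>
  -∑ a, ∑ c, inv g a c * D c a b

theorem umbilicForm_act {p : Mat4} (hp : IsUnit p.det) (g F : Tensor2) (ξ : Tensor1) :
    umbilicForm (act2 p g) (act2 p F) (act1 p ξ) = act3 p (umbilicForm g F ξ) := by
  have key : ∀ (A : Tensor2) (u : Tensor1) (a m n : Fin 4),
      ∑ i, p i a * act2 p (fun j k => A i j * u k) m n = act2 p A a m * act1 p u n :=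
    fun A u a m n => by
      simp only [act2_tmul, ← mul_assoc, ← Finset.sum_mul]
      congr 1
      simp only [act1, act2, Finset.mul_sum]
      exact Finset.sum_congr rfl fun _ _ => Finset.sum_congr rfl fun _ _ => by ring
  have key' : ∀ (A : Tensor2) (u : Tensor1) (a m n : Fin 4),
      ∑ i, p i a * act2 p (fun j k => A i k * u j) m n = act2 p A a n * act1 p u m :=
    fun A u a m n => by
      rw [← key]
      exact Finset.sum_congr rfl fun i _ => by rw [act2_swap p fun k j => A i k * u j]
  funext a m n
  have h : act3 p (umbilicForm g F ξ) a m n = ∑ i, p i a * act2 p (fun m n =>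
      -(g i m * ξ n - g i n * ξ m) / 2 - F i m * interior g ξ F n + F i n * interior g ξ F m) m n :=
    rfl
  rw [h]
  simp only [act2_add, act2_sub, act2_div_const, act2_neg, mul_add, mul_sub, mul_div_assoc', mul_neg,
    Finset.sum_add_distrib, Finset.sum_sub_distrib, ← Finset.sum_div, Finset.sum_neg_distrib,
    key, key']
  simp only [umbilicForm, interior_act hp]

theorem sum_rotate (f : Fin 4 → Fin 4 → Fin 4 → ℂ) :
    ∑ i, ∑ j, ∑ k, f i j k = ∑ k, ∑ i, ∑ j, f i j k := by
  rw [Finset.sum_comm (f := fun k i => ∑ j, f i j k)]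
  exact Finset.sum_congr rfl fun i _ => Finset.sum_comm

theorem codiffOf_act {p : Mat4} (hp : IsUnit p.det) (g : Tensor2) (D : Tensor3) :
    codiffOf (act2 p g) (act3 p D) = act1 p (codiffOf g D) := by
  funext b
  have h1 : ∀ (h : Tensor2) (P : Tensor3), codiffOf h P b = -tr h (fun a c => P c a b) :=
    fun _ _ => rfl
  have h2 : (fun a c => act3 p D c a b) = act2 p (fun i k => ∑ l, p l b * D k i l) := by
    funext a c
    simp only [act3, act2, Finset.mul_sum]
    rw [Finset.sum_comm]
    exact Finset.sum_congr rfl fun _ _ => Finset.sum_congr rfl fun _ _ =>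
      Finset.sum_congr rfl fun _ _ => by ring
  rw [h1, h2, tr_act2 hp]
  simp only [tr, act1, codiffOf, Finset.mul_sum, mul_neg, Finset.sum_neg_distrib]
  congr 1
  rw [sum_rotate]
  exact Finset.sum_congr rfl fun _ _ => Finset.sum_congr rfl fun _ _ =>
    Finset.sum_congr rfl fun _ _ => by ring

/-- Anticommutation with `𝒰` leaves the components `D a 0 2` and `D a 1 3`. Four of these eight
vanish by hypothesis, and each remaining one is the only surviving term in one component of the
codifferential. In a null frame the umbilical form is minus the `𝒢_⊥`-part of `g_{am} ξ_n - g_{an}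
ξ_m`, which has exactly these values. -/
theorem eq_umbilicForm_null {D : Tensor3} (hD : ∀ a m n, D a m n = -D a n m)
    (hF : ∀ a m n, dot nullMetric (D a) nullBivector m n + dot nullMetric nullBivector (D a) m n = 0)
    (h1 : D 0 2 0 = 0) (h2 : D 2 0 2 = 0) (h3 : D 1 3 1 = 0) (h4 : D 3 1 3 = 0) :
    D = umbilicForm nullMetric nullBivector (codiffOf nullMetric D) := by
  have h := sqrt_two_ne_zero
  have h2' := sqrt_two_sq
  have e : ∀ a m n, D a m n = perpCoeff m n * D a m n := fun a m n => by
    have := hF a m n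
    rw [dot_nullBivector, nullBivector_dot] at this
    have t : (nullSign m - nullSign n) * D a m n = 0 := by
      rw [← mul_right_inj' (inv_ne_zero h)]
      linear_combination this
    rw [perpCoeff]
    linear_combination (1 / 2 : ℂ) * nullSign m * t - (1 / 2 : ℂ) * D a m n * nullSign_mul_self m
  have hχ : ∀ ξ n, interior nullMetric ξ nullBivector n = -(nullSign n / (Real.sqrt 2 : ℂ)) * ξ n :=
    fun ξ n => by
      have := dot_nullBivector (fun _ => ξ) 0 n
      rw [neg_mul, ← this, interior, inv_nullMetric, Finset.sum_comm]
      simp only [dot, inv_nullMetric]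
  have hK : ∀ ξ a m n, umbilicForm nullMetric nullBivector ξ a m n =
      -perpCoeff m n * (nullMetric a m * ξ n - nullMetric a n * ξ m) := fun ξ a m n => by
    have e : ∀ a b, nullBivector a b = -(nullSign b / (Real.sqrt 2 : ℂ) * nullMetric a b) :=
      fun a b => by
        unfold nullBivector
        linear_combination (1 / (Real.sqrt 2 : ℂ)) * nullMetric_mul_nullSign a b
    simp only [umbilicForm, hχ, e, perpCoeff]
    field_simp
    rw [h2']
    ring
  have hz : ∀ a m, D a m m = 0 := fun a m => by linear_combination (1 / 2 : ℂ) * hD a m m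
  have c : ∀ b, codiffOf nullMetric D b = -∑ a, D (dualIdx a) a b := fun b => by
    simp only [codiffOf, inv_nullMetric, sum_nullMetric_mul]
  have d1 : ∀ a, D a 0 1 = 0 := fun a => by rw [e]; simp [perpCoeff, nullSign]
  have d2 : ∀ a, D a 0 3 = 0 := fun a => by rw [e]; simp [perpCoeff, nullSign]
  have d3 : ∀ a, D a 1 2 = 0 := fun a => by rw [e]; simp [perpCoeff, nullSign]
  have d4 : ∀ a, D a 2 3 = 0 := fun a => by rw [e]; simp [perpCoeff, nullSign]
  have A : ∀ a, D a 0 2 = -(nullMetric a 0 * codiffOf nullMetric D 2 -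
      nullMetric a 2 * codiffOf nullMetric D 0) := by
    intro a
    simp only [c, Fin.sum_univ_four]
    fin_cases a <;> simp [nullMetric, dualIdx, hz] <;> grind
  have B : ∀ a, D a 1 3 = -(nullMetric a 1 * codiffOf nullMetric D 3 -
      nullMetric a 3 * codiffOf nullMetric D 1) := by
    intro a
    simp only [c, Fin.sum_univ_four]
    fin_cases a <;> simp [nullMetric, dualIdx, hz] <;> grind
  funext a m n
  rw [hK]
  rcases perpCoeff_cases m n with ⟨p, -⟩ | rfl | ⟨rfl, rfl⟩ | ⟨rfl, rfl⟩ | ⟨rfl, rfl⟩ | ⟨rfl, rfl⟩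
  · rw [e, p]
    ring
  · rw [hz]
    ring
  · rw [perpCoeff_zero_two, A]
    ring
  · rw [perpCoeff_symm, perpCoeff_zero_two, hD, A]
    ring
  · rw [perpCoeff_one_three, B]
    ring
  · rw [perpCoeff_symm, perpCoeff_one_three, hD, B]
    ring

theorem antisymm_eq_zero {F : Tensor2} (hF : ∀ a b, F a b = -F b a) (h1 : F 0 1 = 0)
    (h2 : F 0 2 = 0) (h3 : F 0 3 = 0) (h4 : F 1 2 = 0) (h5 : F 1 3 = 0) (h6 : F 2 3 = 0)
    (a b : Fin 4) : F a b = 0 := by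
  fin_cases a <;> fin_cases b <;> grind

set_option maxHeartbeats 1000000 in
/-- The terms quadratic in `ξ` in the commutator of two covariant derivatives of `𝒰`. -/
theorem crossForm_quadratic_null (ξ χ : Tensor1) (hχ : χ = interior nullMetric ξ nullBivector) :
    crossForm nullMetric (fun a b => (ξ a * χ b - χ a * ξ b) / 2) =
      crossForm nullBivector (fun a b => χ a * χ b - ξ a * ξ b / 2 +
        tr nullMetric (fun a b => ξ a * ξ b) / 2 * nullMetric a b) := by
  have hχ : ∀ n, χ n = -(nullSign n / (Real.sqrt 2 : ℂ)) * ξ n :=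
    fun n => by
      have := dot_nullBivector (fun _ => ξ) 0 n
      rw [neg_mul, ← this, hχ, interior, inv_nullMetric, Finset.sum_comm]
      simp only [dot, inv_nullMetric]
  have h2' := sqrt_two_sq
  have hB : (fun a b => χ a * χ b - ξ a * ξ b / 2 +
      tr nullMetric (fun a b => ξ a * ξ b) / 2 * nullMetric a b) = fun a b =>
      (nullSign a * nullSign b - 1) / 2 * (ξ a * ξ b) +
        (ξ 0 * ξ 1 + ξ 2 * ξ 3) * nullMetric a b := by
    funext a b
    have ht : tr nullMetric (fun a b => ξ a * ξ b) = 2 * (ξ 0 * ξ 1 + ξ 2 * ξ 3) := by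
      simp [tr_null, Fin.sum_univ_four, dualIdx]
      ring
    have h := sqrt_two_ne_zero
    rw [ht, hχ, hχ]
    field_simp
    rw [h2']
    ring
  rw [hB]
  set Z : Tensor4 := fun a b m n =>
    crossForm nullMetric (fun a b => (ξ a * χ b - χ a * ξ b) / 2) a b m n -
      crossForm nullBivector (fun a b => (nullSign a * nullSign b - 1) / 2 * (ξ a * ξ b) +
        (ξ 0 * ξ 1 + ξ 2 * ξ 3) * nullMetric a b) a b m n with hZ
  have hl : ∀ a b m n, Z a b m n = -Z b a m n := fun a b m n => by
    simp only [hZ, crossForm]; ring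
  have hr : ∀ a b m n, Z a b m n = -Z a b n m := fun a b m n => by
    simp only [hZ, crossForm]; ring
  funext a b m n
  rw [← sub_eq_zero]
  change Z a b m n = 0
  -- The difference is antisymmetric in each pair of indices, so 36 components suffice; each is a
  -- polynomial identity in the components of `ξ`.
  refine antisymm_eq_zero (F := fun a b => Z a b m n) (fun a b => hl a b m n) ?_ ?_ ?_ ?_ ?_ ?_ a b
  all_goals
    refine antisymm_eq_zero (hr _ _) ?_ ?_ ?_ ?_ ?_ ?_ m n
  all_goals
    simp [hZ, crossForm, hχ, nullBivector, nullMetric, dualIdx, nullSign]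
    try ring

/-! ### Arbitrary coframes -/

theorem isUnit_det_of_mul_eq_one {p q : Mat4} (hpq : p * q = 1) : IsUnit p.det := by
  rw [← Matrix.isUnit_iff_isUnit_det]
  exact IsUnit.of_mul_eq_one _ hpq

theorem isUnit_det_act2_nullMetric {p q : Mat4} (hpq : p * q = 1) :
    IsUnit (Matrix.of (act2 p nullMetric)).det := by
  have hp := isUnit_det_of_mul_eq_one hpq
  have h : Matrix.of nullMetric * Matrix.of nullMetric = 1 := by
    ext i j
    simp only [Matrix.mul_apply, Matrix.of_apply, sum_nullMetric_mul]
    simp [nullMetric, dualIdx_dualIdx, Matrix.one_apply, eq_comm]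
  rw [of_act2, Matrix.det_mul, Matrix.det_mul, Matrix.det_transpose]
  exact (hp.mul (isUnit_det_of_mul_eq_one h)).mul hp

theorem dot_sum_left (g : Tensor2) (c : Fin 4 → ℂ) (A : Tensor3) (B : Tensor2) (m n : Fin 4) :
    dot g (fun m n => ∑ a, c a * A a m n) B m n = ∑ a, c a * dot g (A a) B m n := by
  simp only [dot, Finset.sum_mul, Finset.mul_sum]
  rw [sum_rotate]
  exact Finset.sum_congr rfl fun _ _ => Finset.sum_congr rfl fun _ _ =>
    Finset.sum_congr rfl fun _ _ => by ring

theorem dot_sum_right (g : Tensor2) (c : Fin 4 → ℂ) (A : Tensor3) (B : Tensor2) (m n : Fin 4) :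
    dot g B (fun m n => ∑ a, c a * A a m n) m n = ∑ a, c a * dot g B (A a) m n := by
  simp only [dot, Finset.mul_sum]
  rw [sum_rotate]
  exact Finset.sum_congr rfl fun _ _ => Finset.sum_congr rfl fun _ _ =>
    Finset.sum_congr rfl fun _ _ => by ring

theorem eq_umbilicForm {p q : Mat4} (hpq : p * q = 1) {D : Tensor3}
    (hD : ∀ a m n, D a m n = -D a n m)
    (hF : ∀ a m n, dot (act2 p nullMetric) (D a) (act2 p nullBivector) m n +
      dot (act2 p nullMetric) (act2 p nullBivector) (D a) m n = 0)
    (h1 : act3 q D 0 2 0 = 0) (h2 : act3 q D 2 0 2 = 0) (h3 : act3 q D 1 3 1 = 0)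
    (h4 : act3 q D 3 1 3 = 0) :
    D = umbilicForm (act2 p nullMetric) (act2 p nullBivector)
      (codiffOf (act2 p nullMetric) D) := by
  have hqp : q * p = 1 := mul_eq_one_comm.1 hpq
  have hp := isUnit_det_of_mul_eq_one hpq
  have hq := isUnit_det_of_mul_eq_one hqp
  have hDD : D = act3 p (act3 q D) := by rw [act3_act3, hqp, act3_one]
  rw [hDD, codiffOf_act hp, umbilicForm_act hp]
  congr 1
  refine eq_umbilicForm_null (fun a m n => ?_) (fun a m n => ?_) h1 h2 h3 h4
  · simp only [act3, ← Finset.sum_neg_distrib, ← mul_neg]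
    refine Finset.sum_congr rfl fun i _ => ?_
    rw [← act2_swap q, ← act2_neg]
    congr 2
    funext j k
    exact hD i k j
  · have e : act3 q D a = fun m n => ∑ i, q i a * act2 q (D i) m n := rfl
    rw [e, dot_sum_left nullMetric (fun i => q i a) (fun i => act2 q (D i)),
      dot_sum_right nullMetric (fun i => q i a) (fun i => act2 q (D i)), ← Finset.sum_add_distrib]
    refine Finset.sum_eq_zero fun i _ => ?_
    have g1 : nullMetric = act2 q (act2 p nullMetric) := by rw [act2_act2, hpq, act2_one]
    have f1 : nullBivector = act2 q (act2 p nullBivector) := by rw [act2_act2, hpq, act2_one]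
    rw [g1, f1, dot_act2 hq, dot_act2 hq, ← mul_add, ← act2_add]
    simp only [hF, act2, mul_zero, Finset.sum_const_zero]

theorem crossForm_quadratic {p q : Mat4} (hpq : p * q = 1) (ξ : Tensor1) :
    crossForm (act2 p nullMetric) (fun a b =>
        (ξ a * interior (act2 p nullMetric) ξ (act2 p nullBivector) b -
          interior (act2 p nullMetric) ξ (act2 p nullBivector) a * ξ b) / 2) =
      crossForm (act2 p nullBivector) (fun a b =>
        interior (act2 p nullMetric) ξ (act2 p nullBivector) a *
          interior (act2 p nullMetric) ξ (act2 p nullBivector) b - ξ a * ξ b / 2 +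
        tr (act2 p nullMetric) (fun a b => ξ a * ξ b) / 2 * act2 p nullMetric a b) := by
  have hqp : q * p = 1 := mul_eq_one_comm.1 hpq
  have hp := isUnit_det_of_mul_eq_one hpq
  obtain ⟨ζ, rfl⟩ : ∃ ζ, ξ = act1 p ζ := ⟨act1 q ξ, by rw [act1_act1, hqp, act1_one]⟩
  set χ := interior nullMetric ζ nullBivector with hχ
  have h1 : (fun a b => (act1 p ζ a * act1 p χ b - act1 p χ a * act1 p ζ b) / 2) =
      act2 p (fun a b => (ζ a * χ b - χ a * ζ b) / 2) := by
    funext a b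
    rw [act2_div_const, act2_sub, act2_tmul, act2_tmul]
  have h2 : (fun a b => act1 p ζ a * act1 p ζ b) = act2 p (fun a b => ζ a * ζ b) := by
    funext a b
    rw [act2_tmul]
  have h3 : (fun a b => act1 p χ a * act1 p χ b - act1 p ζ a * act1 p ζ b / 2 +
        tr nullMetric (fun a b => ζ a * ζ b) / 2 * act2 p nullMetric a b) =
      act2 p (fun a b => χ a * χ b - ζ a * ζ b / 2 +
        tr nullMetric (fun a b => ζ a * ζ b) / 2 * nullMetric a b) := by
    funext a b
    rw [act2_add, act2_sub, act2_div_const, act2_tmul, act2_tmul, act2_const_mul]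
  rw [interior_act hp, ← hχ, h1, h2, tr_act2 hp, h3, crossForm_act, crossForm_act,
    crossForm_quadratic_null ζ χ hχ]

/-- The covariant derivative of `umbilicForm g F ξ`, where `N = ∇ξ`, `D = ∇F` and
`X = ∇(i_ξ F)`. -/
noncomputable def umbilicFormDeriv (g F : Tensor2) (χ : Tensor1) (N X : Tensor2) (D : Tensor3) :
    Tensor4 := fun a b m n =>
  -(g b m * N a n - g b n * N a m) / 2 - (D a b m * χ n + F b m * X a n)
    + (D a b n * χ m + F b n * X a m)

/-- Here `∇F` is replaced by its umbilical form and `∇χ` by the Leibniz rule for `χ = i_ξ F`. The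
terms containing `N` already have the shape of `commutatorForm`; those quadratic in `ξ` and `χ`
reduce to the subtraction of `χ ⊗ ξ` from `N` by `crossForm_quadratic`. -/
theorem umbilicFormDeriv_commutator {p q : Mat4} (hpq : p * q = 1) (ξ : Tensor1) (N : Tensor2)
    (a b m n : Fin 4) :
    let g := act2 p nullMetric
    let F := act2 p nullBivector
    let χ := interior g ξ F
    let D := umbilicForm g F ξ
    let X : Tensor2 := fun a n => dot g N F a n + interior g ξ (D a) n
    umbilicFormDeriv g F χ N X D a b m n - umbilicFormDeriv g F χ N X D b a m n =
      commutatorForm g F (fun a b => N a b - χ a * ξ b) a b m n := by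
  intro g F χ D X
  have hqp : q * p = 1 := mul_eq_one_comm.1 hpq
  have hp := isUnit_det_of_mul_eq_one hpq
  have hg : ∀ a b, g a b = g b a := fun a b => by
    simp only [g]
    rw [← act2_swap]
    congr 1
    funext i j
    exact nullMetric_symm _ _
  have hF : ∀ a b, F a b = -F b a := fun a b => by
    simp only [F]
    rw [← act2_swap, ← act2_neg]
    congr 1
    funext i j
    exact nullBivector_antisymm _ _
  have hu : IsUnit (Matrix.of g).det := isUnit_det_act2_nullMetric hpq
  set u : Tensor1 := fun c => ∑ d, ξ d * inv g d c with hu'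
  have hint : ∀ (A : Tensor2) n, interior g ξ A n = ∑ c, u c * A c n := fun A n => by
    simp only [interior, hu', Finset.sum_mul]
  have hug : ∀ n, ∑ c, u c * g c n = ξ n := fun n => by
    have : Matrix.vecMul (Matrix.vecMul ξ (Matrix.of g)⁻¹) (Matrix.of g) = ξ := by
      rw [Matrix.vecMul_vecMul, Matrix.nonsing_inv_mul _ hu, Matrix.vecMul_one]
    exact congrFun this n
  have hχ : ∀ n, χ n = ∑ c, u c * F c n := fun n => hint F n
  -- The 2-form `F` evaluated twice on the vector `ξ`.
  have huχ : ∑ c, u c * χ c = 0 := by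
    have : ∑ c, u c * χ c = -∑ c, u c * χ c := by
      simp only [hχ, Finset.mul_sum]
      conv_rhs => rw [Finset.sum_comm]
      rw [← Finset.sum_neg_distrib]
      refine Finset.sum_congr rfl fun c _ => ?_
      rw [← Finset.sum_neg_distrib]
      refine Finset.sum_congr rfl fun d _ => ?_
      rw [hF d c]
      ring
    linear_combination (1 / 2 : ℂ) * this
  have huξ : ∑ c, u c * ξ c = tr g (fun a b => ξ a * ξ b) := by
    simp only [hu', tr, Finset.sum_mul]
    rw [Finset.sum_comm]
    exact Finset.sum_congr rfl fun _ _ => Finset.sum_congr rfl fun _ _ => by ring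
  -- Contraction of the umbilical form with `ξ`: a multiple of `g` and the squares of `ξ` and `χ`,
  -- hence symmetric.
  have hι : ∀ a n, interior g ξ (D a) n =
      -(ξ a * ξ n - g a n * tr g (fun a b => ξ a * ξ b)) / 2 + χ a * χ n := fun a n => by
    have e : ∀ c, u c * D a c n = -(u c * g c a * ξ n - g a n * (u c * ξ c)) / 2
        + u c * F c a * χ n + F a n * (u c * χ c) := fun c => by
      change u c * (-(g a c * ξ n - g a n * ξ c) / 2 - F a c * χ n + F a n * χ c) = _
      rw [hg a c, hF a c]
      ring
    rw [hint]
    simp only [e, Finset.sum_add_distrib, ← Finset.sum_div, Finset.sum_neg_distrib,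
      Finset.sum_sub_distrib, ← Finset.sum_mul, ← Finset.mul_sum, hug, ← hχ, huχ, huξ]
    ring
  have hdot : dot g (fun a b => N a b - χ a * ξ b) F = fun a n => dot g N F a n - χ a * χ n := by
    funext a n
    have : χ n = ∑ c, ∑ d, ξ c * inv g c d * F d n := by
      rw [hχ]
      simp only [hu', Finset.sum_mul]
      rw [Finset.sum_comm]
    rw [this]
    simp only [dot, sub_mul, Finset.sum_sub_distrib, Finset.mul_sum, mul_assoc]
  have hquad := congrFun (congrFun (congrFun (congrFun (crossForm_quadratic hpq ξ) a) b) m) n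
  change crossForm g (fun a b => (ξ a * χ b - χ a * ξ b) / 2) a b m n =
    crossForm F (fun a b => χ a * χ b - ξ a * ξ b / 2 + tr g (fun a b => ξ a * ξ b) / 2 * g a b)
      a b m n at hquad
  have hDe : ∀ a b m, D a b m = -(g a b * ξ m - g a m * ξ b) / 2 - F a b * χ m + F a m * χ b :=
    fun _ _ _ => rfl
  simp only [crossForm] at hquad
  simp only [commutatorForm, hdot]
  simp only [umbilicFormDeriv, X, hι, hDe]
  rw [hg b a, hF b a]
  linear_combination hquad

end TwoPlusTwo

namespace TwoPlusTwo

open Matrix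

/-! ## Partial derivatives -/

section PartialDerivatives

variable {f h : E4 → ℂ} {y : E4} {Ω : Set E4}

theorem pd_add (hf : DifferentiableAt ℝ f y) (hh : DifferentiableAt ℝ h y) (a : Fin 4) :
    pd (fun z => f z + h z) a y = pd f a y + pd h a y := by
  simp only [pd, fderiv_fun_add hf hh, _root_.add_apply]

theorem pd_sub (hf : DifferentiableAt ℝ f y) (hh : DifferentiableAt ℝ h y) (a : Fin 4) :
    pd (fun z => f z - h z) a y = pd f a y - pd h a y := by
  simp only [pd, fderiv_fun_sub hf hh, _root_.sub_apply]

theorem pd_neg (a : Fin 4) : pd (fun z => -f z) a y = -pd f a y := by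
  simp only [pd, fderiv_fun_neg, _root_.neg_apply]

theorem pd_mul (hf : DifferentiableAt ℝ f y) (hh : DifferentiableAt ℝ h y) (a : Fin 4) :
    pd (fun z => f z * h z) a y = pd f a y * h y + f y * pd h a y := by
  simp only [pd, fderiv_fun_mul hf hh, _root_.add_apply,
    _root_.smul_apply, smul_eq_mul]
  ring

theorem pd_div_const (hf : DifferentiableAt ℝ f y) (c : ℂ) (a : Fin 4) :
    pd (fun z => f z / c) a y = pd f a y / c := by
  simp only [div_eq_mul_inv]
  rw [pd_mul hf (differentiableAt_const _)]
  simp [pd]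

theorem pd_sum {ι : Type*} [Fintype ι] {F : ι → E4 → ℂ} (hF : ∀ i, DifferentiableAt ℝ (F i) y)
    (a : Fin 4) : pd (fun z => ∑ i, F i z) a y = ∑ i, pd (F i) a y := by
  simp only [pd, fderiv_fun_sum fun i _ => hF i, _root_.sum_apply]

theorem pd_congr (hΩ : IsOpen Ω) (hfh : ∀ z ∈ Ω, f z = h z) (hy : y ∈ Ω) (a : Fin 4) :
    pd f a y = pd h a y := by
  have : f =ᶠ[nhds y] h := Filter.eventually_of_mem (hΩ.mem_nhds hy) hfh
  simp only [pd, this.fderiv_eq]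

theorem contDiffOn_pd (hΩ : IsOpen Ω) (hf : ContDiffOn ℝ ∞ f Ω) (a : Fin 4) :
    ContDiffOn ℝ ∞ (pd f a) Ω :=
  (hf.fderiv_of_isOpen hΩ (by simp)).clm_apply contDiffOn_const

theorem differentiableAt_of_contDiffOn (hΩ : IsOpen Ω) (hf : ContDiffOn ℝ ∞ f Ω) (hy : y ∈ Ω) :
    DifferentiableAt ℝ f y :=
  (hf.contDiffAt (hΩ.mem_nhds hy)).differentiableAt (by simp)

theorem pd_comm (hΩ : IsOpen Ω) (hf : ContDiffOn ℝ ∞ f Ω) (hy : y ∈ Ω) (a b : Fin 4) :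
    pd (pd f a) b y = pd (pd f b) a y := by
  have h1 : ContDiffAt ℝ ∞ f y := hf.contDiffAt (hΩ.mem_nhds hy)
  have h2 : DifferentiableAt ℝ (fderiv ℝ f) y :=
    (h1.fderiv_right (m := ∞) (by simp)).differentiableAt (by simp)
  have h3 : IsSymmSndFDerivAt ℝ f y := h1.isSymmSndFDerivAt (by
    simp only [minSmoothness_of_isRCLikeNormedField]
    exact WithTop.coe_le_coe.2 (le_top : (2 : ℕ∞) ≤ ⊤))
  have h4 : ∀ a b, pd (pd f a) b y = fderiv ℝ (fderiv ℝ f) y (EuclideanSpace.single b 1)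
      (EuclideanSpace.single a 1) := fun a b => by
    change fderiv ℝ (fun z => fderiv ℝ f z (EuclideanSpace.single a 1)) y _ = _
    rw [fderiv_clm_apply h2 (differentiableAt_const _)]
    simp
  rw [h4, h4, h3.eq]

end PartialDerivatives

/-! ### Matrices of functions -/

section Matrices

variable {l m n : Type*} [Fintype m] {y : E4} {Ω : Set E4}

/-- The entrywise partial derivative of a matrix. -/
noncomputable def pdMat (A : E4 → Matrix l n ℂ) (c : Fin 4) (y : E4) : Matrix l n ℂ :=
  Matrix.of fun i j => pd (fun z => A z i j) c y

/-- Smoothness of the entries of a matrix. -/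
def SmoothMat (A : E4 → Matrix l n ℂ) (Ω : Set E4) : Prop :=
  ∀ i j, ContDiffOn ℝ ∞ (fun z => A z i j) Ω

theorem SmoothMat.differentiableAt {A : E4 → Matrix l n ℂ} (hA : SmoothMat A Ω) (hΩ : IsOpen Ω)
    (hy : y ∈ Ω) (i : l) (j : n) : DifferentiableAt ℝ (fun z => A z i j) y :=
  differentiableAt_of_contDiffOn hΩ (hA i j) hy

theorem SmoothMat.mul {A : E4 → Matrix l m ℂ} {B : E4 → Matrix m n ℂ} (hA : SmoothMat A Ω)
    (hB : SmoothMat B Ω) : SmoothMat (fun z => A z * B z) Ω := fun i j => by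
  simp only [Matrix.mul_apply]
  exact ContDiffOn.sum fun k _ => (hA i k).mul (hB k j)

theorem SmoothMat.sub {A B : E4 → Matrix l n ℂ} (hA : SmoothMat A Ω)
    (hB : SmoothMat B Ω) : SmoothMat (fun z => A z - B z) Ω := fun i j => (hA i j).sub (hB i j)

theorem SmoothMat.transpose {A : E4 → Matrix l n ℂ} (hA : SmoothMat A Ω) :
    SmoothMat (fun z => (A z)ᵀ) Ω := fun i j => hA j i

theorem SmoothMat.pdMat {A : E4 → Matrix l n ℂ} (hA : SmoothMat A Ω) (hΩ : IsOpen Ω)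
    (c : Fin 4) : SmoothMat (pdMat A c) Ω := fun i j => contDiffOn_pd hΩ (hA i j) c

theorem pdMat_mul {A : E4 → Matrix l m ℂ} {B : E4 → Matrix m n ℂ} (hΩ : IsOpen Ω)
    (hA : SmoothMat A Ω) (hB : SmoothMat B Ω) (hy : y ∈ Ω) (c : Fin 4) :
    pdMat (fun z => A z * B z) c y = pdMat A c y * B y + A y * pdMat B c y := by
  ext i j
  simp only [pdMat, Matrix.mul_apply, Matrix.of_apply, Matrix.add_apply]
  rw [pd_sum (F := fun k z => A z i k * B z k j) fun k =>
      (hA.differentiableAt hΩ hy i k).fun_mul (hB.differentiableAt hΩ hy k j),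
    ← Finset.sum_add_distrib]
  exact Finset.sum_congr rfl fun k _ =>
    pd_mul (hA.differentiableAt hΩ hy i k) (hB.differentiableAt hΩ hy k j) c

theorem pdMat_sub {A B : E4 → Matrix l n ℂ} (hΩ : IsOpen Ω)
    (hA : SmoothMat A Ω) (hB : SmoothMat B Ω) (hy : y ∈ Ω) (c : Fin 4) :
    pdMat (fun z => A z - B z) c y = pdMat A c y - pdMat B c y := by
  ext i j
  exact pd_sub (hA.differentiableAt hΩ hy i j) (hB.differentiableAt hΩ hy i j) c

theorem pdMat_transpose (A : E4 → Matrix l n ℂ) (c : Fin 4) :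
    pdMat (fun z => (A z)ᵀ) c y = (pdMat A c y)ᵀ := rfl

theorem pdMat_congr {A B : E4 → Matrix l n ℂ} (hΩ : IsOpen Ω) (h : ∀ z ∈ Ω, A z = B z)
    (hy : y ∈ Ω) (c : Fin 4) : pdMat A c y = pdMat B c y := by
  ext i j
  exact pd_congr hΩ (fun z hz => by rw [h z hz]) hy c

theorem pdMat_comm {A : E4 → Matrix l n ℂ} (hΩ : IsOpen Ω) (hA : SmoothMat A Ω) (hy : y ∈ Ω)
    (a b : Fin 4) : pdMat (pdMat A a) b y = pdMat (pdMat A b) a y := by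
  ext i j
  exact pd_comm hΩ (hA i j) hy a b

theorem pdMat_const (A : Matrix l n ℂ) (c : Fin 4) : pdMat (fun _ => A) c y = 0 := by
  ext i j
  simp [pdMat, pd]

end Matrices

/-- Cramer's rule: an entry of the inverse is the quotient of a determinant with one row replaced by
the nonvanishing determinant. -/
theorem SmoothMat.inv {A : E4 → Mat4} {Ω : Set E4} (hA : SmoothMat A Ω)
    (h : ∀ z ∈ Ω, IsUnit (A z).det) : SmoothMat (fun z => (A z)⁻¹) Ω := by
  have hdet : ∀ B : E4 → Mat4, SmoothMat B Ω → ContDiffOn ℝ ∞ (fun z => (B z).det) Ω := by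
    intro B hB
    simp only [Matrix.det_apply]
    exact ContDiffOn.sum fun σ _ => (contDiffOn_prod fun i _ => hB (σ i) i).const_smul _
  intro i j
  simp only [Matrix.inv_def, Ring.inverse_eq_inv', Matrix.smul_apply, smul_eq_mul]
  refine ((hdet A hA).inv fun z hz => (h z hz).ne_zero).mul ?_
  simp only [Matrix.adjugate_apply]
  refine hdet _ fun k l => ?_
  by_cases hk : k = j
  · subst hk
    simpa using contDiffOn_const
  · simpa [Matrix.updateRow_ne hk] using hA k l

/-! ## The Levi-Civita connection -/

/-- `g` gives the components of a smooth metric on the open set `Ω`. -/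
structure MetricOn (g : E4 → Tensor2) (Ω : Set E4) : Prop where
  isOpen : IsOpen Ω
  symm : ∀ z a b, g z a b = g z b a
  isUnit_det : ∀ z ∈ Ω, IsUnit (Matrix.of (g z)).det
  smooth : SmoothMat (fun z => Matrix.of (g z)) Ω

/-- The matrix `(Γ_a)^l_k = Γ^l_{ak}` of the connection. -/
noncomputable def connMat (g : E4 → Tensor2) (a : Fin 4) (y : E4) : Mat4 :=
  Matrix.of fun l k => christoffel g y l a k

theorem of_nabla2 (g F : E4 → Tensor2) (y : E4) (a : Fin 4) :
    Matrix.of (nabla2 g F y a) = pdMat (fun z => Matrix.of (F z)) a y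
      - (connMat g a y)ᵀ * Matrix.of (F y) - Matrix.of (F y) * connMat g a y := by
  ext m n
  simp only [nabla2, connMat, pdMat, Matrix.mul_apply, Matrix.sub_apply, Matrix.of_apply,
    Matrix.transpose_apply]
  congr 1
  exact Finset.sum_congr rfl fun _ _ => by ring

section

variable {g : E4 → Tensor2} {Ω : Set E4} {y : E4}

/-! ### Metric compatibility, the Leibniz rule and curvature -/

theorem MetricOn.transpose (hg : MetricOn g Ω) (z : E4) : (Matrix.of (g z))ᵀ = Matrix.of (g z) := by
  ext a b
  exact hg.symm z b a

theorem MetricOn.smooth_inv (hg : MetricOn g Ω) : SmoothMat (fun z => invMat (g z)) Ω :=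
  hg.smooth.inv hg.isUnit_det

theorem MetricOn.mul_inv (hg : MetricOn g Ω) (hy : y ∈ Ω) :
    Matrix.of (g y) * invMat (g y) = 1 := Matrix.mul_nonsing_inv _ (hg.isUnit_det y hy)

theorem MetricOn.inv_mul (hg : MetricOn g Ω) (hy : y ∈ Ω) :
    invMat (g y) * Matrix.of (g y) = 1 := Matrix.nonsing_inv_mul _ (hg.isUnit_det y hy)

theorem MetricOn.christoffel_symm (hg : MetricOn g Ω) (y : E4) (c a b : Fin 4) :
    christoffel g y c a b = christoffel g y c b a := by
  -- Symmetry is available at every point, not just on `Ω`, so the two components are equal as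
  -- functions and have equal derivatives.
  have : (fun z => g z a b) = fun z => g z b a := funext fun z => hg.symm z a b
  simp only [christoffel, this]
  congr 1
  exact Finset.sum_congr rfl fun _ _ => by ring

theorem MetricOn.smooth_connMat (hg : MetricOn g Ω) (a : Fin 4) : SmoothMat (connMat g a) Ω := by
  intro l k
  simp only [connMat, christoffel, Matrix.of_apply]
  refine (ContDiffOn.sum fun d _ => (hg.smooth_inv l d).mul ?_).div_const _
  exact ((contDiffOn_pd hg.isOpen (hg.smooth k d) _).add
    (contDiffOn_pd hg.isOpen (hg.smooth a d) _)).sub (contDiffOn_pd hg.isOpen (hg.smooth a k) _)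

/-- Lowering the upper index cancels the inverse metric and leaves the Christoffel symbols of the
first kind; adding the transpose gives `∇g = 0`. -/
theorem MetricOn.mul_connMat (hg : MetricOn g Ω) (hy : y ∈ Ω) (a k d : Fin 4) :
    (Matrix.of (g y) * connMat g a y) k d =
      (pd (fun z => g z d k) a y + pd (fun z => g z a k) d y - pd (fun z => g z a d) k y) / 2 := by
  set w : Fin 4 → ℂ := fun k =>
    (pd (fun z => g z d k) a y + pd (fun z => g z a k) d y - pd (fun z => g z a d) k y) / 2 with hw
  have h : ∀ l, connMat g a y l d = (invMat (g y) *ᵥ w) l := fun l => by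
    simp only [connMat, christoffel, Matrix.of_apply, Matrix.mulVec, dotProduct, hw, invMat,
      Finset.sum_div, mul_div_assoc]
  have : (Matrix.of (g y) * connMat g a y) k d = (Matrix.of (g y) *ᵥ (invMat (g y) *ᵥ w)) k := by
    simp only [Matrix.mul_apply, h, Matrix.mulVec, dotProduct]
  rw [this, Matrix.mulVec_mulVec, hg.mul_inv hy, Matrix.one_mulVec]

theorem MetricOn.pdMat_metric (hg : MetricOn g Ω) (hy : y ∈ Ω) (a : Fin 4) :
    pdMat (fun z => Matrix.of (g z)) a y =
      (connMat g a y)ᵀ * Matrix.of (g y) + Matrix.of (g y) * connMat g a y := by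
  have h1 : (connMat g a y)ᵀ * Matrix.of (g y) = (Matrix.of (g y) * connMat g a y)ᵀ := by
    rw [Matrix.transpose_mul, hg.transpose]
  have hs : ∀ a b, (fun z => g z a b) = fun z => g z b a :=
    fun a b => funext fun z => hg.symm z a b
  ext k d
  rw [h1, Matrix.add_apply, Matrix.transpose_apply, hg.mul_connMat hy, hg.mul_connMat hy]
  simp only [pdMat, Matrix.of_apply, hs d k]
  ring

theorem MetricOn.nabla2_metric (hg : MetricOn g Ω) (hy : y ∈ Ω) (a m n : Fin 4) :
    nabla2 g g y a m n = 0 := by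
  have := of_nabla2 g g y a
  rw [hg.pdMat_metric hy, add_sub_cancel_left, sub_self] at this
  exact congrFun (congrFun this m) n

theorem MetricOn.pdMat_inv (hg : MetricOn g Ω) (hy : y ∈ Ω) (a : Fin 4) :
    pdMat (fun z => invMat (g z)) a y =
      -(connMat g a y * invMat (g y)) - invMat (g y) * (connMat g a y)ᵀ := by
  -- The derivative of the inverse metric is found by differentiating `g g⁻¹ = 1` and multiplying by
  -- `g⁻¹`.
  have h1 := pdMat_mul hg.isOpen hg.smooth hg.smooth_inv hy a
  have h2 : pdMat (fun z => Matrix.of (g z) * invMat (g z)) a y = 0 := by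
    rw [pdMat_congr hg.isOpen (fun z hz => hg.mul_inv hz) hy, pdMat_const]
  have h3 := congrArg (invMat (g y) * ·) (h1.symm.trans h2)
  simp only [mul_add, mul_zero, hg.pdMat_metric hy, ← mul_assoc, hg.inv_mul hy, one_mul, add_mul] at h3
  simp only [mul_assoc, hg.mul_inv hy, mul_one] at h3
  rw [← sub_eq_zero, ← h3]
  noncomm_ring

/-- The Leibniz rule for the covariant derivative of `A · B`. -/
theorem MetricOn.nabla2_dot (hg : MetricOn g Ω) {A B : E4 → Tensor2}
    (hA : SmoothMat (fun z => Matrix.of (A z)) Ω) (hB : SmoothMat (fun z => Matrix.of (B z)) Ω)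
    (hy : y ∈ Ω) (a m n : Fin 4) :
    nabla2 g (fun z => dot (g z) (A z) (B z)) y a m n =
      dot (g y) (nabla2 g A y a) (B y) m n + dot (g y) (A y) (nabla2 g B y a) m n := by
  have h : Matrix.of (nabla2 g (fun z => dot (g z) (A z) (B z)) y a) =
      Matrix.of (dot (g y) (nabla2 g A y a) (B y)) +
        Matrix.of (dot (g y) (A y) (nabla2 g B y a)) := by
    simp only [of_nabla2, of_dot]
    rw [pdMat_mul hg.isOpen (hA.mul hg.smooth_inv) hB hy, pdMat_mul hg.isOpen hA hg.smooth_inv hy,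
      hg.pdMat_inv hy]
    noncomm_ring
  exact congrFun (congrFun h m) n

/-- The curvature matrix `(R_{ab})^k_s`. -/
noncomputable def curvMat (g : E4 → Tensor2) (a b : Fin 4) (y : E4) : Mat4 :=
  pdMat (connMat g b) a y - pdMat (connMat g a) b y + connMat g a y * connMat g b y
    - connMat g b y * connMat g a y

theorem riemann_eq (g : E4 → Tensor2) (y : E4) (r s a b : Fin 4) :
    riemann g y r s a b = (Matrix.of (g y) * curvMat g a b y) r s := by
  simp only [riemann, curvMat, Matrix.mul_apply, Matrix.sub_apply, Matrix.add_apply, connMat, pdMat,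
    Matrix.of_apply]

/-- The Ricci identity for a 2-tensor. -/
theorem MetricOn.ricci_identity (hg : MetricOn g Ω) {F : E4 → Tensor2}
    (hF : SmoothMat (fun z => Matrix.of (F z)) Ω) (hy : y ∈ Ω) (a b m n : Fin 4) :
    nabla3 g (nabla2 g F) y a b m n - nabla3 g (nabla2 g F) y b a m n =
      (-((curvMat g a b y)ᵀ * Matrix.of (F y)) - Matrix.of (F y) * curvMat g a b y) m n := by
  have h : ∀ a b, Matrix.of (nabla3 g (nabla2 g F) y a b) =
      pdMat (fun z => Matrix.of (nabla2 g F z b)) a y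
      - (Matrix.of fun m n => ∑ c, christoffel g y c a b * nabla2 g F y c m n)
      - (connMat g a y)ᵀ * Matrix.of (nabla2 g F y b)
      - Matrix.of (nabla2 g F y b) * connMat g a y := fun a b => by
    ext m n
    simp only [nabla3, connMat, pdMat, Matrix.mul_apply, Matrix.sub_apply, Matrix.of_apply,
      Matrix.transpose_apply]
    congr 1
    exact Finset.sum_congr rfl fun _ _ => by ring
  have hD : ∀ a b, pdMat (fun z => Matrix.of (nabla2 g F z b)) a y =
      pdMat (pdMat (fun z => Matrix.of (F z)) b) a y -
        ((pdMat (connMat g b) a y)ᵀ * Matrix.of (F y) +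
          (connMat g b y)ᵀ * pdMat (fun z => Matrix.of (F z)) a y) -
        (pdMat (fun z => Matrix.of (F z)) a y * connMat g b y +
          Matrix.of (F y) * pdMat (connMat g b) a y) := fun a b => by
    have hG := hg.smooth_connMat b
    simp only [of_nabla2]
    rw [pdMat_sub hg.isOpen ((hF.pdMat hg.isOpen b).sub (hG.transpose.mul hF)) (hF.mul hG) hy,
      pdMat_sub hg.isOpen (hF.pdMat hg.isOpen b) (hG.transpose.mul hF) hy,
      pdMat_mul hg.isOpen hG.transpose hF hy, pdMat_mul hg.isOpen hF hG hy, pdMat_transpose]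
  have key : Matrix.of (nabla3 g (nabla2 g F) y a b) - Matrix.of (nabla3 g (nabla2 g F) y b a) =
      -((curvMat g a b y)ᵀ * Matrix.of (F y)) - Matrix.of (F y) * curvMat g a b y := by
    have hs : (fun m n => ∑ c, christoffel g y c a b * nabla2 g F y c m n) =
        fun m n => ∑ c, christoffel g y c b a * nabla2 g F y c m n := by
      funext m n
      simp only [hg.christoffel_symm y _ a b]
    rw [h, h, hD, hD, hs, of_nabla2, of_nabla2, pdMat_comm hg.isOpen hF hy a b]
    simp only [curvMat, Matrix.transpose_sub, Matrix.transpose_add, Matrix.transpose_mul]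
    noncomm_ring
  exact congrFun (congrFun key m) n

/-- Antisymmetry in the first pair is the Ricci identity for `g` itself, whose covariant derivative
vanishes near the point; antisymmetry in the second pair is built in; the Bianchi identity uses only
the symmetry of the Christoffel symbols in their lower indices. -/
theorem MetricOn.isCurvatureLike_riemann (hg : MetricOn g Ω) (hy : y ∈ Ω) :
    IsCurvatureLike (riemann g y) where
  antisymm_left r s a b := by
    have h := hg.ricci_identity hg.smooth hy a b r s
    have h0 : ∀ a b m n, nabla3 g (nabla2 g g) y a b m n = 0 := fun a b m n => by
      have hz : ∀ z ∈ Ω, nabla2 g g z b m n = 0 := fun z hz => hg.nabla2_metric hz b m n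
      simp only [nabla3, hg.nabla2_metric hy, mul_zero, Finset.sum_const_zero, sub_zero]
      rw [pd_congr hg.isOpen hz hy]
      simp [pd]
    have ht : (curvMat g a b y)ᵀ * Matrix.of (g y) = (Matrix.of (g y) * curvMat g a b y)ᵀ := by
      rw [Matrix.transpose_mul, hg.transpose]
    rw [h0, h0, ht, Matrix.sub_apply, Matrix.neg_apply, Matrix.transpose_apply, ← riemann_eq,
      ← riemann_eq] at h
    linear_combination h
  antisymm_right r s a b := by
    have : curvMat g a b y = -curvMat g b a y := by
      simp only [curvMat]
      abel
    rw [riemann_eq, riemann_eq, this, mul_neg, Matrix.neg_apply]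
  bianchi r s a b := by
    have hs : ∀ (k a b : Fin 4), (fun z => christoffel g z k a b) = fun z => christoffel g z k b a :=
      fun k a b => funext fun z => hg.christoffel_symm z k a b
    simp only [riemann, ← Finset.sum_add_distrib, ← mul_add]
    refine Finset.sum_eq_zero fun k _ => ?_
    simp only [hs k b s, hs k a s, hs k b a, hg.christoffel_symm y _ b s,
      hg.christoffel_symm y _ a s, hg.christoffel_symm y _ b a]
    ring

end

end TwoPlusTwo

namespace TwoPlusTwo

open Matrix

section

variable {g : E4 → Tensor2} {Ω : Set E4} {y : E4}

/-! ### Locality and linearity of covariant derivatives -/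

theorem nabla2_congr (hΩ : IsOpen Ω) {A B : E4 → Tensor2} (h : ∀ z ∈ Ω, A z = B z) (hy : y ∈ Ω) :
    nabla2 g A y = nabla2 g B y := by
  funext a m n
  simp only [nabla2, h y hy, pd_congr hΩ (fun z hz => congrFun (congrFun (h z hz) m) n) hy]

theorem nabla3_congr (hΩ : IsOpen Ω) {A B : E4 → Tensor3} (h : ∀ z ∈ Ω, A z = B z) (hy : y ∈ Ω) :
    nabla3 g A y = nabla3 g B y := by
  funext a b m n
  simp only [nabla3, h y hy,
    pd_congr hΩ (fun z hz => congrFun (congrFun (congrFun (h z hz) b) m) n) hy]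

theorem nabla2_add (hΩ : IsOpen Ω) {A B : E4 → Tensor2}
    (hA : SmoothMat (fun z => Matrix.of (A z)) Ω) (hB : SmoothMat (fun z => Matrix.of (B z)) Ω)
    (hy : y ∈ Ω) (a m n : Fin 4) :
    nabla2 g (fun z a b => A z a b + B z a b) y a m n = nabla2 g A y a m n + nabla2 g B y a m n := by
  simp only [nabla2, mul_add, Finset.sum_add_distrib]
  have h1 : DifferentiableAt ℝ (fun z => A z m n) y := hA.differentiableAt hΩ hy m n
  have h2 : DifferentiableAt ℝ (fun z => B z m n) y := hB.differentiableAt hΩ hy m n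
  rw [pd_add h1 h2]
  ring

theorem nabla2_sub (hΩ : IsOpen Ω) {A B : E4 → Tensor2}
    (hA : SmoothMat (fun z => Matrix.of (A z)) Ω) (hB : SmoothMat (fun z => Matrix.of (B z)) Ω)
    (hy : y ∈ Ω) (a m n : Fin 4) :
    nabla2 g (fun z a b => A z a b - B z a b) y a m n = nabla2 g A y a m n - nabla2 g B y a m n := by
  simp only [nabla2, mul_sub, Finset.sum_sub_distrib]
  have h1 : DifferentiableAt ℝ (fun z => A z m n) y := hA.differentiableAt hΩ hy m n
  have h2 : DifferentiableAt ℝ (fun z => B z m n) y := hB.differentiableAt hΩ hy m n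
  rw [pd_sub h1 h2]
  ring

theorem nabla2_div_const (hΩ : IsOpen Ω) {A : E4 → Tensor2}
    (hA : SmoothMat (fun z => Matrix.of (A z)) Ω) (c : ℂ) (hy : y ∈ Ω) (a m n : Fin 4) :
    nabla2 g (fun z a b => A z a b / c) y a m n = nabla2 g A y a m n / c := by
  simp only [nabla2, mul_div_assoc', ← Finset.sum_div]
  have h1 : DifferentiableAt ℝ (fun z => A z m n) y := hA.differentiableAt hΩ hy m n
  rw [pd_div_const h1]
  ring

theorem nabla2_antisymm (hΩ : IsOpen Ω) {F : E4 → Tensor2}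
    (hF : ∀ z ∈ Ω, ∀ a b, F z a b = -F z b a) (hy : y ∈ Ω) (a m n : Fin 4) :
    nabla2 g F y a m n = -nabla2 g F y a n m := by
  have : pd (fun z => F z m n) a y = -pd (fun z => F z n m) a y := by
    rw [← pd_neg]
    exact pd_congr hΩ (fun z hz => hF z hz m n) hy a
  simp only [nabla2, this, hF y hy _ n, hF y hy m, mul_neg, Finset.sum_neg_distrib]
  ring

theorem SmoothMat.nabla2 (hg : MetricOn g Ω) {F : E4 → Tensor2}
    (hF : SmoothMat (fun z => Matrix.of (F z)) Ω) (a : Fin 4) :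
    SmoothMat (fun z => Matrix.of (nabla2 g F z a)) Ω := by
  simp only [of_nabla2]
  exact ((hF.pdMat hg.isOpen a).sub ((hg.smooth_connMat a).transpose.mul hF)).sub
    (hF.mul (hg.smooth_connMat a))

/-! ### The derivative of the umbilical form -/

theorem nabla3_tmul {A : E4 → Tensor2} {w : E4 → Tensor1}
    (hA : ∀ a b, DifferentiableAt ℝ (fun z => A z a b) y)
    (hw : ∀ a, DifferentiableAt ℝ (fun z => w z a) y) (a b m n : Fin 4) :
    nabla3 g (fun z b m n => A z b m * w z n) y a b m n =
      nabla2 g A y a b m * w y n + A y b m * nabla1 g w y a n := by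
  simp only [nabla3, nabla2, nabla1]
  rw [pd_mul (hA b m) (hw n)]
  simp only [sub_mul, mul_sub, Finset.sum_mul, Finset.mul_sum, mul_assoc]
  have : ∀ c, A y b m * (christoffel g y c a n * w y c) = christoffel g y c a n * (A y b m * w y c) :=
    fun c => by ring
  simp only [this]
  ring

/-- The pattern is that of `umbilicForm`, with `P = g ⊗ ξ` and `Q = F ⊗ χ`. -/
theorem nabla3_umbilic {P Q : E4 → Tensor3}
    (hP : ∀ a b c, DifferentiableAt ℝ (fun z => P z a b c) y)
    (hQ : ∀ a b c, DifferentiableAt ℝ (fun z => Q z a b c) y) (a b m n : Fin 4) :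
    nabla3 g (fun z b m n => -(P z b m n - P z b n m) / 2 - Q z b m n + Q z b n m) y a b m n =
      -(nabla3 g P y a b m n - nabla3 g P y a b n m) / 2 - nabla3 g Q y a b m n
        + nabla3 g Q y a b n m := by
  have h : pd (fun z => -(P z b m n - P z b n m) / 2 - Q z b m n + Q z b n m) a y =
      -(pd (fun z => P z b m n) a y - pd (fun z => P z b n m) a y) / 2 -
        pd (fun z => Q z b m n) a y + pd (fun z => Q z b n m) a y := by
    have h1 : DifferentiableAt ℝ (fun z => -(P z b m n - P z b n m)) y :=
      ((hP _ _ _).fun_sub (hP _ _ _)).fun_neg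
    have h2 : DifferentiableAt ℝ (fun z => -(P z b m n - P z b n m) / 2) y := by
      simp only [div_eq_mul_inv]
      exact h1.fun_mul (differentiableAt_const _)
    rw [pd_add (h2.fun_sub (hQ _ _ _)) (hQ _ _ _), pd_sub h2 (hQ _ _ _), pd_div_const h1, pd_neg,
      pd_sub (hP _ _ _) (hP _ _ _)]
  simp only [nabla3, h, Fin.sum_univ_four]
  ring

/-- A covector as a row matrix. -/
def rowMat (w : Tensor1) : Matrix Unit (Fin 4) ℂ := Matrix.of fun _ b => w b

theorem rowMat_nabla1 (g : E4 → Tensor2) (w : E4 → Tensor1) (y : E4) (a : Fin 4) :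
    rowMat (nabla1 g w y a) = pdMat (fun z => rowMat (w z)) a y - rowMat (w y) * connMat g a y := by
  ext i b
  simp only [rowMat, nabla1, pdMat, connMat, Matrix.sub_apply, Matrix.mul_apply, Matrix.of_apply]
  congr 1
  exact Finset.sum_congr rfl fun _ _ => by ring

theorem rowMat_interior (g : Tensor2) (ξ : Tensor1) (F : Tensor2) :
    rowMat (interior g ξ F) = rowMat ξ * invMat g * Matrix.of F := by
  ext i b
  rw [rowMat, Matrix.of_apply, interior_eq, ← Matrix.vecMul_vecMul]
  simp only [Matrix.mul_apply, Matrix.vecMul, dotProduct, rowMat, Matrix.of_apply]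

theorem nabla1_interior (hg : MetricOn g Ω) {F : E4 → Tensor2} {ξ : E4 → Tensor1}
    (hF : SmoothMat (fun z => Matrix.of (F z)) Ω) (hξ : SmoothMat (fun z => rowMat (ξ z)) Ω)
    (hy : y ∈ Ω) (a n : Fin 4) :
    nabla1 g (fun z => interior (g z) (ξ z) (F z)) y a n =
      dot (g y) (nabla1 g ξ y) (F y) a n + interior (g y) (ξ y) (nabla2 g F y a) n := by
  have h : rowMat (nabla1 g (fun z => interior (g z) (ξ z) (F z)) y a) =
      rowMat (nabla1 g ξ y a) * invMat (g y) * Matrix.of (F y) +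
        rowMat (interior (g y) (ξ y) (nabla2 g F y a)) := by
    simp only [rowMat_interior, rowMat_nabla1, of_nabla2]
    rw [pdMat_mul hg.isOpen (hξ.mul hg.smooth_inv) hF hy, pdMat_mul hg.isOpen hξ hg.smooth_inv hy,
      hg.pdMat_inv hy]
    simp only [Matrix.add_mul, Matrix.sub_mul, Matrix.mul_sub, Matrix.mul_assoc, Matrix.mul_neg,
      Matrix.neg_mul]
    abel
  have h' : (rowMat (nabla1 g ξ y a) * invMat (g y) * Matrix.of (F y)) () n =
      dot (g y) (nabla1 g ξ y) (F y) a n := by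
    simp only [Matrix.mul_apply, rowMat, invMat, Matrix.of_apply, dot, Finset.sum_mul]
    rw [Finset.sum_comm]
  rw [← h']
  exact congrFun (congrFun h ()) n

theorem smooth_codiff (hg : MetricOn g Ω) {F : E4 → Tensor2}
    (hF : SmoothMat (fun z => Matrix.of (F z)) Ω) : SmoothMat (fun z => rowMat (codiff g F z)) Ω :=
  fun _ b => (ContDiffOn.sum fun a _ => ContDiffOn.sum fun c _ =>
    (hg.smooth_inv a c).mul (hF.nabla2 hg c a b)).neg

/-- The commutator of the second covariant derivatives of a bivector of umbilical type. -/
theorem nabla3_commutator (hg : MetricOn g Ω) {F : E4 → Tensor2}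
    (hF : SmoothMat (fun z => Matrix.of (F z)) Ω)
    (hK : ∀ z ∈ Ω, nabla2 g F z = umbilicForm (g z) (F z) (codiff g F z)) (hy : y ∈ Ω)
    {p q : Mat4} (hpq : p * q = 1) (hgp : g y = act2 p nullMetric)
    (hFp : F y = act2 p nullBivector) (a b m n : Fin 4) :
    nabla3 g (nabla2 g F) y a b m n - nabla3 g (nabla2 g F) y b a m n =
      commutatorForm (g y) (F y) (tensorT g F y) a b m n := by
  have hξ := smooth_codiff hg hF
  set ξ := codiff g F with hξdef
  set χ : E4 → Tensor1 := fun z => interior (g z) (ξ z) (F z) with hχdef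
  have hχ : SmoothMat (fun z => rowMat (χ z)) Ω := by
    simp only [χ, rowMat_interior]
    exact (hξ.mul hg.smooth_inv).mul hF
  have dg : ∀ a b, DifferentiableAt ℝ (fun z => g z a b) y := fun a b =>
    hg.smooth.differentiableAt hg.isOpen hy a b
  have dF : ∀ a b, DifferentiableAt ℝ (fun z => F z a b) y := fun a b =>
    hF.differentiableAt hg.isOpen hy a b
  have dξ : ∀ a, DifferentiableAt ℝ (fun z => ξ z a) y := fun a =>
    hξ.differentiableAt hg.isOpen hy () a
  have dχ : ∀ a, DifferentiableAt ℝ (fun z => χ z a) y := fun a =>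
    hχ.differentiableAt hg.isOpen hy () a
  have h1 : ∀ a b, nabla3 g (nabla2 g F) y a b m n =
      umbilicFormDeriv (g y) (F y) (χ y) (nabla1 g ξ y) (nabla1 g χ y) (nabla2 g F y) a b m n := by
    intro a b
    -- The umbilical formula holds on an open set, so it can be differentiated.
    rw [nabla3_congr hg.isOpen hK hy]
    have := nabla3_umbilic (g := g) (P := fun z b m n => g z b m * ξ z n)
      (Q := fun z b m n => F z b m * χ z n) (fun a b c => (dg a b).fun_mul (dξ c))
      (fun a b c => (dF a b).fun_mul (dχ c)) a b m n
    refine this.trans ?_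
    rw [nabla3_tmul dg dξ, nabla3_tmul dg dξ, nabla3_tmul dF dχ, nabla3_tmul dF dχ,
      hg.nabla2_metric hy, hg.nabla2_metric hy]
    simp only [umbilicFormDeriv]
    ring
  have h2 : nabla1 g χ y = fun a n => dot (g y) (nabla1 g ξ y) (F y) a n +
      interior (g y) (ξ y) (umbilicForm (g y) (F y) (ξ y) a) n := by
    funext a n
    rw [nabla1_interior hg hF hξ hy, hK y hy]
  rw [h1, h1, h2, hK y hy]
  have := umbilicFormDeriv_commutator hpq (ξ y) (nabla1 g ξ y) a b m n
  simp only [← hgp, ← hFp] at this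
  exact this

/-! ### The second fundamental form -/

/-- The covariant derivative of the projected coordinate vector is the contraction of `∇w` plus a
connection term with values in the plane. The complementary projector removes the latter, since the
plane's projector is idempotent. -/
theorem secondForm_eq (hg : MetricOn g Ω) {w : E4 → Tensor2}
    (hw : SmoothMat (fun z => Matrix.of (w z)) Ω) (hy : y ∈ Ω)
    (hww : Matrix.of (w y) * invMat (g y) * Matrix.of (w y) = Matrix.of (w y)) (a b e : Fin 4) :
    secondForm g w y a b e = ∑ c, (invMat (g y) * Matrix.of (w y)) c a *
      (invMat (g y) * (Matrix.of (g y) - Matrix.of (w y)) * invMat (g y) *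
        Matrix.of (nabla2 g w y c)) e b := by
  set V : E4 → Mat4 := fun z => invMat (g z) * Matrix.of (w z) with hV
  have h1 : secondForm g w y a b e =
      ∑ d, (invMat (g y) * (Matrix.of (g y) - Matrix.of (w y))) e d *
        ∑ c, V y c a * (pdMat V c y + connMat g c y * V y) d b := by
    simp only [secondForm, hV, Matrix.mul_apply, Matrix.add_apply, Matrix.sub_apply, Matrix.of_apply,
      invMat, pdMat, connMat]
  have h2 : ∀ c, pdMat V c y + connMat g c y * V y =
      invMat (g y) * Matrix.of (nabla2 g w y c) + V y * connMat g c y := fun c => by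
    rw [hV, of_nabla2, pdMat_mul hg.isOpen hg.smooth_inv hw hy, hg.pdMat_inv hy]
    noncomm_ring
  have h3 : invMat (g y) * (Matrix.of (g y) - Matrix.of (w y)) * V y = 0 := by
    rw [hV, mul_assoc, sub_mul, ← mul_assoc, ← mul_assoc, hww, hg.mul_inv hy, one_mul, sub_self,
      mul_zero]
  rw [h1]
  simp only [Finset.mul_sum]
  rw [Finset.sum_comm]
  refine Finset.sum_congr rfl fun c _ => ?_
  have h4 : invMat (g y) * (Matrix.of (g y) - Matrix.of (w y)) * invMat (g y) *
      Matrix.of (nabla2 g w y c) = invMat (g y) * (Matrix.of (g y) - Matrix.of (w y)) *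
        (pdMat V c y + connMat g c y * V y) := by
    rw [h2, mul_add, ← mul_assoc _ (V y), h3, zero_mul, add_zero, mul_assoc _ (invMat (g y))]
  rw [h4, Matrix.mul_apply (N := pdMat V c y + connMat g c y * V y), Finset.mul_sum]
  exact Finset.sum_congr rfl fun d _ => by ring

/-- On a null vector `x` of the plane the umbilical condition has zero right-hand side, because it
is proportional to `w(x, x)`; what remains is the statement that `(∇_x w)(z, x)` vanishes for `z` in
the complementary plane. The vectors may be complex, which matters for the space-like plane. -/
theorem UmbilicalPlane.nabla2_eq_zero (hg : MetricOn g Ω) {w : E4 → Tensor2}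
    (hw : SmoothMat (fun z => Matrix.of (w z)) Ω) (hy : y ∈ Ω)
    (hww : Matrix.of (w y) * invMat (g y) * Matrix.of (w y) = Matrix.of (w y))
    (hU : UmbilicalPlane g w y) {x z : Fin 4 → ℂ}
    (hx : (invMat (g y) * Matrix.of (w y)) *ᵥ x = x) (hxx : x ⬝ᵥ Matrix.of (w y) *ᵥ x = 0)
    (hz : z ᵥ* ((Matrix.of (g y) - Matrix.of (w y)) * invMat (g y)) = z) :
    ∑ c, x c * (z ⬝ᵥ Matrix.of (nabla2 g w y c) *ᵥ x) = 0 := by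
  set M : Fin 4 → Mat4 := fun c => invMat (g y) * (Matrix.of (g y) - Matrix.of (w y)) *
    invMat (g y) * Matrix.of (nabla2 g w y c) with hM
  have hB : ∀ e, ∑ a, ∑ b, x a * x b * secondForm g w y a b e = ∑ c, x c * (M c *ᵥ x) e := by
    intro e
    have h1 : ∀ a b, x a * x b * secondForm g w y a b e =
        ∑ c, (invMat (g y) * Matrix.of (w y)) c a * x a * (M c e b * x b) := fun a b => by
      rw [secondForm_eq hg hw hy hww, Finset.mul_sum]
      exact Finset.sum_congr rfl fun c _ => by ring
    simp only [h1]
    rw [sum_rotate]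
    refine Finset.sum_congr rfl fun c _ => ?_
    rw [← Finset.sum_mul_sum]
    congr 1
    exact congrFun hx c
  have hB0 : ∀ e, ∑ a, ∑ b, x a * x b * secondForm g w y a b e = 0 := by
    intro e
    set t := ∑ c, ∑ d, inv (g y) c d * secondForm g w y c d e with ht
    have h1 : ∑ a, ∑ b, x a * x b * ((secondForm g w y a b e + secondForm g w y b a e) / 2) =
        ∑ a, ∑ b, x a * x b * (w y a b * t / 2) :=
      Finset.sum_congr rfl fun a _ => Finset.sum_congr rfl fun b _ => by rw [hU a b e]
    have h2 : ∑ a, ∑ b, x a * x b * (w y a b * t / 2) = 0 := by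
      have : ∑ a, ∑ b, x a * x b * (w y a b * t / 2) =
          (x ⬝ᵥ Matrix.of (w y) *ᵥ x) * (t / 2) := by
        simp only [dotProduct, Matrix.mulVec, Matrix.of_apply, Finset.sum_mul, Finset.mul_sum]
        exact Finset.sum_congr rfl fun a _ => Finset.sum_congr rfl fun b _ => by ring
      rw [this, hxx, zero_mul]
    have h3 : ∑ a, ∑ b, x a * x b * secondForm g w y b a e =
        ∑ a, ∑ b, x a * x b * secondForm g w y a b e := by
      rw [Finset.sum_comm]
      exact Finset.sum_congr rfl fun a _ => Finset.sum_congr rfl fun b _ => by ring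
    have h4 : ∑ a, ∑ b, x a * x b * ((secondForm g w y a b e + secondForm g w y b a e) / 2) =
        (∑ a, ∑ b, x a * x b * secondForm g w y a b e +
          ∑ a, ∑ b, x a * x b * secondForm g w y b a e) / 2 := by
      simp only [← Finset.sum_add_distrib, Finset.sum_div]
      exact Finset.sum_congr rfl fun a _ => Finset.sum_congr rfl fun b _ => by ring
    rw [h2, h4, h3] at h1
    linear_combination h1
  -- Since `z` is fixed by the complementary projector, inserting that projector before `∇w` loses
  -- nothing.
  have h5 : ∀ c, z ⬝ᵥ Matrix.of (nabla2 g w y c) *ᵥ x =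
      (z ᵥ* Matrix.of (g y)) ⬝ᵥ (M c *ᵥ x) := fun c => by
    rw [hM, ← Matrix.dotProduct_mulVec, Matrix.mulVec_mulVec, ← mul_assoc, ← mul_assoc, ← mul_assoc,
      hg.mul_inv hy, one_mul, ← Matrix.mulVec_mulVec,
      Matrix.dotProduct_mulVec z ((Matrix.of (g y) - Matrix.of (w y)) * invMat (g y)), hz]
  simp only [h5]
  simp only [dotProduct, Finset.mul_sum]
  rw [Finset.sum_comm]
  refine Finset.sum_eq_zero fun e _ => ?_
  have := hB0 e
  rw [hB] at this
  rw [← mul_zero ((z ᵥ* Matrix.of (g y)) e), ← this, Finset.mul_sum]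
  exact Finset.sum_congr rfl fun c _ => by ring

end

end TwoPlusTwo

namespace TwoPlusTwo

open Matrix

/-! ## Umbilical structures in an adapted null frame -/

/-- The signs of the eigenvalues of the conjugate of the canonical bivector in a null frame. -/
def conjSign : Fin 4 → ℂ := ![1, -1, -1, 1]

/-- The conjugate of the canonical self-dual bivector in an adapted null frame. -/
noncomputable def conjBivector : Tensor2 := fun a b =>
  conjSign a / (Real.sqrt 2 : ℂ) * nullMetric a b

/-- The metric of the planes of an adapted null frame selected by `ε`. -/
def planeMetric (ε : Fin 4 → ℂ) : Tensor2 := fun a b => ε a * nullMetric a b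

def timeIndicator : Fin 4 → ℂ := ![1, 1, 0, 0]

def spaceIndicator : Fin 4 → ℂ := ![0, 0, 1, 1]

theorem conjSign_dualIdx (a : Fin 4) : conjSign (dualIdx a) = -conjSign a := by
  fin_cases a <;> simp [conjSign, dualIdx]

theorem dot_conjBivector (A : Tensor2) (a b : Fin 4) :
    dot nullMetric A conjBivector a b = -(conjSign b / (Real.sqrt 2 : ℂ) * A a b) := by
  simp [dot_null, conjBivector, nullMetric, dualIdx_dualIdx, conjSign_dualIdx]
  ring

theorem conjBivector_dot (A : Tensor2) (a b : Fin 4) :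
    dot nullMetric conjBivector A a b = conjSign a / (Real.sqrt 2 : ℂ) * A a b := by
  simp [dot_null, conjBivector, nullMetric, dualIdx_dualIdx]

theorem dot_nullBivector_self (a b : Fin 4) :
    dot nullMetric nullBivector nullBivector a b = nullMetric a b / 2 := by
  rw [nullBivector_dot, nullBivector, ← mul_assoc, div_mul_div_comm, nullSign_mul_self, ← sq,
    sqrt_two_sq]
  ring

theorem dot_conjBivector_self (a b : Fin 4) :
    dot nullMetric conjBivector conjBivector a b = nullMetric a b / 2 := by
  have : conjSign a * conjSign a = 1 := by fin_cases a <;> simp [conjSign]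
  rw [conjBivector_dot, conjBivector, ← mul_assoc, div_mul_div_comm, this, ← sq, sqrt_two_sq]
  ring

theorem planeMetric_timeIndicator (a b : Fin 4) :
    planeMetric timeIndicator a b =
      nullMetric a b / 2 + dot nullMetric nullBivector conjBivector a b := by
  rw [nullBivector_dot, conjBivector, ← mul_assoc, div_mul_div_comm, ← sq, sqrt_two_sq, planeMetric]
  have : timeIndicator a = 1 / 2 + nullSign a * conjSign a / 2 := by
    fin_cases a <;> simp [timeIndicator, nullSign, conjSign] <;> norm_num
  rw [this]
  ring

theorem planeMetric_spaceIndicator (a b : Fin 4) :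
    planeMetric spaceIndicator a b = nullMetric a b - planeMetric timeIndicator a b := by
  have : spaceIndicator a = 1 - timeIndicator a := by
    fin_cases a <;> simp [timeIndicator, spaceIndicator]
  rw [planeMetric, planeMetric, this]
  ring

theorem invMat_act2_nullMetric {p q : Mat4} (hpq : p * q = 1) :
    invMat (act2 p nullMetric) = q * Matrix.of nullMetric * qᵀ := by
  have hqp : q * p = 1 := mul_eq_one_comm.1 hpq
  have hqp' : pᵀ * qᵀ = 1 := by rw [← Matrix.transpose_mul, hqp, Matrix.transpose_one]
  have h := mul_invMat_act2_mul (isUnit_det_of_mul_eq_one hpq) nullMetric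
  have h0 : invMat nullMetric = Matrix.of nullMetric := congrArg Matrix.of inv_nullMetric
  rw [← h0, ← h]
  calc invMat (act2 p nullMetric)
      = (q * p) * invMat (act2 p nullMetric) * (pᵀ * qᵀ) := by rw [hqp, hqp', one_mul, mul_one]
    _ = _ := by simp only [mul_assoc]

section

variable {g : E4 → Tensor2} {Ω : Set E4} {y : E4}

/-- An umbilical plane which is a coordinate plane of a null frame. -/
theorem UmbilicalPlane.act3_eq_zero (hg : MetricOn g Ω) {w : E4 → Tensor2}
    (hw : SmoothMat (fun z => Matrix.of (w z)) Ω) (hy : y ∈ Ω) (hU : UmbilicalPlane g w y)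
    {p q : Mat4} (hpq : p * q = 1) (hgp : g y = act2 p nullMetric) {ε : Fin 4 → ℂ}
    (hε : ∀ a, ε (dualIdx a) = ε a) (hεε : ∀ a, ε a * ε a = ε a)
    (hwp : w y = act2 p (planeMetric ε)) {i j : Fin 4} (hi : ε i = 1) (hj : ε j = 0) :
    act3 q (nabla2 g w y) i j i = 0 := by
  have hqp : q * p = 1 := mul_eq_one_comm.1 hpq
  have hqp' : qᵀ * pᵀ = 1 := by rw [← Matrix.transpose_mul, hpq, Matrix.transpose_one]
  have e1 : Matrix.of nullMetric * Matrix.of (planeMetric ε) = Matrix.diagonal ε := by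
    ext a b
    simp only [Matrix.mul_apply, Matrix.of_apply, sum_nullMetric_mul, planeMetric, hε]
    simp [nullMetric, dualIdx_dualIdx, Matrix.diagonal_apply, eq_comm]
  have e2 : (Matrix.of nullMetric - Matrix.of (planeMetric ε)) * Matrix.of nullMetric =
      Matrix.diagonal (1 - ε) := by
    ext a b
    have : ∀ m, (nullMetric a m - ε a * nullMetric a m) * nullMetric m b =
        nullMetric a m * ((1 - ε a) * nullMetric m b) := fun m => by ring
    simp only [Matrix.mul_apply, Matrix.sub_apply, Matrix.of_apply, planeMetric, this,
      sum_nullMetric_mul]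
    simp [nullMetric, dualIdx_dualIdx, Matrix.diagonal_apply, eq_comm]
  have hinv := invMat_act2_nullMetric hpq
  have hww : Matrix.of (w y) * invMat (g y) * Matrix.of (w y) = Matrix.of (w y) := by
    have e3 : dot nullMetric (planeMetric ε) (planeMetric ε) = planeMetric ε := by
      funext a b
      have : ∀ m, planeMetric ε a m * planeMetric ε (dualIdx m) b =
        nullMetric a m * (ε a * ε m * nullMetric (dualIdx m) b) := fun m => by
        simp only [planeMetric, hε]
        ring
      rw [dot_null]
      simp only [this, sum_nullMetric_mul, dualIdx_dualIdx, hε, hεε]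
      rfl
    rw [← of_dot, hgp, hwp, dot_act2 (isUnit_det_of_mul_eq_one hpq), e3]
  -- The columns of `q` are the vectors of the frame dual to the coframe `p`: the `i`-th lies in the
  -- plane, and the `j`-th in the complementary one.
  have hx : (invMat (g y) * Matrix.of (w y)) *ᵥ (q *ᵥ Pi.single i 1) = q *ᵥ Pi.single i 1 := by
    have : invMat (g y) * Matrix.of (w y) * q = q * Matrix.diagonal ε := by
      rw [hgp, hwp, hinv, of_act2, ← e1]
      calc q * Matrix.of nullMetric * qᵀ * (pᵀ * Matrix.of (planeMetric ε) * p) * q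
          = q * Matrix.of nullMetric * (qᵀ * pᵀ) * Matrix.of (planeMetric ε) * (p * q) := by
            simp only [mul_assoc]
        _ = _ := by rw [hqp', hpq, mul_one, mul_one, mul_assoc]
    rw [Matrix.mulVec_mulVec, this, ← Matrix.mulVec_mulVec, Matrix.diagonal_mulVec_single, hi,
      one_mul]
  have hxx : (q *ᵥ Pi.single i 1) ⬝ᵥ Matrix.of (w y) *ᵥ (q *ᵥ Pi.single i 1) = 0 := by
    have : qᵀ * Matrix.of (w y) * q = Matrix.of (planeMetric ε) := by
      rw [← act2_one (planeMetric ε), ← hpq, ← act2_act2, ← hwp, ← of_act2]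
    rw [Matrix.mulVec_mulVec, ← Matrix.vecMul_transpose, ← Matrix.dotProduct_mulVec,
      Matrix.mulVec_mulVec, ← mul_assoc, this]
    -- No index is its own dual, so every vector of the frame is null.
    have h0 : i ≠ dualIdx i := by fin_cases i <;> simp [dualIdx]
    simp [planeMetric, nullMetric, h0]
  have hz : (q *ᵥ Pi.single j 1) ᵥ* ((Matrix.of (g y) - Matrix.of (w y)) * invMat (g y)) =
      q *ᵥ Pi.single j 1 := by
    have : qᵀ * ((Matrix.of (g y) - Matrix.of (w y)) * invMat (g y)) =
        Matrix.diagonal (1 - ε) * qᵀ := by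
      rw [hgp, hwp, hinv, of_act2, of_act2, ← e2]
      calc qᵀ * ((pᵀ * Matrix.of nullMetric * p - pᵀ * Matrix.of (planeMetric ε) * p) *
            (q * Matrix.of nullMetric * qᵀ))
          = (qᵀ * pᵀ) * (Matrix.of nullMetric - Matrix.of (planeMetric ε)) * (p * q) *
            Matrix.of nullMetric * qᵀ := by noncomm_ring
        _ = _ := by rw [hqp', hpq, mul_one, one_mul]
    rw [← Matrix.vecMul_transpose, Matrix.vecMul_vecMul, this, ← Matrix.vecMul_vecMul,
      Matrix.single_vecMul_diagonal]
    simp [hj]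
  have := hU.nabla2_eq_zero hg hw hy hww hx hxx hz
  rw [← this, act3]
  refine Finset.sum_congr rfl fun c _ => ?_
  simp only [Matrix.mulVec_single_one, Matrix.col_apply]
  congr 1
  simp only [act2, dotProduct, Matrix.mulVec, Matrix.of_apply, Finset.mul_sum, Matrix.col_apply]
  exact Finset.sum_congr rfl fun _ _ => Finset.sum_congr rfl fun _ _ => by ring

/-- The fields `F`, `F'`, `v` are the canonical bivector, its conjugate and the projector on the
time-like plane, as seen from a null coframe `p` with dual frame `q`. -/
structure IsAdapted (g F F' v : Tensor2) (p q : Mat4) : Prop where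
  mul_eq_one : p * q = 1
  metric : g = act2 p nullMetric
  bivector : F = act2 p nullBivector
  conj : F' = act2 p conjBivector
  time : v = act2 p (planeMetric timeIndicator)

theorem act3_dot_left {p q : Mat4} (hpq : p * q = 1) (D : Tensor3) (A : Tensor2) (i m n : Fin 4) :
    act3 q (fun a => dot (act2 p nullMetric) (D a) (act2 p A)) i m n =
      dot nullMetric (act3 q D i) A m n := by
  have hq := isUnit_det_of_mul_eq_one (mul_eq_one_comm.1 hpq)
  have e : act3 q D i = fun m n => ∑ a, q a i * act2 q (D a) m n := rfl
  rw [e, dot_sum_left nullMetric (fun a => q a i) (fun a => act2 q (D a))]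
  refine Finset.sum_congr rfl fun a _ => ?_
  rw [← dot_act2 hq, act2_act2, act2_act2, hpq, act2_one, act2_one]

theorem act3_dot_right {p q : Mat4} (hpq : p * q = 1) (D : Tensor3) (A : Tensor2) (i m n : Fin 4) :
    act3 q (fun a => dot (act2 p nullMetric) (act2 p A) (D a)) i m n =
      dot nullMetric A (act3 q D i) m n := by
  have hq := isUnit_det_of_mul_eq_one (mul_eq_one_comm.1 hpq)
  have e : act3 q D i = fun m n => ∑ a, q a i * act2 q (D a) m n := rfl
  rw [e, dot_sum_right nullMetric (fun a => q a i) (fun a => act2 q (D a))]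
  refine Finset.sum_congr rfl fun a _ => ?_
  rw [← dot_act2 hq, act2_act2, act2_act2, hpq, act2_one, act2_one]

theorem act3_add (p : Mat4) (D D' : Tensor3) (a b c : Fin 4) :
    act3 p (fun i j k => D i j k + D' i j k) a b c = act3 p D a b c + act3 p D' a b c := by
  simp only [act3, act2_add, mul_add, Finset.sum_add_distrib]

theorem act3_neg (p : Mat4) (D : Tensor3) (a b c : Fin 4) :
    act3 p (fun i j k => -D i j k) a b c = -act3 p D a b c := by
  simp only [act3, act2_neg, mul_neg, Finset.sum_neg_distrib]

theorem act3_zero (p : Mat4) (a b c : Fin 4) : act3 p (fun _ _ _ => 0) a b c = 0 := by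
  simp [act3, act2]

/-- The derivative of the canonical bivector of an umbilical structure is of umbilical type. -/
theorem nabla2_eq_umbilicForm (hg : MetricOn g Ω) {F F' v : E4 → Tensor2}
    (hF : SmoothMat (fun z => Matrix.of (F z)) Ω) (hF' : SmoothMat (fun z => Matrix.of (F' z)) Ω)
    (hv : SmoothMat (fun z => Matrix.of (v z)) Ω)
    (hp : ∀ z ∈ Ω, ∃ p q, IsAdapted (g z) (F z) (F' z) (v z) p q) (hy : y ∈ Ω)
    (hUv : UmbilicalPlane g v y) (hUh : UmbilicalPlane g (fun z a b => g z a b - v z a b) y) :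
    nabla2 g F y = umbilicForm (g y) (F y) (codiff g F y) := by
  have hgg : ∀ a m n, nabla2 g (fun z a b => g z a b / 2) y a m n = 0 := fun a m n => by
    rw [nabla2_div_const hg.isOpen hg.smooth 2 hy, hg.nabla2_metric hy, zero_div]
  have hanti : ∀ z ∈ Ω, ∀ a b, F z a b = -F z b a := fun z hz a b => by
    obtain ⟨p, q, h⟩ := hp z hz
    rw [h.bivector, ← act2_swap, ← act2_neg]
    congr 1
    funext i j
    exact nullBivector_antisymm _ _
  have hFF : ∀ z ∈ Ω, dot (g z) (F z) (F z) = fun a b => g z a b / 2 := fun z hz => by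
    obtain ⟨p, q, h⟩ := hp z hz
    funext a b
    rw [h.bivector, h.metric, dot_act2 (isUnit_det_of_mul_eq_one h.mul_eq_one), ← act2_div_const]
    congr 1
    funext i j
    exact dot_nullBivector_self _ _
  have hFF' : ∀ z ∈ Ω, dot (g z) (F' z) (F' z) = fun a b => g z a b / 2 := fun z hz => by
    obtain ⟨p, q, h⟩ := hp z hz
    funext a b
    rw [h.conj, h.metric, dot_act2 (isUnit_det_of_mul_eq_one h.mul_eq_one), ← act2_div_const]
    congr 1
    funext i j
    exact dot_conjBivector_self _ _
  have hvF : ∀ z ∈ Ω, v z = fun a b => g z a b / 2 + dot (g z) (F z) (F' z) a b := fun z hz => by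
    obtain ⟨p, q, h⟩ := hp z hz
    funext a b
    rw [h.time, h.bivector, h.conj, h.metric, dot_act2 (isUnit_det_of_mul_eq_one h.mul_eq_one),
      ← act2_div_const, ← act2_add]
    congr 1
    funext i j
    exact planeMetric_timeIndicator _ _
  -- Differentiating `F·F = g/2` with `∇g = 0` shows that `∇F` anticommutes with `F`; the same is
  -- done for `F'` next.
  have d1 : ∀ a m n, dot (g y) (nabla2 g F y a) (F y) m n + dot (g y) (F y) (nabla2 g F y a) m n = 0 :=
    fun a m n => by
      rw [← hg.nabla2_dot hF hF hy, nabla2_congr hg.isOpen hFF hy, hgg]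
  have d2 : ∀ a m n, dot (g y) (nabla2 g F' y a) (F' y) m n +
      dot (g y) (F' y) (nabla2 g F' y a) m n = 0 := fun a m n => by
    rw [← hg.nabla2_dot hF' hF' hy, nabla2_congr hg.isOpen hFF' hy, hgg]
  have d3 : nabla2 g v y = fun a m n => dot (g y) (nabla2 g F y a) (F' y) m n +
      dot (g y) (F y) (nabla2 g F' y a) m n := by
    funext a m n
    have sg : SmoothMat (fun z => Matrix.of (fun a b => g z a b / 2)) Ω :=
      fun i j => (hg.smooth i j).div_const 2
    have sd : SmoothMat (fun z => Matrix.of (dot (g z) (F z) (F' z))) Ω := by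
      simp only [of_dot]
      exact (hF.mul hg.smooth_inv).mul hF'
    rw [← hg.nabla2_dot hF hF' hy, nabla2_congr hg.isOpen hvF hy, nabla2_add hg.isOpen sg sd hy, hgg,
      zero_add]
  have d4 : nabla2 g (fun z a b => g z a b - v z a b) y = fun a m n => -nabla2 g v y a m n := by
    funext a m n
    rw [nabla2_sub hg.isOpen hg.smooth hv hy, hg.nabla2_metric hy, zero_sub]
  obtain ⟨p, q, h⟩ := hp y hy
  have hpq := h.mul_eq_one
  -- Anticommutation with the conjugate bivector kills the components of `∇F'` on indices of
  -- different conjugate sign.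
  have e2 : ∀ i m n, (conjSign m - conjSign n) * act3 q (nabla2 g F' y) i m n = 0 := fun i m n => by
    have : act3 q (fun a m n => dot (g y) (nabla2 g F' y a) (F' y) m n +
        dot (g y) (F' y) (nabla2 g F' y a) m n) i m n = 0 := by
      simp only [d2, act3_zero]
    rw [act3_add, h.conj, h.metric, act3_dot_left hpq, act3_dot_right hpq, dot_conjBivector,
      conjBivector_dot] at this
    have hs := inv_ne_zero sqrt_two_ne_zero
    rw [← mul_right_inj' hs]
    linear_combination this
  have e3 : ∀ i m n, act3 q (nabla2 g v y) i m n =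
      -(conjSign n / (Real.sqrt 2 : ℂ) * act3 q (nabla2 g F y) i m n) +
        nullSign m / (Real.sqrt 2 : ℂ) * act3 q (nabla2 g F' y) i m n := fun i m n => by
    rw [d3, act3_add, h.conj, h.bivector, h.metric, act3_dot_left hpq, act3_dot_right hpq,
      dot_conjBivector, nullBivector_dot]
  -- For such indices only `∇F` contributes to `∇v`, with a nonzero factor, so a vanishing component
  -- of `∇v` is a vanishing component of `∇F`.
  have e4 : ∀ i m n, conjSign m - conjSign n ≠ 0 → conjSign n ≠ 0 →
      act3 q (nabla2 g v y) i m n = 0 → act3 q (nabla2 g F y) i m n = 0 := fun i m n h1 h2 h3 => by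
    rw [e3, (mul_eq_zero.1 (e2 i m n)).resolve_left h1, mul_zero, add_zero, neg_eq_zero] at h3
    exact (mul_eq_zero.1 h3).resolve_left (div_ne_zero h2 sqrt_two_ne_zero)
  have hh : (fun z a b => g z a b - v z a b) y = act2 p (planeMetric spaceIndicator) := by
    funext a b
    change g y a b - v y a b = _
    rw [h.metric, h.time, ← act2_sub]
    congr 1
    funext i j
    exact (planeMetric_spaceIndicator i j).symm
  have t1 : ∀ a, timeIndicator (dualIdx a) = timeIndicator a := fun a => by
    fin_cases a <;> simp [timeIndicator, dualIdx]
  have t2 : ∀ a, timeIndicator a * timeIndicator a = timeIndicator a := fun a => by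
    fin_cases a <;> simp [timeIndicator]
  have t3 : ∀ a, spaceIndicator (dualIdx a) = spaceIndicator a := fun a => by
    fin_cases a <;> simp [spaceIndicator, dualIdx]
  have t4 : ∀ a, spaceIndicator a * spaceIndicator a = spaceIndicator a := fun a => by
    fin_cases a <;> simp [spaceIndicator]
  have ev : ∀ i j, timeIndicator i = 1 → timeIndicator j = 0 →
      act3 q (nabla2 g v y) i j i = 0 := fun i j hi hj =>
    hUv.act3_eq_zero hg hv hy hpq h.metric t1 t2 h.time hi hj
  have eh : ∀ i j, spaceIndicator i = 1 → spaceIndicator j = 0 →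
      act3 q (nabla2 g v y) i j i = 0 := fun i j hi hj => by
    have := UmbilicalPlane.act3_eq_zero (w := fun z a b => g z a b - v z a b) hg
      (hg.smooth.sub hv) hy hUh hpq h.metric t3 t4 hh hi hj
    -- As `∇h = -∇v`, umbilicity of the second plane also constrains `∇v`.
    rw [d4, act3_neg, neg_eq_zero] at this
    exact this
  have hcod : codiff g F y = codiffOf (g y) (nabla2 g F y) := rfl
  rw [hcod, h.metric, h.bivector]
  rw [h.metric, h.bivector] at d1
  refine eq_umbilicForm hpq (nabla2_antisymm hg.isOpen hanti hy) d1 ?_ ?_ ?_ ?_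
  · exact e4 _ _ _ (by simp [conjSign]; norm_num) (by simp [conjSign])
      (ev 0 2 (by simp [timeIndicator]) (by simp [timeIndicator]))
  · exact e4 _ _ _ (by simp [conjSign]) (by simp [conjSign])
      (eh 2 0 (by simp [spaceIndicator]) (by simp [spaceIndicator]))
  · exact e4 _ _ _ (by simp [conjSign]) (by simp [conjSign])
      (ev 1 3 (by simp [timeIndicator]) (by simp [timeIndicator]))
  · exact e4 _ _ _ (by simp [conjSign]; norm_num) (by simp [conjSign])
      (eh 3 1 (by simp [spaceIndicator]) (by simp [spaceIndicator]))

/-! ### The Ricci identities and the equivalence in a chart -/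

theorem MetricOn.ricciIdentities_riemann (hg : MetricOn g Ω) {F : E4 → Tensor2}
    (hF : SmoothMat (fun z => Matrix.of (F z)) Ω) (hy : y ∈ Ω)
    (hanti : ∀ a b, F y a b = -F y b a) : RicciIdentities g F y (riemann g y) := by
  intro a b m n
  have hc : curvMat g b a y = -curvMat g a b y := by
    simp only [curvMat]
    abel
  have hsum : ∀ m n, ∑ k, ∑ l, F y m k * inv (g y) k l * riemann g y l n b a =
      -(Matrix.of (F y) * curvMat g a b y) m n := fun m n => by
    have : Matrix.of (F y) * curvMat g b a y =
        Matrix.of (F y) * invMat (g y) * (Matrix.of (g y) * curvMat g b a y) := by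
      rw [mul_assoc, ← mul_assoc (invMat (g y)), hg.inv_mul hy, one_mul]
    rw [← Matrix.neg_apply, ← mul_neg, ← hc, this]
    simp only [Matrix.mul_apply (M := Matrix.of (F y) * invMat (g y)), riemann_eq]
    simp only [Matrix.mul_apply (M := Matrix.of (F y)), Finset.sum_mul, invMat, Matrix.of_apply]
    rw [Finset.sum_comm]
  rw [hg.ricci_identity hF hy, hsum, hsum]
  have hT : (Matrix.of (F y))ᵀ = -Matrix.of (F y) := by
    ext i j
    exact hanti j i
  -- Antisymmetry of `F` turns the action of the curvature on the first index into the second term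
  -- of the identities, with `m` and `n` exchanged.
  have : (curvMat g a b y)ᵀ * Matrix.of (F y) = -(Matrix.of (F y) * curvMat g a b y)ᵀ := by
    rw [Matrix.transpose_mul, hT, mul_neg, neg_neg]
  rw [this]
  simp only [Matrix.sub_apply, Matrix.neg_apply, Matrix.transpose_apply]
  ring

theorem integrabilityEquations_iff {η : E4 → Tensor4} {F : E4 → Tensor2} {Rm : Tensor4} :
    IntegrabilityEquations g η F y Rm ↔ PointEquations (g y) (η y) (F y) (tensorT g F y) Rm := by
  constructor
  · rintro ⟨h1, h2, h3⟩
    exact ⟨by funext a b m n; exact h1 a b m n, by funext a b; exact h2 a b,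
      by funext a b; exact h3 a b⟩
  · rintro ⟨h1, h2, h3⟩
    exact ⟨fun a b m n => by rw [h1]; rfl, fun a b => by rw [h2], fun a b => by rw [h3]⟩

/-- The equivalence of the Ricci identities and the integrability equations, in a chart. -/
theorem ricciIdentities_iff (hg : MetricOn g Ω) {F F' v : E4 → Tensor2} {η : E4 → Tensor4}
    (hF : SmoothMat (fun z => Matrix.of (F z)) Ω) (hF' : SmoothMat (fun z => Matrix.of (F' z)) Ω)
    (hv : SmoothMat (fun z => Matrix.of (v z)) Ω)
    (hp : ∀ z ∈ Ω, ∃ p q, IsAdapted (g z) (F z) (F' z) (v z) p q)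
    (hη : ∀ z ∈ Ω, η z = volOfBivector (F z))
    (hUv : ∀ z ∈ Ω, UmbilicalPlane g v z)
    (hUh : ∀ z ∈ Ω, UmbilicalPlane g (fun z a b => g z a b - v z a b) z) (hy : y ∈ Ω) :
    (∀ Rm, IsCurvatureLike Rm → (RicciIdentities g F y Rm ↔ IntegrabilityEquations g η F y Rm)) ∧
      RicciIdentities g F y (riemann g y) := by
  obtain ⟨p, q, h⟩ := hp y hy
  have hpq := h.mul_eq_one
  have hanti : ∀ a b, F y a b = -F y b a := fun a b => by
    rw [h.bivector, ← act2_swap, ← act2_neg]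
    congr 1
    funext i j
    exact nullBivector_antisymm _ _
  have hK : ∀ z ∈ Ω, nabla2 g F z = umbilicForm (g z) (F z) (codiff g F z) := fun z hz =>
    nabla2_eq_umbilicForm hg hF hF' hv hp hz (hUv z hz) (hUh z hz)
  have hR : ∀ Rm, RicciIdentities g F y Rm ↔
      commutatorForm (act2 p nullMetric) (act2 p nullBivector) (tensorT g F y) =
        curvatureForm (act2 p nullMetric) (act2 p nullBivector) Rm := fun Rm => by
    rw [← h.metric, ← h.bivector]
    constructor
    · intro H
      funext a b m n
      rw [← nabla3_commutator hg hF hK hy hpq h.metric h.bivector]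
      exact H a b m n
    · intro H a b m n
      rw [nabla3_commutator hg hF hK hy hpq h.metric h.bivector, H]
      rfl
  have hriem := hg.ricciIdentities_riemann hF hy hanti
  refine ⟨fun Rm hRm => ?_, hriem⟩
  -- `T` depends only on the structure, so its trace is computed from the genuine Riemann tensor and
  -- then used for an arbitrary `Rm`.
  have hT := tr_eq_zero_of_commutatorForm_eq hpq (hg.isCurvatureLike_riemann hy) ((hR _).1 hriem)
  rw [hR, integrabilityEquations_iff, commutatorForm_eq_iff hpq hT hRm, ← volOfBivector_act2,
    ← h.metric, ← h.bivector, hη y hy]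

end

end TwoPlusTwo

namespace TwoPlusTwo

open Matrix

/-! ## Null coframes of a 2+2 structure -/

/-- The null coframe of an orthonormal coframe of orientation `ε`. -/
noncomputable def nullOfLorentz (ε : ℂ) : Mat4 :=
  !![1 / (Real.sqrt 2 : ℂ), 1 / (Real.sqrt 2 : ℂ), 0, 0;
    -(1 / (Real.sqrt 2 : ℂ)), 1 / (Real.sqrt 2 : ℂ), 0, 0;
    0, 0, 1 / (Real.sqrt 2 : ℂ), -(Complex.I * ε / (Real.sqrt 2 : ℂ));
    0, 0, 1 / (Real.sqrt 2 : ℂ), Complex.I * ε / (Real.sqrt 2 : ℂ)]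

noncomputable def lorentzOfNull (ε : ℂ) : Mat4 :=
  !![1 / (Real.sqrt 2 : ℂ), -(1 / (Real.sqrt 2 : ℂ)), 0, 0;
    1 / (Real.sqrt 2 : ℂ), 1 / (Real.sqrt 2 : ℂ), 0, 0;
    0, 0, 1 / (Real.sqrt 2 : ℂ), 1 / (Real.sqrt 2 : ℂ);
    0, 0, Complex.I * ε / (Real.sqrt 2 : ℂ), -(Complex.I * ε / (Real.sqrt 2 : ℂ))]

/-- The 2-form of the time-like plane in an adapted null frame. -/
noncomputable def planeForm : Tensor2 := fun a b =>
  (nullSign a + conjSign a) / 2 * nullMetric a b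

theorem nullOfLorentz_mul {ε : ℂ} (hε : ε * ε = 1) : nullOfLorentz ε * lorentzOfNull ε = 1 := by
  have h := sqrt_two_ne_zero
  have h2 := sqrt_two_sq
  have h3 : ε ^ 2 = 1 := by rw [sq, hε]
  ext i j
  fin_cases i <;> fin_cases j <;>
    simp [nullOfLorentz, lorentzOfNull, Matrix.mul_apply, Fin.sum_univ_four] <;> field_simp <;>
    simp only [h2, h3, Complex.I_sq] <;> norm_num

theorem act2_nullMetric (p : Mat4) (a b : Fin 4) :
    act2 p nullMetric a b = p 0 a * p 1 b + p 1 a * p 0 b + p 2 a * p 3 b + p 3 a * p 2 b := by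
  simp [act2, Fin.sum_univ_four, nullMetric, dualIdx]

theorem act2_planeForm (p : Mat4) (a b : Fin 4) :
    act2 p planeForm a b = p 0 a * p 1 b - p 1 a * p 0 b := by
  simp [act2, Fin.sum_univ_four, planeForm, nullMetric, dualIdx, nullSign, conjSign]
  ring

theorem act2_nullBivector (p : Mat4) (a b : Fin 4) :
    act2 p nullBivector a b = (p 0 a * p 1 b - p 1 a * p 0 b + p 2 a * p 3 b - p 3 a * p 2 b) /
      (Real.sqrt 2 : ℂ) := by
  simp [act2, Fin.sum_univ_four, nullBivector, nullMetric, dualIdx, nullSign]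
  ring

section

variable (ε : ℂ) (P : Mat4) (a : Fin 4)

theorem nullOfLorentz_mul_zero :
    (nullOfLorentz ε * P) 0 a = (P 0 a + P 1 a) / (Real.sqrt 2 : ℂ) := by
  simp [nullOfLorentz, Matrix.mul_apply, Fin.sum_univ_four]
  ring

theorem nullOfLorentz_mul_one :
    (nullOfLorentz ε * P) 1 a = (P 1 a - P 0 a) / (Real.sqrt 2 : ℂ) := by
  simp [nullOfLorentz, Matrix.mul_apply, Fin.sum_univ_four]
  ring

theorem nullOfLorentz_mul_two :
    (nullOfLorentz ε * P) 2 a = (P 2 a - Complex.I * ε * P 3 a) / (Real.sqrt 2 : ℂ) := by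
  simp [nullOfLorentz, Matrix.mul_apply, Fin.sum_univ_four]
  ring

theorem nullOfLorentz_mul_three :
    (nullOfLorentz ε * P) 3 a = (P 2 a + Complex.I * ε * P 3 a) / (Real.sqrt 2 : ℂ) := by
  simp [nullOfLorentz, Matrix.mul_apply, Fin.sum_univ_four]
  ring

end

theorem act2_nullOfLorentz_nullMetric {ε : ℂ} (hε : ε * ε = 1) (P : Mat4) (a b : Fin 4) :
    act2 (nullOfLorentz ε * P) nullMetric a b =
      -(P 0 a * P 0 b) + P 1 a * P 1 b + P 2 a * P 2 b + P 3 a * P 3 b := by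
  rw [act2_nullMetric]
  simp only [nullOfLorentz_mul_zero, nullOfLorentz_mul_one, nullOfLorentz_mul_two,
    nullOfLorentz_mul_three, div_mul_div_comm, ← sq, sqrt_two_sq]
  linear_combination P 3 a * P 3 b * hε - ε * ε * P 3 a * P 3 b * Complex.I_sq

theorem act2_nullOfLorentz_planeForm (ε : ℂ) (P : Mat4) (a b : Fin 4) :
    act2 (nullOfLorentz ε * P) planeForm a b = P 0 a * P 1 b - P 1 a * P 0 b := by
  rw [act2_planeForm]
  simp only [nullOfLorentz_mul_zero, nullOfLorentz_mul_one, div_mul_div_comm, ← sq, sqrt_two_sq]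
  ring

theorem act2_nullOfLorentz_nullBivector (ε : ℂ) (P : Mat4) (a b : Fin 4) :
    act2 (nullOfLorentz ε * P) nullBivector a b =
      (P 0 a * P 1 b - P 1 a * P 0 b + Complex.I * ε * (P 2 a * P 3 b - P 3 a * P 2 b)) /
        (Real.sqrt 2 : ℂ) := by
  rw [act2_nullBivector]
  simp only [nullOfLorentz_mul_zero, nullOfLorentz_mul_one, nullOfLorentz_mul_two,
    nullOfLorentz_mul_three, div_mul_div_comm, ← sq, sqrt_two_sq]
  ring

theorem det_submatrix_cons (P : Mat4) (a b c d : Fin 4) :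
    (P.submatrix id ![a, b, c, d]).det =
      (P 0 a * P 1 b - P 1 a * P 0 b) * (P 2 c * P 3 d - P 3 c * P 2 d)
      - (P 0 a * P 1 c - P 1 a * P 0 c) * (P 2 b * P 3 d - P 3 b * P 2 d)
      + (P 0 a * P 1 d - P 1 a * P 0 d) * (P 2 b * P 3 c - P 3 b * P 2 c)
      + (P 0 b * P 1 c - P 1 b * P 0 c) * (P 2 a * P 3 d - P 3 a * P 2 d)
      - (P 0 b * P 1 d - P 1 b * P 0 d) * (P 2 a * P 3 c - P 3 a * P 2 c)
      + (P 0 c * P 1 d - P 1 c * P 0 d) * (P 2 a * P 3 b - P 3 a * P 2 b) := by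
  simp [Matrix.det_succ_row_zero, Fin.sum_univ_succ, Fin.succAbove]
  ring

/-- The bivector is `(θ⁰∧θ¹ + iε θ²∧θ³)/√2` and each of the two plane forms squares to zero, so only
the cross term survives; it is the Laplace expansion of the determinant along the first two rows. -/
theorem volOfBivector_nullOfLorentz (ε : ℂ) (P : Mat4) (a b c d : Fin 4) :
    volOfBivector (act2 (nullOfLorentz ε * P) nullBivector) a b c d =
      ε * (P.submatrix id ![a, b, c, d]).det := by
  simp only [volOfBivector, act2_nullOfLorentz_nullBivector, div_mul_div_comm, ← sq, sqrt_two_sq,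
    det_submatrix_cons]
  linear_combination (-ε * ((P 0 a * P 1 b - P 1 a * P 0 b) * (P 2 c * P 3 d - P 3 c * P 2 d)
      - (P 0 a * P 1 c - P 1 a * P 0 c) * (P 2 b * P 3 d - P 3 b * P 2 d)
      + (P 0 a * P 1 d - P 1 a * P 0 d) * (P 2 b * P 3 c - P 3 b * P 2 c)
      + (P 0 b * P 1 c - P 1 b * P 0 c) * (P 2 a * P 3 d - P 3 a * P 2 d)
      - (P 0 b * P 1 d - P 1 b * P 0 d) * (P 2 a * P 3 c - P 3 a * P 2 c)
      + (P 0 c * P 1 d - P 1 c * P 0 d) * (P 2 a * P 3 b - P 3 a * P 2 b))) * Complex.I_sq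

/-- The dual of the form of one plane is a multiple of the form of the other. Hence `U - i *U` and
`U + i *U` are diagonal with the signs `nullSign` and `conjSign`. -/
theorem hodge_planeForm (a b : Fin 4) :
    hodge nullMetric (volOfBivector nullBivector) planeForm a b =
      Complex.I * ((nullSign a - conjSign a) / 2 * nullMetric a b) := by
  -- The form of the plane has only the components 01 and 10, and raising its indices exchanges
  -- them.
  have h : ∀ P : Tensor4, dapply nullMetric P planeForm a b = -(P a b 0 1 - P a b 1 0) / 2 :=
    fun P => by
      rw [dapply_null]
      simp [Fin.sum_univ_four, planeForm, nullMetric, dualIdx, nullSign, conjSign]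
      ring
  have h2 := sqrt_two_sq
  have h3 := sqrt_two_ne_zero
  rw [hodge, h]
  fin_cases a <;> fin_cases b <;>
    simp [volOfBivector, nullBivector, nullMetric, dualIdx, nullSign, conjSign] <;>
    field_simp <;> simp only [h2] <;> norm_num

theorem dot_planeForm (a b : Fin 4) :
    dot nullMetric planeForm planeForm a b = planeMetric timeIndicator a b := by
  rw [dot_null]
  fin_cases a <;> fin_cases b <;>
    simp [Fin.sum_univ_four, planeForm, nullMetric, dualIdx, nullSign, conjSign, planeMetric,
      timeIndicator]

/-- The fields of a 2+2 structure seen from an adapted null coframe. -/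
theorem isAdapted_of_planeForm {g U : Tensor2} {η : Tensor4} {p q : Mat4} (hpq : p * q = 1)
    (hg : g = act2 p nullMetric) (hU : U = act2 p planeForm)
    (hη : η = volOfBivector (act2 p nullBivector)) :
    IsAdapted g (sdBivector g η U)
      (fun a b => (U a b + Complex.I * hodge g η U a b) / (Real.sqrt 2 : ℂ)) (dot g U U) p q := by
  have hp := isUnit_det_of_mul_eq_one hpq
  have hh : hodge g η U = act2 p (hodge nullMetric (volOfBivector nullBivector) planeForm) := by
    rw [hodge, hg, hη, hU, volOfBivector_act2, dapply_act hp]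
    rfl
  refine ⟨hpq, hg, ?_, ?_, ?_⟩
  · funext a b
    rw [sdBivector, hh, hU, ← act2_const_mul, ← act2_sub, ← act2_div_const]
    congr 1
    funext i j
    rw [hodge_planeForm, planeForm, nullBivector]
    linear_combination (-(nullSign i - conjSign i) / 2 * nullMetric i j / (Real.sqrt 2 : ℂ)) *
      Complex.I_sq
  · funext a b
    rw [hh, hU, ← act2_const_mul, ← act2_add, ← act2_div_const]
    congr 1
    funext i j
    rw [hodge_planeForm, planeForm, conjBivector]
    linear_combination ((nullSign i - conjSign i) / 2 * nullMetric i j / (Real.sqrt 2 : ℂ)) *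
      Complex.I_sq
  · rw [hg, hU, dot_act2 hp]
    congr 1
    funext i j
    exact dot_planeForm i j

end TwoPlusTwo

namespace TwoPlusTwo

open Matrix

/-! ## 2+2 structures in a chart -/

theorem IsLorentzFrame.apply_eq {V : Type*} [AddCommGroup V] [Module ℝ V]
    {B : LinearMap.BilinForm ℝ V} {b : Module.Basis (Fin 4) ℝ V} (h : IsLorentzFrame B b)
    (u w : V) :
    B u w = -(b.coord 0 u * b.coord 0 w) + b.coord 1 u * b.coord 1 w + b.coord 2 u * b.coord 2 w
      + b.coord 3 u * b.coord 3 w := by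
  rw [← LinearMap.sum_repr_mul_repr_mul b b u w]
  simp [Finsupp.sum_fintype, Fin.sum_univ_four, h _ _]

section

variable {M : Type*} [TopologicalSpace M] [ChartedSpace E4 M]

/-- The components of the dual basis of `b` in the chart `e`. -/
noncomputable def coframeMat (e : OpenPartialHomeomorph M E4) (y : E4)
    (b : Module.Basis (Fin 4) ℝ (TangentSpace (𝓡 4) (e.symm y))) : Mat4 :=
  Matrix.of fun i a => (b.coord i (coordVec e y a) : ℂ)

/-- The inverse matrix holds the coordinates of the frame vectors, obtained with the differential of
the chart; that this differential is inverted by that of `e.symm` makes the coordinate vectors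
reproduce the frame. -/
theorem exists_coframeMat_mul_eq_one [IsManifold (𝓡 4) ∞ M] {e : OpenPartialHomeomorph M E4}
    (he : e ∈ atlas E4 M) {y : E4} (hy : y ∈ e.target)
    (b : Module.Basis (Fin 4) ℝ (TangentSpace (𝓡 4) (e.symm y))) :
    ∃ Q, coframeMat e y b * Q = 1 := by
  have : IsManifold (𝓡 4) 1 M := IsManifold.of_le (n := ∞) (by simp)
  have hd := mdifferentiable_of_mem_atlas (I := 𝓡 4) he
  have hinv := hd.symm_comp_deriv (e.map_target hy)
  rw [e.right_inv hy] at hinv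
  let L : TangentSpace (𝓡 4) (e.symm y) →L[ℝ] E4 := mfderiv (𝓡 4) (𝓡 4) e (e.symm y)
  let L' : E4 →L[ℝ] TangentSpace (𝓡 4) (e.symm y) := mfderiv (𝓡 4) (𝓡 4) e.symm y
  have hL : ∀ u, L' (L u) = u := fun u => DFunLike.congr_fun hinv u
  refine ⟨Matrix.of fun a j => (L (b j) a : ℂ), ?_⟩
  ext i j
  have hs : ∑ a, L (b j) a • coordVec e y a = b j := by
    have : L (b j) = ∑ a, L (b j) a • (EuclideanSpace.single a (1 : ℝ) : E4) := by
      ext k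
      simp [Finset.sum_apply, Pi.single_apply]
    conv_rhs => rw [← hL (b j), this, map_sum]
    simp only [map_smul]
    rfl
  have := congrArg (b.coord i) hs
  rw [map_sum] at this
  simp only [map_smul, smul_eq_mul] at this
  rw [Matrix.mul_apply]
  simp only [coframeMat, Matrix.of_apply, ← Complex.ofReal_mul, ← Complex.ofReal_sum,
    mul_comm (b.coord i _), this]
  simp only [Matrix.one_apply, Module.Basis.coord_apply, Module.Basis.repr_self,
    Finsupp.single_apply, eq_comm (a := j)]
  split_ifs <;> simp

/-- The orientation sign `ε = ±1` of the orthonormal frame is absorbed in the null coframe: changing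
it exchanges the two complex null covectors of the space-like plane. The volume element is then
always the one determined by the bivector. -/
theorem SpaceTime.exists_nullCoframe [IsManifold (𝓡 4) ∞ M] (S : SpaceTime M)
    {e : OpenPartialHomeomorph M E4} (he : e ∈ atlas E4 M) {y : E4} (hy : y ∈ e.target)
    {b : Module.Basis (Fin 4) ℝ (TangentSpace (𝓡 4) (e.symm y))}
    (hb : IsLorentzFrame (S.metric (e.symm y)) b) :
    ∃ ε p q, p * q = 1 ∧ p = nullOfLorentz ε * coframeMat e y b ∧ S.g e y = act2 p nullMetric ∧
      S.η e y = volOfBivector (act2 p nullBivector) := by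
  obtain ⟨Q, hQ⟩ := exists_coframeMat_mul_eq_one he hy b
  set ε : ℂ := (S.vol (e.symm y) b : ℂ) with hεdef
  have hε : ε * ε = 1 := by
    rcases S.vol_unit _ b hb with h | h <;> simp [hεdef, h]
  refine ⟨ε, _, Q * lorentzOfNull ε, ?_, rfl, ?_, ?_⟩
  · rw [mul_assoc, ← mul_assoc _ Q, hQ, one_mul, nullOfLorentz_mul hε]
  · funext i j
    rw [act2_nullOfLorentz_nullMetric hε]
    simp [SpaceTime.g, comp2, coframeMat, hb.apply_eq]
  · funext i j k l
    rw [volOfBivector_nullOfLorentz]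
    simp only [SpaceTime.η, comp4]
    rw [(S.vol (e.symm y)).eq_smul_basis_det b, AlternatingMap.smul_apply, smul_eq_mul,
      Complex.ofReal_mul, Module.Basis.det_apply, ← hεdef]
    congr 1
    have : (coframeMat e y b).submatrix id ![i, j, k, l] = (Complex.ofRealHom).mapMatrix
        (b.toMatrix ![coordVec e y i, coordVec e y j, coordVec e y k, coordVec e y l]) := by
      ext m n
      fin_cases n <;> rfl
    rw [this, ← RingHom.map_det]
    rfl

theorem SpaceTime.metricOn [IsManifold (𝓡 4) ∞ M] (S : SpaceTime M)
    {e : OpenPartialHomeomorph M E4} (he : e ∈ atlas E4 M) : MetricOn (S.g e) e.target where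
  isOpen := e.open_target
  symm z i j := by
    obtain ⟨b, hb⟩ := S.lorentz (e.symm z)
    simp only [SpaceTime.g, comp2, hb.apply_eq]
    push_cast
    ring
  isUnit_det z hz := by
    obtain ⟨b, hb⟩ := S.lorentz (e.symm z)
    obtain ⟨ε, p, q, hpq, -, hg, -⟩ := S.exists_nullCoframe he hz hb
    rw [hg]
    exact isUnit_det_act2_nullMetric hpq
  smooth := S.metric_smooth e he

variable {S : SpaceTime M}

/-- The conjugate of the canonical self-dual bivector. -/
noncomputable def Structure22.asd (U : Structure22 S) (e : OpenPartialHomeomorph M E4)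
    (z : E4) : Tensor2 := fun a b =>
  (comp2 U.form e z a b + Complex.I * hodge (S.g e z) (S.η e z) (comp2 U.form e z) a b) /
    (Real.sqrt 2 : ℂ)

/-- The null coframe is built on the orthonormal frame that exhibits `U` as `e⁰ ∧ e¹`. It is chosen
point by point: no smooth frame is needed, since only tensor fields are differentiated. -/
theorem Structure22.exists_isAdapted [IsManifold (𝓡 4) ∞ M] (U : Structure22 S)
    {e : OpenPartialHomeomorph M E4} (he : e ∈ atlas E4 M) {z : E4} (hz : z ∈ e.target) :
    ∃ p q, IsAdapted (S.g e z) (U.sd e z) (U.asd e z) (U.v e z) p q ∧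
      S.η e z = volOfBivector (U.sd e z) := by
  obtain ⟨b, hb, hU⟩ := U.unitary (e.symm z)
  obtain ⟨ε, p, q, hpq, hp, hg, hη⟩ := S.exists_nullCoframe he hz hb
  have hform : comp2 U.form e z = act2 p planeForm := by
    funext i j
    rw [hp, act2_nullOfLorentz_planeForm]
    simp [comp2, coframeMat, hU]
  have h := isAdapted_of_planeForm hpq hg hform hη
  exact ⟨p, q, h, hη.trans (congrArg volOfBivector h.bivector.symm)⟩

theorem Structure22.smooth_hodge [IsManifold (𝓡 4) ∞ M] (U : Structure22 S)
    {e : OpenPartialHomeomorph M E4} (he : e ∈ atlas E4 M) (a b : Fin 4) :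
    ContDiffOn ℝ ∞ (fun z => hodge (S.g e z) (S.η e z) (comp2 U.form e z) a b) e.target := by
  have hi := (S.metricOn he).smooth_inv
  exact ContDiffOn.div_const (ContDiffOn.sum fun m _ => ContDiffOn.sum fun n _ =>
    ContDiffOn.sum fun p _ => ContDiffOn.sum fun q _ =>
      (((S.vol_smooth e he a b p q).mul (hi p m)).mul (hi q n)).mul (U.form_smooth e he m n)) 2

end

end TwoPlusTwo

/-! ### The theorem on a space-time -/

theorem mainTheorem1 {M : Type*} [TopologicalSpace M] [ChartedSpace TwoPlusTwo.E4 M]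
    [IsManifold (𝓡 4) ∞ M] (S : TwoPlusTwo.SpaceTime M) (U : TwoPlusTwo.Structure22 S)
    (hU : U.IsUmbilical)
    (e : OpenPartialHomeomorph M TwoPlusTwo.E4) (he : e ∈ atlas TwoPlusTwo.E4 M)
    (y : TwoPlusTwo.E4) (hy : y ∈ e.target) :
    (∀ Rm : TwoPlusTwo.Tensor4, TwoPlusTwo.IsCurvatureLike Rm →
      (TwoPlusTwo.RicciIdentities (S.g e) (U.sd e) y Rm ↔
        TwoPlusTwo.IntegrabilityEquations (S.g e) (S.η e) (U.sd e) y Rm)) ∧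
    TwoPlusTwo.IsCurvatureLike (TwoPlusTwo.riemann (S.g e) y) ∧
    TwoPlusTwo.RicciIdentities (S.g e) (U.sd e) y (TwoPlusTwo.riemann (S.g e) y) ∧
    TwoPlusTwo.IntegrabilityEquations (S.g e) (S.η e) (U.sd e) y
      (TwoPlusTwo.riemann (S.g e) y) := by
  have hg := S.metricOn he
  have hform : TwoPlusTwo.SmoothMat (fun z => Matrix.of (TwoPlusTwo.comp2 U.form e z)) e.target :=
    U.form_smooth e he
  have hv : TwoPlusTwo.SmoothMat (fun z => Matrix.of (U.v e z)) e.target := by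
    simp only [TwoPlusTwo.Structure22.v, TwoPlusTwo.of_dot]
    exact (hform.mul hg.smooth_inv).mul hform
  have hsd : TwoPlusTwo.SmoothMat (fun z => Matrix.of (U.sd e z)) e.target := fun a b =>
    ((hform a b).sub (contDiffOn_const.mul (U.smooth_hodge he a b))).div_const _
  have hasd : TwoPlusTwo.SmoothMat (fun z => Matrix.of (U.asd e z)) e.target := fun a b =>
    ((hform a b).add (contDiffOn_const.mul (U.smooth_hodge he a b))).div_const _
  obtain ⟨h, hric⟩ := TwoPlusTwo.ricciIdentities_iff hg hsd hasd hv
    (fun z hz => by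
      obtain ⟨p, q, h, -⟩ := U.exists_isAdapted he hz
      exact ⟨p, q, h⟩)
    (fun z hz => by
      obtain ⟨p, q, -, h⟩ := U.exists_isAdapted he hz
      exact h)
    (fun z hz => (hU e he z hz).1) (fun z hz => (hU e he z hz).2) hy
  have hcurv := hg.isCurvatureLike_riemann hy
  exact ⟨h, hcurv, hric, (h _ hcurv).1 hric⟩
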